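/- \textbf{Theorem (The absorption theorem).} Let $X$ be the Cantor space. \emph{Definitions.} Let $Y$ be a compact metrizable zero-dimensional space. A subgroup $G\le \mathrm{Homeo}(Y)$ is a \emph{full group} if it contains every $g\in\mathrm{Homeo}(Y)$ for which there are a finite clopen partition $Y=\bigsqcup_{i=1}^n U_i$ and $\gamma_1,\dots,\gamma_n\in G$ with $g(x)=\gamma_i(x)$ for all $x\in U_i$ and all $i$. An \emph{ample group over $Y$} is a countable, locally finite full group $G\le\mathrm{Homeo}(Y)$ such that $\{x\in Y:\gamma(x)=x\}$ is clopen for every $\gamma\in G$. For a subgroup $\Gamma\le\mathrm{Homeo}(X)$, write $R_\Gamma$ for the equivalence relation on $X$ whose classes are the $\Gamma$-orbits; $\Gamma$ is \emph{minimal} if all its orbits are dense. A subset $K\subseteq X$ is \emph{$\Gamma$-malleable} if it is closed, $\mu(K)=0$ for every $\Gamma$-invariant Borel probability measure $\mu$ on $X$, and $K$ is \emph{$\Gamma$-étale}: for every $\gamma\in\Gamma$ and every clopen subset $A$ of $K$, the set $\gamma(A)\cap K$ is clopen in $K$. In that case, for every $\gamma\in\Gamma$ with $\gamma^2=1$, the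 map $\gamma_K\colon K\to K$ defined by $\gamma_K(x)=\gamma(x)$ if $\gamma(x)\in K$ and $\gamma_K(x)=x$ otherwise is a homeomorphism of $K$; let $\Gamma_K$ denote the smallest full subgroup of $\mathrm{Homeo}(K)$ that contains all these $\gamma_K$. For a subgroup $\Sigma\le\mathrm{Homeo}(K)$, let $R_\Gamma(K,\Sigma)$ be the finest equivalence relation $S$ on $X$ which is coarser than $R_\Gamma$ and satisfies $(x,\sigma x)\in S$ for all $x\in K$ and $\sigma\in\Sigma$. Two equivalence relations $R,S$ on $X$ are \emph{orbit equivalent} if there is a homeomorphism $h\colon X\to X$ with $(h\times h)(R)=S$. \emph{Statement.} Let $\Gamma\le\mathrm{Homeo}(X)$ be a minimal ample group over $X$, let $K\subseteq X$ be a $\Gamma$-malleable set, and let $\Sigma\le\mathrm{Homeo}(K)$ be an ample group over $K$ which contains $\Gamma_K$. Then $R_\Gamma(K,\Sigma)$ is orbit equivalent to $R_\Gamma$. -/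

import Mathlib

open Set MeasureTheory

namespace AmpleGroup

section Basic

variable {X : Type*} [TopologicalSpace X]

/-- The equivalence relation `R_Γ` on `X` whose classes are the `Γ`-orbits. -/
def orbitSetoid (Γ : Subgroup (X ≃ₜ X)) : Setoid X where
  r x y := ∃ γ ∈ Γ, γ x = y
  iseqv :=
    { refl := fun _ => ⟨1, Γ.one_mem, rfl⟩
      symm := by
        rintro x y ⟨γ, hγ, rfl⟩
        exact ⟨γ⁻¹, Γ.inv_mem hγ, γ.symm_apply_apply x⟩
      trans := by
        rintro x y z ⟨γ, hγ, rfl⟩ ⟨δ, hδ, rfl⟩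
        exact ⟨δ * γ, Γ.mul_mem hδ hγ, rfl⟩ }

/-- All orbits of `Γ` are dense. -/
def IsMinimal (Γ : Subgroup (X ≃ₜ X)) : Prop :=
  ∀ x : X, Dense {y : X | ∃ γ ∈ Γ, γ x = y}

/-- The full group `F(Γ)` generated by `Γ`, as a set of homeomorphisms: those which coincide, on
each piece of some finite clopen partition of `X`, with an element of `Γ`. -/
def fullGroup (Γ : Subgroup (X ≃ₜ X)) : Set (X ≃ₜ X) :=
  {g | ∃ (n : ℕ) (U : Fin n → Set X) (γ : Fin n → (X ≃ₜ X)),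
    (∀ i, IsClopen (U i)) ∧ Pairwise (fun i j => Disjoint (U i) (U j)) ∧ (⋃ i, U i) = univ ∧
      (∀ i, γ i ∈ Γ) ∧ ∀ i, ∀ x ∈ U i, g x = γ i x}

/-- `Γ` is a full group: `Γ = F(Γ)`. -/
def IsFull (Γ : Subgroup (X ≃ₜ X)) : Prop :=
  (Γ : Set (X ≃ₜ X)) = fullGroup Γ

/-- An ample group over `X`: a countable, locally finite full group of homeomorphisms of `X` such
that the fixed point set of each of its elements is clopen. -/
structure IsAmple (Γ : Subgroup (X ≃ₜ X)) : Prop where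
  countable : Countable Γ
  /-- every finitely generated subgroup is finite -/
  locallyFinite : ∀ F : Finset (X ≃ₜ X), (F : Set (X ≃ₜ X)) ⊆ Γ →
    (Subgroup.closure (F : Set (X ≃ₜ X)) : Set (X ≃ₜ X)).Finite
  full : IsFull Γ
  isClopen_fixedPoints : ∀ γ ∈ Γ, IsClopen {x : X | γ x = x}

/-- `K` has measure zero for every `Γ`-invariant Borel probability measure. -/
def IsThin [MeasurableSpace X] [BorelSpace X] (Γ : Subgroup (X ≃ₜ X)) (K : Set X) : Prop :=
  ∀ μ : Measure X, IsProbabilityMeasure μ → (∀ γ ∈ Γ, μ.map γ = μ) → μ K = 0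

/-- `K` is `Γ`-étale: `γ A ∩ K` is clopen in `K` for every `γ ∈ Γ` and every clopen subset `A`
of `K`. -/
def IsEtale (Γ : Subgroup (X ≃ₜ X)) (K : Set X) : Prop :=
  ∀ γ ∈ Γ, ∀ A : Set K, IsClopen A →
    IsClopen ((↑) ⁻¹' (γ '' ((↑) '' A : Set X)) : Set K)

/-- `K` is `Γ`-malleable: closed, `Γ`-thin and `Γ`-étale. -/
structure IsMalleable [MeasurableSpace X] [BorelSpace X] (Γ : Subgroup (X ≃ₜ X)) (K : Set X) :
    Prop where
  isClosed : IsClosed K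
  thin : IsThin Γ K
  etale : IsEtale Γ K

/-- `g = γ_K`, that is, `g x = γ x` if `γ x ∈ K` and `g x = x` otherwise. -/
def IsInducedMap (K : Set X) (γ : X ≃ₜ X) (g : K ≃ₜ K) : Prop :=
  ∀ x : K, (γ x ∈ K → (g x : X) = γ x) ∧ (γ x ∉ K → g x = x)

/-- If `K` is `Γ`-étale, then `γ_K` exists as a homeomorphism of `K` for every involution
`γ ∈ Γ`. -/
theorem exists_isInducedMap {Γ : Subgroup (X ≃ₜ X)} {K : Set X} (hK : IsEtale Γ K)
    {γ : X ≃ₜ X} (hγ : γ ∈ Γ) (hγ2 : γ * γ = 1) :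
    ∃ g : K ≃ₜ K, IsInducedMap K γ g := by
  classical
  have hinv : ∀ x, γ (γ x) = x := fun x => DFunLike.congr_fun hγ2 x
  have hcl : IsClopen {x : K | γ x ∈ K} := by
    convert hK γ hγ univ isClopen_univ using 1
    ext x
    simp only [mem_ofPred_eq, mem_preimage, mem_image, mem_univ, true_and]
    constructor
    · intro hx
      exact ⟨γ x, ⟨⟨γ x, hx⟩, rfl⟩, hinv x⟩
    · rintro ⟨y, ⟨z, rfl⟩, hz⟩
      rw [← hz, hinv]
      exact z.2
  let f : K → K := fun x => if h : γ x ∈ K then ⟨γ x, h⟩ else x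
  have hf1 : ∀ x : K, γ x ∈ K → (f x : X) = γ x := fun x h => by simp [f, h]
  have hf2 : ∀ x : K, γ x ∉ K → f x = x := fun x h => by simp [f, h]
  have hff : Function.Involutive f := by
    intro x
    by_cases h : γ x ∈ K
    · apply Subtype.ext
      rw [hf1 (f x) (by rw [hf1 x h, hinv]; exact x.2), hf1 x h, hinv]
    · rw [hf2 x h, hf2 x h]
  have hc : Continuous f := by
    rw [continuous_induced_rng]
    have : (Subtype.val ∘ f : K → X) = fun x => if x ∈ {x : K | γ x ∈ K} then γ x else x := by
      funext x
      by_cases h : γ x ∈ K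
      · simp [hf1 x h, h]
      · simp [hf2 x h, h]
    rw [this]
    refine continuous_if ?_ ?_ ?_
    · intro a ha
      have ha : a ∈ frontier {x : K | γ x ∈ K} := ha
      rw [hcl.frontier_eq] at ha
      exact ha.elim
    · exact (γ.continuous.comp continuous_subtype_val).continuousOn
    · exact continuous_subtype_val.continuousOn
  exact ⟨{ hff.toPerm with
    continuous_toFun := hc
    continuous_invFun := hc }, fun x => ⟨hf1 x, hf2 x⟩⟩

/-- The induced group `Γ_K`: the smallest full group of homeomorphisms of `K` which contains `γ_K`
for every involution `γ ∈ Γ`. -/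
def inducedGroup (Γ : Subgroup (X ≃ₜ X)) (K : Set X) : Subgroup (K ≃ₜ K) :=
  sInf {H : Subgroup (K ≃ₜ K) | IsFull H ∧
    ∀ γ ∈ Γ, γ * γ = 1 → ∀ g : K ≃ₜ K, IsInducedMap K γ g → g ∈ H}

/-- The relation `R_Γ(K, Δ)`: the finest equivalence relation on `X` which is coarser than `R_Γ`
and relates `x` to `δ x` for all `x ∈ K` and `δ ∈ Δ`. (In `Setoid X`, finer is smaller.) -/
def glue (Γ : Subgroup (X ≃ₜ X)) (K : Set X) (Δ : Subgroup (K ≃ₜ K)) : Setoid X :=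
  sInf {S : Setoid X | orbitSetoid Γ ≤ S ∧ ∀ δ ∈ Δ, ∀ x : K, S (x : X) (δ x : X)}

/-- `R` and `S` are orbit equivalent: some homeomorphism `h` of `X` satisfies `(h × h) R = S`. -/
def OrbitEquivalent (R S : Setoid X) : Prop :=
  ∃ h : X ≃ₜ X, ∀ x y : X, R x y ↔ S (h x) (h y)

end Basic

end AmpleGroup

/-!
The relation `R_Γ(K, Σ)` is compared with `R_Γ` by placing infinitely many copies of `K` in `X`, of
which the first one is `K` itself, and by shifting these copies, as in Hilbert's hotel.

A map `i : Y → X` is an étale embedding (`IsEtaleEmb`) of a space `Y` with a group `S` if the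
partial homeomorphisms which `Γ` induces on `Y` are locally those of `S`, and it is small
(`IsSmall`) if `Γ` can move its range into any nonempty clopen set. A malleable set `K` is such an
embedding, for the induced group `Γ_K`: an invariant measure charging `K` is obtained from averages
over finite orbits if `K` cannot be moved into some clopen set (`IsThin.isSmall`). Besides, the
proof rests on three facts.

* Existence (`IsAmple.exists_isEtaleEmb`): if `Γ` is minimal, then every `(Y, S)` with `S`
  countable, locally finite and with clopen fixed point sets has a small étale embedding,
  constructed as a limit of approximations by clopen sets.
* Extension (`IsEtaleEmb.exists_conj`): any two small étale embeddings of `(Y, S)` are conjugate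
  under a homeomorphism of `X` normalizing `Γ`. This is a back-and-forth argument in the style of
  Krieger, whose single step is `Matches.exists_step`; all modifications are made by involutions
  which swap clopen sets.
* Shrinking (`IsEtaleEmb.exists_shrink`): if `T ≤ S`, then a small étale embedding of `(Y, S)` for
  `Γ` is also one of `(Y, T)` for some ample subgroup `Λ` of `Γ` such that `R_Γ` is generated by
  `R_Λ` and the relation defined by `S` on the image of `Y`.

These facts are applied to `Y = K × ℕ∞`, where `Γ_K` acts on the level `K × {0}` and `Σ` on the
other levels (`levelGroup`). By existence and extension, `Y` has a small étale embedding which is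
the inclusion of `K` on the level `0`. Shrinking provides a group `Λ` for which `Γ_K` acts on all
the levels. Then `R_Γ` is generated by `R_Λ` and by `Σ` acting on the positive levels, whereas
`R_Γ(K, Σ)` is generated by `R_Λ` and by `Σ` acting on all the levels. By extension, the shift of
the levels is induced by a homeomorphism of `X` normalizing `Λ`, and this homeomorphism maps
`R_Γ(K, Σ)` to `R_Γ` (`IsAmple.exists_orbit_equiv`).
-/

open Filter Topology

namespace AmpleGroup

/-! ### Locally finite groups of homeomorphisms with clopen fixed point sets -/

section Basics

variable {X : Type*} [TopologicalSpace X]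

/-- A property of sets which passes to subsets and holds near each point of a profinite space holds
for all the classes of some finite clopen partition. -/
theorem exists_discreteQuotient_forall [CompactSpace X] [T2Space X] [TotallyDisconnectedSpace X]
    {p : Set X → Prop} (mono : ∀ s t, t ⊆ s → p s → p t) (hloc : ∀ x, ∃ U ∈ 𝓝 x, p U) :
    ∃ Q : DiscreteQuotient X, ∀ x, p {y | Q.toSetoid x y} := by
  have h : ∀ x, ∃ V : Set X, IsClopen V ∧ x ∈ V ∧ p V := by
    intro x
    obtain ⟨U, hU, hp⟩ := hloc x
    obtain ⟨V, hV, hx, hVU⟩ := compact_exists_isClopen_in_isOpen isOpen_interior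
      (mem_interior_iff_mem_nhds.2 hU)
    exact ⟨V, hV, hx, mono _ _ (hVU.trans interior_subset) hp⟩
  choose V hV hx hp using h
  obtain ⟨t, ht⟩ := isCompact_univ.elim_finite_subcover V (fun x => (hV x).isOpen)
    (fun x _ => mem_iUnion.2 ⟨x, hx x⟩)
  refine ⟨t.inf fun x => DiscreteQuotient.ofIsClopen (hV x), fun x => ?_⟩
  obtain ⟨y, hy, hxy⟩ := mem_iUnion₂.1 (ht (mem_univ x))
  refine mono _ _ ?_ (hp y)
  intro z hz
  have := (Finset.inf_le hy : t.inf (fun x => DiscreteQuotient.ofIsClopen (hV x)) ≤ _) hz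
  exact this.1 hxy

/-- Membership in a full group is a local matter. -/
theorem IsFull.mem_of_locally [CompactSpace X] [T2Space X] [TotallyDisconnectedSpace X]
    {Γ : Subgroup (X ≃ₜ X)} (hΓ : IsFull Γ) (g : X ≃ₜ X)
    (hg : ∀ x, ∃ γ ∈ Γ, ∀ᶠ y in 𝓝 x, g y = γ y) : g ∈ Γ := by
  obtain ⟨Q, hQ⟩ := exists_discreteQuotient_forall (X := X)
    (p := fun s => ∃ γ ∈ Γ, ∀ y ∈ s, g y = γ y)
    (fun s t hts ⟨γ, hγ, h⟩ => ⟨γ, hγ, fun y hy => h y (hts hy)⟩)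
    (fun x => by
      obtain ⟨γ, hγ, h⟩ := hg x
      exact ⟨_, h, γ, hγ, fun y hy => hy⟩)
  choose γ hγ h using hQ
  have : g ∈ fullGroup Γ := by
    let e := Finite.equivFin Q
    refine ⟨Nat.card Q, fun k => Q.proj ⁻¹' {e.symm k}, fun k => γ (Quotient.out (e.symm k)),
      fun k => Q.isClopen_preimage _, ?_, ?_, fun k => hγ _, ?_⟩
    · intro i j hij
      refine Disjoint.preimage _ ?_
      simpa using hij
    · ext x
      simp only [mem_iUnion, mem_univ, iff_true]
      exact ⟨e (Q.proj x), by simp⟩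
    · intro k x hx
      refine h _ x ?_
      have hx' : Q.proj x = e.symm k := hx
      rw [← hx']
      exact Quotient.mk_out (s := Q.toSetoid) x
  rw [← hΓ] at this
  exact this

theorem IsFull.exists_mem_of_involutive [CompactSpace X] [T2Space X] [TotallyDisconnectedSpace X]
    {Γ : Subgroup (X ≃ₜ X)} (hΓ : IsFull Γ) (f : X → X) (hf : Function.Involutive f)
    (hg : ∀ x, ∃ γ ∈ Γ, ∀ᶠ y in 𝓝 x, f y = γ y) : ∃ c ∈ Γ, ⇑c = f := by
  have hc : Continuous f := by
    rw [continuous_iff_continuousAt]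
    intro x
    obtain ⟨γ, -, h⟩ := hg x
    exact γ.continuous.continuousAt.congr (h.mono fun y hy => hy.symm)
  exact ⟨{ hf.toPerm with
    continuous_toFun := hc
    continuous_invFun := hc }, hΓ.mem_of_locally _ hg, rfl⟩

/-- The properties of an ample group other than fullness. -/
structure IsPreample (Γ : Subgroup (X ≃ₜ X)) : Prop where
  countable : Countable Γ
  locallyFinite : ∀ F : Finset (X ≃ₜ X), (F : Set (X ≃ₜ X)) ⊆ Γ →
    (Subgroup.closure (F : Set (X ≃ₜ X)) : Set (X ≃ₜ X)).Finite
  isClopen_fixedPoints : ∀ γ ∈ Γ, IsClopen {x : X | γ x = x}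

theorem IsAmple.isPreample {Γ : Subgroup (X ≃ₜ X)} (h : IsAmple Γ) : IsPreample Γ :=
  ⟨h.countable, h.locallyFinite, h.isClopen_fixedPoints⟩

theorem IsPreample.mono {Γ Δ : Subgroup (X ≃ₜ X)} (h : IsPreample Γ) (hΔ : Δ ≤ Γ) :
    IsPreample Δ where
  countable := by
    have := h.countable
    exact (Subgroup.inclusion_injective hΔ).countable
  locallyFinite F hF := h.locallyFinite F (hF.trans hΔ)
  isClopen_fixedPoints γ hγ := h.isClopen_fixedPoints γ (hΔ hγ)

theorem IsPreample.isClopen_eq {Γ : Subgroup (X ≃ₜ X)} (h : IsPreample Γ) {γ δ : X ≃ₜ X}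
    (hγ : γ ∈ Γ) (hδ : δ ∈ Γ) : IsClopen {x : X | γ x = δ x} := by
  convert h.isClopen_fixedPoints _ (Γ.mul_mem (Γ.inv_mem hδ) hγ) using 1
  ext x
  simp [Homeomorph.mul_apply, Homeomorph.inv_apply, Homeomorph.symm_apply_eq]

theorem IsPreample.eventually_eq {Γ : Subgroup (X ≃ₜ X)} (h : IsPreample Γ) {γ δ : X ≃ₜ X}
    (hγ : γ ∈ Γ) (hδ : δ ∈ Γ) {x : X} (hx : γ x = δ x) : ∀ᶠ y in 𝓝 x, γ y = δ y :=
  (h.isClopen_eq hγ hδ).isOpen.mem_nhds hx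

theorem IsPreample.exists_finite_le {Γ : Subgroup (X ≃ₜ X)} (h : IsPreample Γ)
    {F : Set (X ≃ₜ X)} (hF : F.Finite) (hFΓ : F ⊆ Γ) :
    ∃ G : Subgroup (X ≃ₜ X), Finite G ∧ G ≤ Γ ∧ F ⊆ G := by
  refine ⟨Subgroup.closure F, ?_, (Subgroup.closure_le _).2 hFΓ, Subgroup.subset_closure⟩
  have := h.locallyFinite hF.toFinset (by simpa using hFΓ)
  simp only [Finite.coe_toFinset] at this
  exact this.to_subtype

theorem IsPreample.exists_finite_ge {Γ G : Subgroup (X ≃ₜ X)} (h : IsPreample Γ) (hG : Finite G)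
    (hGΓ : G ≤ Γ) {F : Set (X ≃ₜ X)} (hF : F.Finite) (hFΓ : F ⊆ Γ) :
    ∃ G' : Subgroup (X ≃ₜ X), Finite G' ∧ G' ≤ Γ ∧ G ≤ G' ∧ F ⊆ G' := by
  obtain ⟨G', h1, h2, h3⟩ := h.exists_finite_le ((Set.toFinite (G : Set (X ≃ₜ X))).union hF)
    (union_subset hGΓ hFΓ)
  exact ⟨G', h1, h2, subset_union_left.trans h3, subset_union_right.trans h3⟩

theorem IsPreample.exists_exhaustion {Γ : Subgroup (X ≃ₜ X)} (h : IsPreample Γ) :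
    ∃ G : ℕ → Subgroup (X ≃ₜ X), Monotone G ∧ (∀ n, Finite (G n)) ∧ (∀ n, G n ≤ Γ) ∧
      ∀ γ ∈ Γ, ∃ n, γ ∈ G n := by
  have := h.countable
  obtain ⟨e, he⟩ := exists_surjective_nat Γ
  have hfin : ∀ n : ℕ, ((fun k => (e k : X ≃ₜ X)) '' Iio n).Finite := fun n =>
    (finite_Iio n).image _
  refine ⟨fun n => Subgroup.closure ((fun k => (e k : X ≃ₜ X)) '' Iio n), ?_, ?_, ?_, ?_⟩
  · intro m n hmn
    exact Subgroup.closure_mono (image_mono (Iio_subset_Iio hmn))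
  · intro n
    have := h.locallyFinite (hfin n).toFinset (by
      simp only [Finite.coe_toFinset]
      rintro _ ⟨k, -, rfl⟩
      exact (e k).2)
    simp only [Finite.coe_toFinset] at this
    exact this.to_subtype
  · intro n
    refine (Subgroup.closure_le _).2 ?_
    rintro _ ⟨k, -, rfl⟩
    exact (e k).2
  · intro γ hγ
    obtain ⟨k, hk⟩ := he ⟨γ, hγ⟩
    exact ⟨k + 1, Subgroup.subset_closure ⟨k, by simp, by simp [hk]⟩⟩

/-- A finite clopen partition adapted to the group `G`: it is `G`-invariant, and an element of `G`
which maps a point into its own class fixes this class pointwise. -/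
structure Adapted (G : Subgroup (X ≃ₜ X)) (Q : DiscreteQuotient X) : Prop where
  map : ∀ γ ∈ G, ∀ x y, Q.toSetoid x y → Q.toSetoid (γ x) (γ y)
  fix : ∀ γ ∈ G, ∀ x, Q.toSetoid x (γ x) → γ x = x

theorem Adapted.eq_of_rel {G : Subgroup (X ≃ₜ X)} {Q : DiscreteQuotient X} (h : Adapted G Q)
    {γ δ : X ≃ₜ X} (hγ : γ ∈ G) (hδ : δ ∈ G) {x y : X} (hxy : Q.toSetoid x y)
    (hx : Q.toSetoid (γ x) (δ y)) : γ x = δ x := by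
  have h1 := h.map _ (G.inv_mem hγ) _ _
    (Q.trans _ _ _ hx (h.map δ hδ _ _ (Q.symm _ _ hxy)))
  simp only [Homeomorph.inv_apply, Homeomorph.symm_apply_apply] at h1
  have h2 := h.fix _ (G.mul_mem (G.inv_mem hγ) hδ) x h1
  rw [Homeomorph.mul_apply, Homeomorph.inv_apply, Homeomorph.symm_apply_eq] at h2
  exact h2.symm

/-- Every finite clopen partition has an adapted refinement: a partition whose classes are fixed
pointwise or displaced by each element of the finite group `G` is made `G`-invariant. -/
theorem IsPreample.exists_adapted [CompactSpace X] [T2Space X] [TotallyDisconnectedSpace X]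
    {Γ : Subgroup (X ≃ₜ X)} (h : IsPreample Γ) (G : Subgroup (X ≃ₜ X)) (hG : Finite G)
    (hGΓ : G ≤ Γ) (Q₀ : DiscreteQuotient X) : ∃ Q ≤ Q₀, Adapted G Q := by
  obtain ⟨Q₁, hQ₁⟩ := exists_discreteQuotient_forall (X := X)
    (p := fun s => ∀ γ : G, (∀ x ∈ s, γ.1 x = x) ∨ ∀ x ∈ s, γ.1 x ∉ s)
    (fun s t hts hp γ => (hp γ).imp (fun h x hx => h x (hts hx))
      (fun h x hx hx' => h x (hts hx) (hts hx')))
    (fun x => by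
      have hx : ∀ γ : G, ∃ U ∈ 𝓝 x, (∀ x ∈ U, γ.1 x = x) ∨ ∀ x ∈ U, γ.1 x ∉ U := by
        intro γ
        by_cases hx : γ.1 x = x
        · exact ⟨_, (h.isClopen_fixedPoints _ (hGΓ γ.2)).isOpen.mem_nhds hx,
            Or.inl fun y hy => hy⟩
        · obtain ⟨u, v, hu, hv, hxu, hxv, huv⟩ := t2_separation hx
          refine ⟨v ∩ γ.1 ⁻¹' u, inter_mem (hv.mem_nhds hxv)
            (γ.1.continuous.continuousAt.preimage_mem_nhds (hu.mem_nhds hxu)), Or.inr ?_⟩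
          intro y hy hy'
          exact huv.le_bot ⟨hy.2, hy'.1⟩
      choose U hU hp using hx
      refine ⟨⋂ γ, U γ, Filter.iInter_mem.2 hU, fun γ => (hp γ).imp ?_ ?_⟩
      · exact fun h x hx => h x (mem_iInter.1 hx γ)
      · exact fun h x hx hx' => h x (mem_iInter.1 hx γ) (mem_iInter.1 hx' γ))
  have := Fintype.ofFinite G
  let Q : DiscreteQuotient X := Finset.univ.inf fun γ : G =>
    (Q₀ ⊓ Q₁).comap ⟨γ.1, γ.1.continuous⟩
  have hle : ∀ γ : G, ∀ x y, Q.toSetoid x y → (Q₀ ⊓ Q₁).toSetoid (γ.1 x) (γ.1 y) := fun γ x y hxy =>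
    (Finset.inf_le (Finset.mem_univ γ) : Q ≤ _) hxy
  have hge : ∀ x y, (∀ γ : G, (Q₀ ⊓ Q₁).toSetoid (γ.1 x) (γ.1 y)) → Q.toSetoid x y := by
    intro x y hxy
    have key : ∀ s : Finset G, (s.inf fun γ : G =>
        (Q₀ ⊓ Q₁).comap ⟨γ.1, γ.1.continuous⟩).toSetoid x y := by
      classical
      intro s
      induction s using Finset.induction_on with
      | empty => trivial
      | insert a s ha ih =>
        rw [Finset.inf_insert]
        exact ⟨hxy a, ih⟩
    exact key _
  refine ⟨Q, fun x y hxy => (hle 1 x y hxy).1, ?_, ?_⟩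
  · intro γ hγ x y hxy
    refine hge _ _ fun δ => ?_
    exact hle (δ * ⟨γ, hγ⟩) x y hxy
  · intro γ hγ x hx
    have h1 : Q₁.toSetoid x (γ x) := (hle 1 _ _ hx).2
    rcases hQ₁ x ⟨γ, hγ⟩ with h2 | h2
    · exact h2 x (Q₁.refl x)
    · exact absurd h1 (h2 x (Q₁.refl x))

/-- Finitely many disjoint partial homeomorphisms `α i : W i → α i '' W i` given by elements of an
ample group, with all the sources disjoint from all the ranges, are swapped by an involution in this
group. -/
theorem IsAmple.exists_swap [CompactSpace X] [T2Space X] [TotallyDisconnectedSpace X]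
    {Γ : Subgroup (X ≃ₜ X)} (hΓ : IsAmple Γ) {ι : Type*} [Finite ι] (W : ι → Set X)
    (α : ι → X ≃ₜ X) (hα : ∀ i, α i ∈ Γ) (hW : ∀ i, IsClopen (W i))
    (hd : ∀ i k x, x ∈ W i → x ∈ W k → i = k)
    (hd' : ∀ i k x y, x ∈ W i → y ∈ W k → α i x = α k y → i = k)
    (hdd : ∀ i k x, x ∈ W i → α i x ∉ W k) :
    ∃ c ∈ Γ, (∀ x, c (c x) = x) ∧ (∀ i, ∀ x ∈ W i, c x = α i x) ∧
      (∀ i, ∀ x ∈ W i, c (α i x) = x) ∧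
      ∀ x, (∀ i, x ∉ W i ∧ ∀ y ∈ W i, α i y ≠ x) → c x = x := by
  classical
  let f : X → X := fun x => if h : ∃ i, x ∈ W i then α h.choose x else
    if h : ∃ i, ∃ y ∈ W i, α i y = x then (α h.choose).symm x else x
  have f1 : ∀ i, ∀ x ∈ W i, f x = α i x := by
    intro i x hx
    have h : ∃ i, x ∈ W i := ⟨i, hx⟩
    have : h.choose = i := hd _ _ x h.choose_spec hx
    simp only [f, dif_pos h, this]
  have f2 : ∀ i, ∀ x ∈ W i, f (α i x) = x := by
    intro i x hx
    have h' : ¬ ∃ k, α i x ∈ W k := fun ⟨k, hk⟩ => hdd i k x hx hk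
    have h : ∃ k, ∃ y ∈ W k, α k y = α i x := ⟨i, x, hx, rfl⟩
    obtain ⟨y, hy, hyx⟩ := h.choose_spec
    have : h.choose = i := hd' _ _ y x hy hx hyx
    simp only [f, dif_neg h', dif_pos h, this, Homeomorph.symm_apply_apply]
  have f3 : ∀ x, (∀ i, x ∉ W i ∧ ∀ y ∈ W i, α i y ≠ x) → f x = x := by
    intro x hx
    have h1 : ¬ ∃ i, x ∈ W i := fun ⟨i, hi⟩ => (hx i).1 hi
    have h2 : ¬ ∃ i, ∃ y ∈ W i, α i y = x := fun ⟨i, y, hy, h⟩ => (hx i).2 y hy h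
    simp only [f, dif_neg h1, dif_neg h2]
  have cases : ∀ x, (∃ i, x ∈ W i) ∨ (∃ i, ∃ y ∈ W i, α i y = x) ∨
      ∀ i, x ∉ W i ∧ ∀ y ∈ W i, α i y ≠ x := by
    intro x
    by_cases h1 : ∃ i, x ∈ W i
    · exact Or.inl h1
    by_cases h2 : ∃ i, ∃ y ∈ W i, α i y = x
    · exact Or.inr (Or.inl h2)
    · exact Or.inr (Or.inr fun i => ⟨fun h => h1 ⟨i, h⟩, fun y hy h => h2 ⟨i, y, hy, h⟩⟩)
  have hff : Function.Involutive f := by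
    intro x
    rcases cases x with ⟨i, hi⟩ | ⟨i, y, hy, rfl⟩ | h
    · rw [f1 i x hi, f2 i x hi]
    · rw [f2 i y hy, f1 i y hy]
    · rw [f3 x h, f3 x h]
  clear_value f
  obtain ⟨c, hc, rfl⟩ := hΓ.full.exists_mem_of_involutive f hff (by
    intro x
    rcases cases x with ⟨i, hi⟩ | ⟨i, y, hy, rfl⟩ | h
    · exact ⟨α i, hα i, (hW i).isOpen.mem_nhds hi |> fun h => mem_of_superset h (f1 i)⟩
    · refine ⟨(α i)⁻¹, Γ.inv_mem (hα i), ?_⟩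
      have : α i '' W i ∈ 𝓝 (α i y) :=
        ((α i).isOpenMap _ (hW i).isOpen).mem_nhds (mem_image_of_mem _ hy)
      refine mem_of_superset this ?_
      rintro _ ⟨z, hz, rfl⟩
      change f (α i z) = (α i)⁻¹ (α i z)
      rw [f2 i z hz]
      simp
    · refine ⟨1, Γ.one_mem, ?_⟩
      have hcl : IsClosed (⋃ i, W i ∪ α i '' W i) := isClosed_iUnion_of_finite fun i =>
        (hW i).isClosed.union ((α i).isClosedMap _ (hW i).isClosed)
      have hx : x ∉ ⋃ i, W i ∪ α i '' W i := by
        simp only [mem_iUnion, mem_union, mem_image, not_exists, not_or]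
        exact fun i => ⟨(h i).1, fun y hy => (h i).2 y hy.1 hy.2⟩
      refine mem_of_superset (hcl.isOpen_compl.mem_nhds hx) ?_
      intro z hz
      simp only [mem_compl_iff, mem_iUnion, mem_union, mem_image, not_exists, not_or] at hz
      exact f3 z fun i => ⟨(hz i).1, fun y hy h => (hz i).2 y ⟨hy, h⟩⟩)
  exact ⟨c, hc, hff, f1, f2, f3⟩

/-- The case of a single partial homeomorphism. -/
theorem IsAmple.exists_swap_one [CompactSpace X] [T2Space X] [TotallyDisconnectedSpace X]
    {Γ : Subgroup (X ≃ₜ X)} (hΓ : IsAmple Γ) {W : Set X} {α : X ≃ₜ X} (hα : α ∈ Γ)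
    (hW : IsClopen W) (hd : ∀ x ∈ W, α x ∉ W) :
    ∃ c ∈ Γ, (∀ x, c (c x) = x) ∧ (∀ x ∈ W, c x = α x) ∧ (∀ x ∈ W, c (α x) = x) ∧
      ∀ x, x ∉ W → (∀ y ∈ W, α y ≠ x) → c x = x := by
  obtain ⟨c, h1, h2, h3, h4, h5⟩ := hΓ.exists_swap (fun _ : Unit => W) (fun _ => α) (fun _ => hα)
    (fun _ => hW) (fun _ _ _ _ _ => rfl) (fun _ _ _ _ _ _ _ => rfl) (fun _ _ x hx => hd x hx)
  exact ⟨c, h1, h2, h3 (), h4 (), fun x hx hy => h5 x fun _ => ⟨hx, hy⟩⟩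

end Basics

/-! ### Thin sets can be moved into any nonempty clopen set -/

section Thin

variable {X Y : Type*} [TopologicalSpace X]

/-- The range of `i` can be moved into any nonempty clopen set by some element of `Γ`. For the
inclusion of a closed set and a minimal ample group this amounts to thinness. -/
def IsSmall (Γ : Subgroup (X ≃ₜ X)) (i : Y → X) : Prop :=
  ∀ B : Set X, IsClopen B → B.Nonempty → ∃ γ ∈ Γ, ∀ y, γ (i y) ∈ B

/-- A greedy matching, inside the orbits of a finite group `G`, of a clopen set `A` with a disjoint
clopen set `D`, where the elements of the list `l` have been tried one after the other. The matched
part of `A` is `A₁`, and the involution `c` swaps it with the matched part of `D`. -/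
theorem IsAmple.exists_matching [CompactSpace X] [T2Space X] [TotallyDisconnectedSpace X]
    {Γ : Subgroup (X ≃ₜ X)} (hΓ : IsAmple Γ) {G : Subgroup (X ≃ₜ X)} (hGΓ : G ≤ Γ)
    {A D : Set X} (hA : IsClopen A) (hD : IsClopen D) (hAD : ∀ x ∈ A, x ∉ D)
    (l : List (X ≃ₜ X)) (hl : ∀ γ ∈ l, γ ∈ G) :
    ∃ A₁ ⊆ A, IsClopen A₁ ∧ ∃ c ∈ Γ, (∀ x, c (c x) = x) ∧ (∀ x ∈ A₁, c x ∈ D) ∧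
      (∀ x, x ∉ A₁ → c x ∉ A₁ → c x = x) ∧ (∀ x, ∃ γ ∈ G, c x = γ x) ∧
      ∀ γ ∈ l, ∀ x ∈ A, x ∉ A₁ → γ x ∈ D → c (γ x) ∈ A₁ := by
  induction l with
  | nil =>
    exact ⟨∅, empty_subset _, isClopen_empty, 1, Γ.one_mem, fun _ => rfl, by simp,
      fun _ _ _ => rfl, fun _ => ⟨1, G.one_mem, rfl⟩, by simp⟩
  | cons γ₀ l ih =>
    obtain ⟨A₁, hA₁, hA₁c, c, hc, hcc, hcD, hcid, hcG, hcl⟩ :=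
      ih fun γ hγ => hl γ (List.mem_cons_of_mem _ hγ)
    have hγ₀ : γ₀ ∈ G := hl γ₀ List.mem_cons_self
    let W : Set X := A ∩ A₁ᶜ ∩ γ₀ ⁻¹' (D ∩ c ⁻¹' A₁ᶜ)
    have hW : IsClopen W := (hA.inter hA₁c.compl).inter
      ((hD.inter (hA₁c.compl.preimage c.continuous)).preimage γ₀.continuous)
    obtain ⟨s, hs, hss, hs1, hs2, hs3⟩ := hΓ.exists_swap_one (hGΓ hγ₀) hW
      (fun x hx hx' => hAD _ hx'.1.1 hx.2.1)
    have hcW : ∀ x ∈ W, c x = x := fun x hx =>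
      hcid x hx.1.2 fun h => hAD x hx.1.1 (by simpa [hcc] using hcD _ h)
    have hcW' : ∀ x ∈ W, c (γ₀ x) = γ₀ x := fun x hx =>
      hcid _ (fun h => hAD _ (hA₁ h) hx.2.1) hx.2.2
    have cases : ∀ x, x ∈ W ∨ (∃ y ∈ W, γ₀ y = x) ∨ (x ∉ W ∧ (∀ y ∈ W, γ₀ y ≠ x)) := by
      intro x
      by_cases h1 : x ∈ W
      · exact Or.inl h1
      by_cases h2 : ∃ y ∈ W, γ₀ y = x
      · exact Or.inr (Or.inl h2)
      · exact Or.inr (Or.inr ⟨h1, fun y hy h => h2 ⟨y, hy, h⟩⟩)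
    have e1 : ∀ x ∈ W, c (s x) = γ₀ x := fun x hx => by rw [hs1 x hx, hcW' x hx]
    have e2 : ∀ x ∈ W, c (s (γ₀ x)) = x := fun x hx => by rw [hs2 x hx, hcW x hx]
    have e3 : ∀ x, x ∉ W → (∀ y ∈ W, γ₀ y ≠ x) → c (s x) = c x := fun x h1 h2 => by
      rw [hs3 x h1 h2]
    have hA₁W : ∀ x ∈ A₁, x ∉ W ∧ ∀ y ∈ W, γ₀ y ≠ x := by
      refine fun x hx => ⟨fun h => h.1.2 hx, ?_⟩
      rintro y hy rfl
      exact hAD _ (hA₁ hx) hy.2.1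
    refine ⟨A₁ ∪ W, union_subset hA₁ fun x hx => hx.1.1, hA₁c.union hW, c * s, Γ.mul_mem hc hs,
      ?_, ?_, ?_, ?_, ?_⟩
    · intro x
      change c (s (c (s x))) = x
      rcases cases x with h | ⟨y, hy, rfl⟩ | ⟨h1, h2⟩
      · rw [e1 x h, e2 x h]
      · rw [e2 y hy, e1 y hy]
      · rw [e3 x h1 h2, e3, hcc]
        · intro h
          refine h1 ?_
          have := hcW _ h
          rw [hcc] at this
          rwa [this]
        · intro y hy h
          refine h2 y hy ?_
          have := hcW' _ hy
          rw [h, hcc] at this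
          exact h.trans this.symm
    · rintro x (hx | hx)
      · change c (s x) ∈ D
        rw [e3 x (hA₁W x hx).1 (hA₁W x hx).2]
        exact hcD x hx
      · change c (s x) ∈ D
        rw [e1 x hx]
        exact hx.2.1
    · intro x hx hx'
      change c (s x) ∉ _ at hx'
      change c (s x) = x
      rcases cases x with h | ⟨y, hy, rfl⟩ | ⟨h1, h2⟩
      · exact absurd (Or.inr h) hx
      · rw [e2 y hy] at hx'
        exact absurd (Or.inr hy) hx'
      · rw [e3 x h1 h2] at hx' ⊢
        exact hcid x (fun h => hx (Or.inl h)) fun h => hx' (Or.inl h)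
    · intro x
      change ∃ γ ∈ G, c (s x) = γ x
      rcases cases x with h | ⟨y, hy, rfl⟩ | ⟨h1, h2⟩
      · exact ⟨γ₀, hγ₀, e1 x h⟩
      · exact ⟨γ₀⁻¹, G.inv_mem hγ₀, by rw [e2 y hy]; simp⟩
      · rw [e3 x h1 h2]
        exact hcG x
    · intro γ hγ x hxA hx hxD
      change c (s (γ x)) ∈ _
      simp only [mem_union, not_or] at hx
      rcases List.mem_cons.1 hγ with rfl | hγ
      · have : c (γ x) ∈ A₁ := by
          by_contra h
          exact hx.2 ⟨⟨hxA, hx.1⟩, hxD, h⟩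
        left
        rw [e3]
        · exact this
        · exact fun h => hAD _ h.1.1 hxD
        · intro y hy h
          rw [← h, hcW' y hy] at this
          exact hAD _ (hA₁ this) hy.2.1
      · have := hcl γ hγ x hxA hx.1 hxD
        left
        rw [e3]
        · exact this
        · exact fun h => hAD _ h.1.1 hxD
        · intro y hy h
          rw [← h, hcW' y hy] at this
          exact hAD _ (hA₁ this) hy.2.1

open Classical in
/-- If a clopen set `U` cannot be moved into a clopen set `B`, then for each finite subgroup `G`
some `G`-orbit has more points in `U` than in `B`: otherwise a greedy matching of `U \ B` with
`B \ U` inside the `G`-orbits would exhaust `U \ B`. -/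
theorem IsAmple.exists_card_lt [CompactSpace X] [T2Space X] [TotallyDisconnectedSpace X]
    {Γ : Subgroup (X ≃ₜ X)} (hΓ : IsAmple Γ) {G : Subgroup (X ≃ₜ X)} [Fintype G] (hGΓ : G ≤ Γ)
    {U B : Set X} (hU : IsClopen U) (hB : IsClopen B) (h : ∀ γ ∈ Γ, ∃ x ∈ U, γ x ∉ B) :
    ∃ x, (Finset.univ.filter fun γ : G => γ.1 x ∈ B).card <
      (Finset.univ.filter fun γ : G => γ.1 x ∈ U).card := by
  obtain ⟨A₁, hA₁, -, c, hc, hcc, hcD, hcid, hcG, hcl⟩ := hΓ.exists_matching hGΓ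
    (hU.diff hB) (hB.diff hU) (fun x hx hx' => hx.2 hx'.1)
    ((Finset.univ : Finset G).toList.map Subtype.val) (by simp)
  obtain ⟨x, hxU, hxB⟩ := h c hc
  have hx₁ : x ∉ A₁ := fun hx => hxB (hcD x hx).1
  have hxA : x ∈ U \ B := by
    refine ⟨hxU, fun hB' => hxB ?_⟩
    rw [hcid x hx₁ fun h => (hcD _ h).2 (by rwa [hcc])]
    exact hB'
  choose f hf hfc using hcG
  -- an injection of the visits of the orbit to `B` into its visits to `U` other than that to `x`
  let Φ : G → G := fun γ => ⟨f (γ.1 x), hf _⟩ * γ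
  have hΦ : ∀ γ, (Φ γ).1 x = c (γ.1 x) := fun γ => (hfc _).symm
  have hΦi : Function.Injective Φ := by
    intro γ δ hγδ
    have h1 : c (γ.1 x) = c (δ.1 x) := by rw [← hΦ, ← hΦ, hγδ]
    have h2 : γ.1 x = δ.1 x := c.injective h1
    simp only [Φ, h2] at hγδ
    exact mul_left_cancel hγδ
  refine ⟨x, ?_⟩
  let Ψ : G → G := fun γ => if γ.1 x ∈ U then γ else Φ γ
  have key : ∀ γ : G, γ.1 x ∈ B → γ.1 x ∉ U → c (γ.1 x) ∈ A₁ := fun γ hγ hγ' =>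
    hcl γ.1 (by simp) x hxA hx₁ ⟨hγ, hγ'⟩
  have hmaps : ∀ γ ∈ Finset.univ.filter (fun γ : G => γ.1 x ∈ B),
      Ψ γ ∈ (Finset.univ.filter fun γ : G => γ.1 x ∈ U).erase 1 := by
    intro γ hγ
    have hγB : γ.1 x ∈ B := (Finset.mem_filter.1 hγ).2
    rw [Finset.mem_erase, Finset.mem_filter]
    by_cases hγU : γ.1 x ∈ U
    · simp only [Ψ, if_pos hγU]
      refine ⟨?_, Finset.mem_univ _, hγU⟩
      rintro rfl
      exact hxA.2 hγB
    · simp only [Ψ, if_neg hγU]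
      have h1 := key γ hγB hγU
      rw [← hΦ] at h1
      refine ⟨?_, Finset.mem_univ _, (hA₁ h1).1⟩
      intro h2
      rw [h2] at h1
      exact hx₁ h1
  have hinj : Set.InjOn Ψ (Finset.univ.filter (fun γ : G => γ.1 x ∈ B)) := by
    intro γ hγ δ hδ hγδ
    have hγB : γ.1 x ∈ B := (Finset.mem_filter.1 hγ).2
    have hδB : δ.1 x ∈ B := (Finset.mem_filter.1 hδ).2
    by_cases hγU : γ.1 x ∈ U <;> by_cases hδU : δ.1 x ∈ U
    · simpa [Ψ, hγU, hδU] using hγδ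
    · simp only [Ψ, hγU, hδU, if_true, if_false] at hγδ
      have h1 := key δ hδB hδU
      rw [← hΦ, ← hγδ] at h1
      exact absurd hγB (hA₁ h1).2
    · simp only [Ψ, hγU, hδU, if_true, if_false] at hγδ
      have h1 := key γ hγB hγU
      rw [← hΦ, hγδ] at h1
      exact absurd hδB (hA₁ h1).2
    · simp only [Ψ, hγU, hδU, if_false] at hγδ
      exact hΦi hγδ
  have h1 := Finset.card_le_card_of_injOn Ψ hmaps hinj
  refine h1.trans_lt (Finset.card_erase_lt_of_mem ?_)
  simpa using hxU

open Classical in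
/-- Averages over orbits of larger and larger finite subgroups accumulate at an invariant
probability measure. -/
theorem exists_invariant_measure [CompactSpace X] [T2Space X] [MeasurableSpace X] [BorelSpace X]
    {Γ : Subgroup (X ≃ₜ X)} {G : ℕ → Subgroup (X ≃ₜ X)} (hmono : Monotone G)
    [∀ n, Fintype (G n)] (hG : ∀ γ ∈ Γ, ∃ n, γ ∈ G n) (x : ℕ → X) :
    ∃ μ : Measure X, IsProbabilityMeasure μ ∧ (∀ γ ∈ Γ, μ.map γ = μ) ∧
      ∀ U V : Set X, IsClopen U → IsClopen V →
        (∀ᶠ n in atTop, (Finset.univ.filter fun γ : G n => γ.1 (x n) ∈ V).card ≤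
          (Finset.univ.filter fun γ : G n => γ.1 (x n) ∈ U).card) → μ V ≤ μ U := by
  let L : ℕ → (X → ℝ) → ℝ := fun n f => (Fintype.card (G n) : ℝ)⁻¹ * ∑ γ : G n, f (γ.1 (x n))
  have hcard : ∀ n, (0 : ℝ) < Fintype.card (G n) := fun n => by
    exact_mod_cast Fintype.card_pos
  have hLadd : ∀ n f g, L n (f + g) = L n f + L n g := fun n f g => by
    simp [L, Finset.sum_add_distrib, mul_add]
  have hLsmul : ∀ n (a : ℝ) f, L n (a • f) = a * L n f := fun n a f => by
    simp only [L, Pi.smul_apply, smul_eq_mul, ← Finset.mul_sum]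
    ring
  have hLmono : ∀ n f g, (∀ y, f y ≤ g y) → L n f ≤ L n g := fun n f g h =>
    mul_le_mul_of_nonneg_left (Finset.sum_le_sum fun γ _ => h _) (inv_nonneg.2 (hcard n).le)
  have hLconst : ∀ n (a : ℝ), L n (fun _ => a) = a := fun n a => by
    simp only [L, Finset.sum_const, Finset.card_univ, nsmul_eq_mul]
    rw [inv_mul_cancel_left₀ (hcard n).ne']
  -- the limit of the averages along an ultrafilter is a positive functional on `C(X, ℝ)`
  let u : Ultrafilter ℕ := hyperfilter ℕ
  have hu : (u : Filter ℕ) ≤ atTop := Nat.hyperfilter_le_atTop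
  have hlim : ∀ f : CompactlySupportedContinuousMap X ℝ, ∃ a, Tendsto (fun n => L n f) u (𝓝 a) := by
    intro f
    obtain ⟨C, hC⟩ := isCompact_univ.exists_bound_of_continuousOn (f.continuous.continuousOn)
    have hmem : ∀ n, L n f ∈ Icc (-C) C := fun n => by
      have h (y) := abs_le.1 (hC y (mem_univ y))
      exact ⟨(hLconst n (-C)).ge.trans (hLmono n _ _ fun y => (h y).1),
        (hLmono n _ _ fun y => (h y).2).trans (hLconst n C).le⟩
    obtain ⟨a, -, ha⟩ := isCompact_Icc.ultrafilter_le_nhds (u.map fun n => L n f)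
      (le_principal_iff.2 (mem_map.2 (Filter.univ_mem' hmem)))
    exact ⟨a, ha⟩
  choose Λ₀ hΛ₀ using hlim
  let Λ : CompactlySupportedContinuousMap X ℝ →ₚ[ℝ] ℝ :=
    { toFun := Λ₀
      map_add' := fun f g => tendsto_nhds_unique (hΛ₀ (f + g)) (((hΛ₀ f).add (hΛ₀ g)).congr
        fun n => (hLadd n f g).symm)
      map_smul' := fun a f => tendsto_nhds_unique (hΛ₀ (a • f)) (((hΛ₀ f).const_mul a).congr
        fun n => (hLsmul n a f).symm)
      monotone' := fun f g hfg => le_of_tendsto_of_tendsto' (hΛ₀ f) (hΛ₀ g)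
        fun n => hLmono n f g hfg }
  let μ := RealRMK.rieszMeasure Λ
  have hμ : ∀ f : CompactlySupportedContinuousMap X ℝ,
      Tendsto (fun n => L n f) u (𝓝 (∫ x, f x ∂μ)) := fun f => by
    rw [RealRMK.integral_rieszMeasure]
    exact hΛ₀ f
  have hclopen : ∀ U : Set X, IsClopen U →
      Tendsto (fun n => L n (U.indicator 1)) u (𝓝 (μ.real U)) := by
    intro U hU
    let f : CompactlySupportedContinuousMap X ℝ := ⟨⟨U.indicator 1,
      (IsLocallyConstant.continuous (LocallyConstant.charFn ℝ hU).isLocallyConstant)⟩,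
      HasCompactSupport.of_compactSpace _⟩
    have := hμ f
    have e : ∫ x, f x ∂μ = μ.real U := integral_indicator_one hU.isOpen.measurableSet
    rwa [e] at this
  have hL_ind : ∀ n (U : Set X), L n (U.indicator 1) = (Fintype.card (G n) : ℝ)⁻¹ *
      (Finset.univ.filter fun γ : G n => γ.1 (x n) ∈ U).card := by
    intro n U
    simp only [L]
    congr 1
    rw [Finset.card_filter]
    push_cast
    exact Finset.sum_congr rfl fun γ _ => by simp [indicator]
  refine ⟨μ, ⟨?_⟩, ?_, ?_⟩
  · have h1 := hclopen univ isClopen_univ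
    have h2 : ∀ n, L n ((univ : Set X).indicator 1) = 1 := fun n => by
      rw [indicator_univ]
      exact hLconst n 1
    simp only [h2] at h1
    have h3 := tendsto_nhds_unique h1 tendsto_const_nhds
    rw [measureReal_def] at h3
    exact (ENNReal.toReal_eq_one_iff _).1 h3
  · intro γ hγ
    have : (μ.map γ).Regular := Measure.Regular.map γ
    refine Measure.ext_of_integral_eq_on_compactlySupported fun f => ?_
    rw [integral_map γ.continuous.aemeasurable (map_continuous f).aestronglyMeasurable]
    let g : CompactlySupportedContinuousMap X ℝ := ⟨f.toContinuousMap.comp ⟨γ, γ.continuous⟩,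
      HasCompactSupport.of_compactSpace _⟩
    refine tendsto_nhds_unique (hμ g) ((hμ f).congr' ?_)
    obtain ⟨N, hN⟩ := hG γ hγ
    refine hu ?_
    filter_upwards [eventually_ge_atTop N] with n hn
    simp only [L]
    congr 1
    exact (Equiv.sum_comp (Equiv.mulLeft (⟨γ, hmono hn hN⟩ : G n))
      (fun δ : G n => f (δ.1 (x n)))).symm
  · intro U V hU hV h
    have h1 : μ.real V ≤ μ.real U := by
      refine le_of_tendsto_of_tendsto (hclopen V hV) (hclopen U hU) (hu ?_)
      filter_upwards [h] with n hn
      rw [hL_ind, hL_ind]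
      exact mul_le_mul_of_nonneg_left (by exact_mod_cast hn) (inv_nonneg.2 (hcard n).le)
    exact (ENNReal.toReal_le_toReal (measure_ne_top _ _) (measure_ne_top _ _)).1 h1

/-- A nonempty open set has positive measure for every measure which is invariant under a minimal
group. -/
theorem IsMinimal.measure_pos [CompactSpace X] [MeasurableSpace X] [BorelSpace X]
    {Γ : Subgroup (X ≃ₜ X)} (hΓ : IsMinimal Γ) {μ : Measure X} [IsProbabilityMeasure μ]
    (hμ : ∀ γ ∈ Γ, μ.map γ = μ) {B : Set X} (hB : IsOpen B) (hne : B.Nonempty) : 0 < μ B := by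
  have hcov : (univ : Set X) ⊆ ⋃ γ : Γ, γ.1 ⁻¹' B := by
    intro x _
    obtain ⟨_, hy, γ, hγ, rfl⟩ := (hΓ x).inter_open_nonempty B hB hne
    exact mem_iUnion.2 ⟨⟨γ, hγ⟩, hy⟩
  obtain ⟨t, ht⟩ := isCompact_univ.elim_finite_subcover _
    (fun γ : Γ => hB.preimage γ.1.continuous) hcov
  rw [pos_iff_ne_zero]
  intro h0
  have h1 : μ univ ≤ 0 := by
    refine (measure_mono ht).trans ((measure_biUnion_finset_le _ _).trans ?_)
    refine (Finset.sum_eq_zero fun γ _ => ?_).le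
    have := hμ γ.1 γ.2
    rw [← Measure.map_apply γ.1.continuous.measurable hB.measurableSet, this, h0]
  simp at h1

/-- If a closed thin set `K` could not be moved into `B`, then neither could any of its clopen
neighbourhoods `U n`; for each finite subgroup, some orbit would then have more points in `U n` than
in `B`, and averages over such orbits would give in the limit an invariant probability
measure `μ` with `μ B ≤ μ K = 0`. -/
theorem IsThin.isSmall [CompactSpace X] [T2Space X] [TotallyDisconnectedSpace X]
    [SecondCountableTopology X] [MeasurableSpace X] [BorelSpace X] {Γ : Subgroup (X ≃ₜ X)}
    (hΓ : IsAmple Γ) (hmin : IsMinimal Γ) {K : Set X} (hK : IsClosed K) (hthin : IsThin Γ K) :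
    IsSmall Γ (Subtype.val : K → X) := by
  classical
  intro B hB hBne
  by_contra hcon
  push Not at hcon
  obtain ⟨G, hGmono, hGfin, hGΓ, hG⟩ := hΓ.isPreample.exists_exhaustion
  have := fun n => Fintype.ofFinite (G n)
  obtain ⟨U, hUc, hUa, hUK⟩ : ∃ U : ℕ → Set X, (∀ n, IsClopen (U n)) ∧ Antitone U ∧
      ⋂ n, U n = K := by
    have hC : Countable (TopologicalSpace.Clopens X) :=
      TopologicalSpace.Clopens.countable_iff_secondCountable.2 inferInstance
    have : Nonempty {C : TopologicalSpace.Clopens X // K ⊆ C} := ⟨⟨⊤, fun x _ => mem_univ x⟩⟩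
    obtain ⟨e, he⟩ := exists_surjective_nat {C : TopologicalSpace.Clopens X // K ⊆ C}
    refine ⟨fun n => ⋂ k ∈ Finset.range n, ((e k).1 : Set X), fun n => ?_, fun m n hmn => ?_, ?_⟩
    · exact isClopen_biInter_finset fun k _ => (e k).1.isClopen
    · exact biInter_subset_biInter_left (by simpa using hmn)
    · refine subset_antisymm (fun x hx => ?_) ?_
      · by_contra hxK
        obtain ⟨V, hV, hxV, hVK⟩ := compact_exists_isClopen_in_isOpen hK.isOpen_compl hxK
        obtain ⟨k, hk⟩ := he ⟨⟨Vᶜ, hV.compl⟩, fun y hy hyV => hVK hyV hy⟩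
        have := mem_iInter.1 hx (k + 1)
        have := mem_iInter₂.1 this k (by simp)
        rw [hk] at this
        exact this hxV
      · exact subset_iInter fun n => subset_iInter₂ fun k _ => (e k).2
  have hx : ∀ n, ∃ x, (Finset.univ.filter fun γ : G n => γ.1 x ∈ B).card <
      (Finset.univ.filter fun γ : G n => γ.1 x ∈ U n).card := by
    intro n
    refine hΓ.exists_card_lt (hGΓ n) (hUc n) hB fun γ hγ => ?_
    obtain ⟨y, hy⟩ := hcon γ hγ
    refine ⟨y, ?_, hy⟩
    have : (y : X) ∈ ⋂ n, U n := by
      rw [hUK]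
      exact y.2
    exact mem_iInter.1 this n
  choose x hx using hx
  obtain ⟨μ, hμ, hμΓ, hμc⟩ := exists_invariant_measure hGmono hG x
  have h1 : ∀ n, μ B ≤ μ (U n) := by
    intro n
    refine hμc _ _ (hUc n) hB ?_
    filter_upwards [eventually_ge_atTop n] with m hm
    refine (hx m).le.trans (Finset.card_le_card ?_)
    exact Finset.monotone_filter_right _ fun γ _ h => hUa hm h
  have h2 : Tendsto (fun n => μ (U n)) atTop (𝓝 (μ (⋂ n, U n))) :=
    tendsto_measure_iInter_atTop (fun n => (hUc n).isOpen.measurableSet.nullMeasurableSet) hUa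
      ⟨0, measure_ne_top _ _⟩
  rw [hUK, hthin μ hμ hμΓ] at h2
  have h3 : μ B ≤ 0 := ge_of_tendsto' h2 h1
  exact (hmin.measure_pos hμΓ hB.isOpen hBne).not_ge h3

end Thin

/-! ### Étale embeddings -/

section Etale

variable {X Y : Type*} [TopologicalSpace X] [TopologicalSpace Y]

/-- An étale embedding of `(Y, S)` into `(X, Γ)`: `i` embeds `Y` into `X` in such a way that the
partial homeomorphisms of `Y` induced by the elements of `Γ` are, locally, the elements of `S`. -/
structure IsEtaleEmb (Γ : Subgroup (X ≃ₜ X)) (S : Subgroup (Y ≃ₜ Y)) (i : Y → X) : Prop where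
  continuous : Continuous i
  injective : Function.Injective i
  lift : ∀ σ ∈ S, ∀ y, ∃ γ ∈ Γ, ∀ᶠ z in 𝓝 y, i (σ z) = γ (i z)
  lower : ∀ γ ∈ Γ, ∀ y y', γ (i y) = i y' → ∃ σ ∈ S, ∀ᶠ z in 𝓝 y, γ (i z) = i (σ z)

theorem exists_nhds_of_eventually [CompactSpace Y] [T2Space X] {f : Y → X} (hf : Continuous f)
    (hinj : Function.Injective f) {y : Y} {p : Y → Prop} (hp : ∀ᶠ z in 𝓝 y, p z) :
    ∃ V ∈ 𝓝 (f y), ∀ z, f z ∈ V → p z := by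
  have h := (hf.isClosedEmbedding hinj).isInducing
  rw [h.nhds_eq_comap] at hp
  obtain ⟨V, hV, hVp⟩ := hp
  exact ⟨V, hV, fun z hz => hVp hz⟩

theorem proj_eq_proj_iff (Q : DiscreteQuotient X) {x y : X} :
    Q.proj x = Q.proj y ↔ Q.toSetoid x y := Quotient.eq''

/-- Étale embeddings are preserved by the homeomorphisms which normalize the group. -/
theorem IsEtaleEmb.comp {Γ : Subgroup (X ≃ₜ X)} {S : Subgroup (Y ≃ₜ Y)} {i : Y → X}
    (h : IsEtaleEmb Γ S i) {c : X ≃ₜ X} (hc : ∀ γ, γ ∈ Γ ↔ c * γ * c⁻¹ ∈ Γ) :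
    IsEtaleEmb Γ S (c ∘ i) where
  continuous := c.continuous.comp h.continuous
  injective := c.injective.comp h.injective
  lift σ hσ y := by
    obtain ⟨γ, hγ, hy⟩ := h.lift σ hσ y
    refine ⟨_, (hc γ).1 hγ, hy.mono fun z hz => ?_⟩
    simp [Homeomorph.mul_apply, hz]
  lower γ hγ y y' hy := by
    have h1 : c⁻¹ * γ * c ∈ Γ := by
      rw [hc]
      simpa [mul_assoc] using hγ
    obtain ⟨σ, hσ, hs⟩ := h.lower _ h1 y y' (by
      simp only [Function.comp_apply] at hy
      simp [Homeomorph.mul_apply, hy])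
    refine ⟨σ, hσ, hs.mono fun z hz => ?_⟩
    simp only [Function.comp_apply]
    rw [← hz]
    simp [Homeomorph.mul_apply]

theorem IsEtaleEmb.comp_mem {Γ : Subgroup (X ≃ₜ X)} {S : Subgroup (Y ≃ₜ Y)} {i : Y → X}
    (h : IsEtaleEmb Γ S i) {c : X ≃ₜ X} (hc : c ∈ Γ) : IsEtaleEmb Γ S (c ∘ i) :=
  h.comp fun γ => by
    constructor
    · exact fun hγ => Γ.mul_mem (Γ.mul_mem hc hγ) (Γ.inv_mem hc)
    · intro hγ
      have := Γ.mul_mem (Γ.mul_mem (Γ.inv_mem hc) hγ) hc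
      simpa [mul_assoc] using this

theorem IsSmall.comp {Y : Type*} {Γ : Subgroup (X ≃ₜ X)} {i : Y → X} (h : IsSmall Γ i) {c : X ≃ₜ X}
    (hc : ∀ γ, γ ∈ Γ → c * γ * c⁻¹ ∈ Γ) : IsSmall Γ (c ∘ i) := by
  intro B hB hne
  obtain ⟨γ, hγ, h⟩ := h (c ⁻¹' B) (hB.preimage c.continuous)
    (hne.preimage c.surjective)
  exact ⟨_, hc γ hγ, fun y => by simpa [Homeomorph.mul_apply] using h y⟩

theorem IsSmall.comp_mem {Y : Type*} {Γ : Subgroup (X ≃ₜ X)} {i : Y → X} (h : IsSmall Γ i)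
    {c : X ≃ₜ X} (hc : c ∈ Γ) : IsSmall Γ (c ∘ i) :=
  h.comp fun _ hγ => Γ.mul_mem (Γ.mul_mem hc hγ) (Γ.inv_mem hc)

theorem exists_isClopen_ssubset [CompactSpace X] [T2Space X] [TotallyDisconnectedSpace X]
    [∀ x : X, (𝓝[≠] x).NeBot] {B : Set X} (hB : IsClopen B) (hne : B.Nonempty) :
    ∃ A ⊆ B, IsClopen A ∧ A.Nonempty ∧ ∃ x ∈ B, x ∉ A := by
  obtain ⟨x, hx⟩ := hne
  obtain ⟨y, hy, hyx⟩ : ∃ y ∈ B, y ≠ x := by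
    have : B ∩ {x}ᶜ ∈ 𝓝[≠] x :=
      inter_mem (mem_nhdsWithin_of_mem_nhds (hB.isOpen.mem_nhds hx)) self_mem_nhdsWithin
    obtain ⟨y, hy⟩ := Filter.nonempty_of_mem this
    exact ⟨y, hy.1, hy.2⟩
  obtain ⟨A, hA, hyA, hAB⟩ := compact_exists_isClopen_in_isOpen
    (hB.isOpen.inter isClosed_singleton.isOpen_compl) ⟨hy, hyx⟩
  exact ⟨A, fun z hz => (hAB hz).1, hA, ⟨y, hyA⟩, x, hx, fun h => (hAB h).2 rfl⟩

/-- If the range contained a clopen set `B`, then a power of an element of the group moving the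
range into a proper part of `B` would contradict local finiteness. -/
theorem IsSmall.interior_eq_empty [CompactSpace X] [T2Space X] [TotallyDisconnectedSpace X]
    [∀ x : X, (𝓝[≠] x).NeBot] {Y : Type*} {Γ : Subgroup (X ≃ₜ X)} (hΓ : IsAmple Γ) {i : Y → X}
    (hi : IsSmall Γ i) : interior (range i) = ∅ := by
  by_contra hne
  obtain ⟨x, hx⟩ := nonempty_iff_ne_empty.2 hne
  obtain ⟨B, hB, hxB, hBi⟩ := compact_exists_isClopen_in_isOpen isOpen_interior hx
  obtain ⟨A, hAB, hA, hAne, z, hzB, hzA⟩ := exists_isClopen_ssubset hB ⟨x, hxB⟩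
  obtain ⟨γ, hγ, h⟩ := hi A hA hAne
  have hr : ∀ w ∈ range i, γ w ∈ A := by
    rintro _ ⟨y, rfl⟩
    exact h y
  have hpow : ∀ n : ℕ, ∀ w ∈ range i, (γ ^ (n + 1)) w ∈ A := by
    intro n
    induction n with
    | zero => simpa using hr
    | succ n ih =>
      intro w hw
      rw [pow_succ', Homeomorph.mul_apply]
      exact hr _ (interior_subset (hBi (hAB (ih w hw))))
  have hfin : IsOfFinOrder γ := by
    obtain ⟨G, hG, -, hGγ⟩ := hΓ.isPreample.exists_finite_le (finite_singleton γ)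
      (singleton_subset_iff.2 hγ)
    have := isOfFinOrder_of_finite (⟨γ, hGγ rfl⟩ : G)
    exact (Submonoid.isOfFinOrder_coe (H := G.toSubmonoid)).2 this
  obtain ⟨n, hn, hn1⟩ := isOfFinOrder_iff_pow_eq_one.1 hfin
  have := hpow (n - 1) z (interior_subset (hBi hzB))
  rw [Nat.sub_add_cancel hn, hn1] at this
  exact hzA this

/-- The saturation of the range of a small map under a finite group is nowhere dense. -/
theorem IsSmall.exists_isClopen_disjoint [CompactSpace X] [T2Space X] [TotallyDisconnectedSpace X]
    [∀ x : X, (𝓝[≠] x).NeBot] [CompactSpace Y] {Γ : Subgroup (X ≃ₜ X)} (hΓ : IsAmple Γ)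
    {i : Y → X} (hi : IsSmall Γ i) (hc : Continuous i) (G : Subgroup (X ≃ₜ X)) [Finite G]
    {B : Set X} (hB : IsClopen B) (hne : B.Nonempty) :
    ∃ A ⊆ B, IsClopen A ∧ A.Nonempty ∧ ∀ g ∈ G, ∀ y, g (i y) ∉ A := by
  have h1 : Dense (⋂ g : G, (range (g.1 ∘ i))ᶜ) := by
    refine dense_iInter_of_isOpen (fun g => ?_) fun g => ?_
    · exact (isCompact_range (g.1.continuous.comp hc)).isClosed.isOpen_compl
    · rw [← interior_eq_empty_iff_dense_compl, range_comp, ← Homeomorph.image_interior,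
        hi.interior_eq_empty hΓ, image_empty]
  obtain ⟨x, hxB, hx⟩ := h1.inter_open_nonempty B hB.isOpen hne
  have h2 : IsOpen (⋂ g : G, (range (g.1 ∘ i))ᶜ) := isOpen_iInter_of_finite fun g =>
    (isCompact_range (g.1.continuous.comp hc)).isClosed.isOpen_compl
  obtain ⟨A, hA, hxA, hAB⟩ := compact_exists_isClopen_in_isOpen (hB.isOpen.inter h2) ⟨hxB, hx⟩
  exact ⟨A, fun z hz => (hAB hz).1, hA, ⟨x, hxA⟩, fun g hg y hy =>
    mem_iInter.1 (hAB hy).2 ⟨g, hg⟩ ⟨y, rfl⟩⟩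

end Etale

/-! ### Matching étale embeddings -/

section Matching

variable {X Y : Type*} [TopologicalSpace X] [TopologicalSpace Y]

/-- The embeddings `i` and `j` look the same from the point of view of the finite group `G` and of
the finite clopen partition `P`. -/
structure Matches (i j : Y → X) (G : Subgroup (X ≃ₜ X)) (P : DiscreteQuotient X) : Prop where
  rel : ∀ y, P.toSetoid (i y) (j y)
  iff : ∀ γ ∈ G, ∀ y z, γ (i y) = i z ↔ γ (j y) = j z

/-- The `G`-equivariant extension of the correspondence between `i y` and `j y`. -/
def Corr (i j : Y → X) (G : Subgroup (X ≃ₜ X)) (x w : X) : Prop :=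
  ∃ g ∈ G, ∃ y, g (i y) = x ∧ g (j y) = w

theorem Corr.map {Y : Type*} {i j : Y → X} {G : Subgroup (X ≃ₜ X)} {x w : X} (h : Corr i j G x w)
    {g : X ≃ₜ X} (hg : g ∈ G) : Corr i j G (g x) (g w) := by
  obtain ⟨g', hg', y, rfl, rfl⟩ := h
  exact ⟨g * g', G.mul_mem hg hg', y, rfl, rfl⟩

theorem Matches.corr_iff {Y : Type*} {i j : Y → X} {G : Subgroup (X ≃ₜ X)} {P : DiscreteQuotient X}
    (h : Matches i j G P) {x w x' w' : X} (h1 : Corr i j G x w) (h2 : Corr i j G x' w') :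
    x = x' ↔ w = w' := by
  obtain ⟨g, hg, y, rfl, rfl⟩ := h1
  obtain ⟨g', hg', y', rfl, rfl⟩ := h2
  have := h.iff (g'⁻¹ * g) (G.mul_mem (G.inv_mem hg') hg) y y'
  simpa [Homeomorph.mul_apply, Homeomorph.inv_apply, Homeomorph.symm_apply_eq] using this

/-- Near each point, the correspondence between `G • i` and `G • j` comes from a single element `g₀`
of `G`, and each element of `G'` acts on the first coordinate in the same way as some element of `Γ`
acts on the second one. -/
theorem exists_nhds_good [CompactSpace X] [T2Space X] [CompactSpace Y]
    {Γ : Subgroup (X ≃ₜ X)} {S : Subgroup (Y ≃ₜ Y)} {i j : Y → X}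
    (hi : IsEtaleEmb Γ S i) (hj : IsEtaleEmb Γ S j)
    {G G' : Subgroup (X ≃ₜ X)} [Finite G'] (hG' : G' ≤ Γ) (hGG' : G ≤ G') (x : X) :
    ∃ s ∈ 𝓝 x, (∀ g ∈ G, ∀ y, g (i y) ∉ s) ∨ ∃ g₀ ∈ G,
      (∀ g ∈ G, ∀ y, g (i y) ∈ s → ∃ y', g₀ (i y') = g (i y)) ∧
      ∀ γ ∈ G', (∀ z ∈ s, ∀ g ∈ G, ∀ y, g (i y) ≠ γ z) ∨
        ∃ δ ∈ Γ, ∀ y, g₀ (i y) ∈ s → Corr i j G (γ (g₀ (i y))) (δ (g₀ (j y))) := by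
  have : Finite G := Finite.of_injective _ (Subgroup.inclusion_injective hGG')
  have hclosed : ∀ g : X ≃ₜ X, IsClosed (range fun y => g (i y)) := fun g =>
    (isCompact_range (g.continuous.comp hi.continuous)).isClosed
  have hD : IsClosed (⋃ g : G, range fun y => g.1 (i y)) :=
    isClosed_iUnion_of_finite fun g => hclosed _
  by_cases hx : x ∈ ⋃ g : G, range fun y => g.1 (i y)
  swap
  · refine ⟨_, hD.isOpen_compl.mem_nhds hx, Or.inl fun g hg y hy => hy ?_⟩
    exact mem_iUnion.2 ⟨⟨g, hg⟩, y, rfl⟩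
  obtain ⟨⟨g₀, hg₀⟩, y₀, rfl⟩ := mem_iUnion.1 hx
  dsimp only at hx ⊢
  have h1 : ∀ g : G, ∃ s ∈ 𝓝 (g₀ (i y₀)), ∀ y, g.1 (i y) ∈ s → ∃ y', g₀ (i y') = g.1 (i y) := by
    rintro ⟨g, hg⟩
    by_cases h : g₀ (i y₀) ∈ range fun y => g (i y)
    · obtain ⟨y₁, hy₁⟩ := h
      dsimp only at hy₁
      obtain ⟨σ, -, hσ⟩ := hi.lower (g₀⁻¹ * g) (hG' (hGG' (G.mul_mem (G.inv_mem hg₀) hg))) y₁ y₀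
        (by simp [Homeomorph.mul_apply, hy₁])
      obtain ⟨s, hs, hsp⟩ := exists_nhds_of_eventually (g.continuous.comp hi.continuous)
        (g.injective.comp hi.injective) hσ
      rw [← hy₁]
      refine ⟨s, hs, fun y hy => ⟨σ y, ?_⟩⟩
      rw [← hsp y hy]
      simp [Homeomorph.mul_apply]
    · exact ⟨_, (hclosed g).isOpen_compl.mem_nhds h, fun y hy => absurd ⟨y, rfl⟩ hy⟩
  have h2 : ∀ γ : G', ∃ s ∈ 𝓝 (g₀ (i y₀)), (∀ z ∈ s, ∀ g ∈ G, ∀ y, g (i y) ≠ γ.1 z) ∨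
      ∃ δ ∈ Γ, ∀ y, g₀ (i y) ∈ s → Corr i j G (γ.1 (g₀ (i y))) (δ (g₀ (j y))) := by
    rintro ⟨γ, hγ⟩
    by_cases h : γ (g₀ (i y₀)) ∈ ⋃ g : G, range fun y => g.1 (i y)
    · obtain ⟨⟨g, hg⟩, y₁, hy₁⟩ := mem_iUnion.1 h
      dsimp only at hy₁
      obtain ⟨σ, hσ, hσ1⟩ := hi.lower (g⁻¹ * γ * g₀) (hG' (G'.mul_mem (G'.mul_mem
        (G'.inv_mem (hGG' hg)) hγ) (hGG' hg₀))) y₀ y₁ (by simp [Homeomorph.mul_apply, ← hy₁])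
      obtain ⟨δ, hδ, hδ1⟩ := hj.lift σ hσ y₀
      obtain ⟨s, hs, hsp⟩ := exists_nhds_of_eventually (g₀.continuous.comp hi.continuous)
        (g₀.injective.comp hi.injective) (hσ1.and hδ1)
      refine ⟨s, hs, Or.inr ⟨g * δ * g₀⁻¹, Γ.mul_mem (Γ.mul_mem (hG' (hGG' hg)) hδ)
        (Γ.inv_mem (hG' (hGG' hg₀))), fun y hy => ⟨g, hg, σ y, ?_, ?_⟩⟩⟩
      · rw [← (hsp y hy).1]
        simp [Homeomorph.mul_apply]
      · rw [(hsp y hy).2]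
        simp [Homeomorph.mul_apply]
    · refine ⟨γ ⁻¹' _, γ.continuous.continuousAt.preimage_mem_nhds (hD.isOpen_compl.mem_nhds h),
        Or.inl fun z hz g hg y hy => hz ?_⟩
      exact mem_iUnion.2 ⟨⟨g, hg⟩, y, hy⟩
  choose s hs hs1 using h1
  choose t ht ht1 using h2
  refine ⟨(⋂ g, s g) ∩ ⋂ γ, t γ, inter_mem (Filter.iInter_mem.2 hs) (Filter.iInter_mem.2 ht),
    Or.inr ⟨g₀, hg₀, fun g hg y hy => hs1 ⟨g, hg⟩ y (mem_iInter.1 hy.1 _), fun γ hγ => ?_⟩⟩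
  refine (ht1 ⟨γ, hγ⟩).imp (fun h z hz => h z (mem_iInter.1 hz.2 _)) ?_
  rintro ⟨δ, hδ, h⟩
  exact ⟨δ, hδ, fun y hy => h y (mem_iInter.1 hy.2 _)⟩

/-- A `G`-invariant clopen set which meets all the classes of an adapted partition can be chosen
disjoint from the range of a small embedding. -/
theorem IsSmall.exists_invariant_clopen [CompactSpace X] [T2Space X] [TotallyDisconnectedSpace X]
    [∀ x : X, (𝓝[≠] x).NeBot] [CompactSpace Y] {Γ : Subgroup (X ≃ₜ X)} (hΓ : IsAmple Γ)
    {i : Y → X} (hi : IsSmall Γ i) (hc : Continuous i) (G : Subgroup (X ≃ₜ X)) [Finite G]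
    (P : DiscreteQuotient X) :
    ∃ V : Set X, IsClopen V ∧ (∀ g ∈ G, ∀ x ∈ V, g x ∈ V) ∧ (∀ b : P, ∃ x ∈ V, P.proj x = b) ∧
      ∀ g ∈ G, ∀ y, g (i y) ∉ V := by
  have h : ∀ b : P, ∃ A ⊆ P.proj ⁻¹' {b}, IsClopen A ∧ A.Nonempty ∧ ∀ g ∈ G, ∀ y, g (i y) ∉ A :=
    fun b => hi.exists_isClopen_disjoint hΓ hc G (P.isClopen_preimage _)
      ((singleton_nonempty b).preimage P.proj_surjective)
  choose A hAb hA hAne hAi using h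
  refine ⟨⋃ g : G, ⋃ b, g.1 ⁻¹' A b, ?_, ?_, ?_, ?_⟩
  · exact isClopen_iUnion_of_finite fun g => isClopen_iUnion_of_finite fun b =>
      (hA b).preimage g.1.continuous
  · intro g hg x hx
    simp only [mem_iUnion, mem_preimage] at hx ⊢
    obtain ⟨g', b, h⟩ := hx
    exact ⟨g' * ⟨g, hg⟩⁻¹, b, by simpa [Homeomorph.mul_apply] using h⟩
  · intro b
    obtain ⟨x, hx⟩ := hAne b
    exact ⟨x, mem_iUnion₂.2 ⟨1, b, hx⟩, hAb b hx⟩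
  · intro g hg y hy
    simp only [mem_iUnion, mem_preimage] at hy
    obtain ⟨g', b, h⟩ := hy
    exact hAi b (g'.1 * g) (G.mul_mem g'.2 hg) y h

end Matching

/-! ### One step of the back-and-forth construction -/

section Step

variable {X Y : Type*} [TopologicalSpace X] [TopologicalSpace Y]

/-- Finitely many pairwise disjoint closed sets have disjoint clopen neighbourhoods, which can be
chosen within the classes of any prescribed finite clopen partition. -/
theorem exists_disjoint_clopen [CompactSpace X] [T2Space X] [TotallyDisconnectedSpace X]
    {ι : Type*} [Finite ι] (J : ι → Set X) (hJ : ∀ b, IsClosed (J b))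
    (hd : ∀ b b' x, x ∈ J b → x ∈ J b' → b = b') (P : DiscreteQuotient X) :
    ∃ N : ι → Set X, (∀ b, IsClopen (N b)) ∧ (∀ b, J b ⊆ N b) ∧
      (∀ b b' x, x ∈ N b → x ∈ N b' → b = b') ∧
      ∀ b, ∀ x ∈ N b, ∃ y ∈ J b, P.toSetoid y x := by
  obtain ⟨Q, hQ⟩ := exists_discreteQuotient_forall (X := X)
    (p := fun s => ∀ b b', (s ∩ J b).Nonempty → (s ∩ J b').Nonempty → b = b')
    (fun s t hts h b b' h1 h2 => h b b' (h1.mono (inter_subset_inter_left _ hts))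
      (h2.mono (inter_subset_inter_left _ hts)))
    (fun x => by
      refine ⟨⋂ b : {b // x ∉ J b}, (J b)ᶜ, Filter.iInter_mem.2 fun b =>
        (hJ b).isOpen_compl.mem_nhds b.2, ?_⟩
      have key : ∀ b, ((⋂ b : {b // x ∉ J b}, (J b)ᶜ) ∩ J b).Nonempty → x ∈ J b := by
        rintro b ⟨y, hy, hyb⟩
        by_contra h
        exact mem_iInter.1 hy ⟨b, h⟩ hyb
      exact fun b b' h1 h2 => hd b b' x (key b h1) (key b' h2))
  refine ⟨fun b => (Q ⊓ P).proj ⁻¹' ((Q ⊓ P).proj '' J b), fun b => (Q ⊓ P).isClopen_preimage _,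
    fun b => subset_preimage_image _ _, ?_, ?_⟩
  · rintro b b' x ⟨y, hy, hyx⟩ ⟨y', hy', hyx'⟩
    rw [proj_eq_proj_iff] at hyx hyx'
    exact hQ x b b' ⟨y, Q.symm _ _ hyx.1, hy⟩ ⟨y', Q.symm _ _ hyx'.1, hy'⟩
  · rintro b x ⟨y, hy, hyx⟩
    rw [proj_eq_proj_iff] at hyx
    exact ⟨y, hy, hyx.2⟩

/-- If `i` and `j` match with respect to a finite group `G` and a partition `P`, then `j` can be
modified by an involution which is compatible with `G` and `P`, so as to match `i` with respect to a
larger finite group `G'` and a finer partition `P'`. The involution swaps neighbourhoods of the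
parts of `G • j` corresponding to the various classes of `P'` with copies of a single one of them
for each `G'`-orbit of classes, placed by means of `G'` in these classes, off the saturation of `j`.
-/
theorem Matches.exists_step [CompactSpace X] [T2Space X] [TotallyDisconnectedSpace X]
    [∀ x : X, (𝓝[≠] x).NeBot] [CompactSpace Y] {Γ : Subgroup (X ≃ₜ X)} (hΓ : IsAmple Γ)
    {S : Subgroup (Y ≃ₜ Y)} {i j : Y → X} (hi : IsEtaleEmb Γ S i) (hj : IsEtaleEmb Γ S j)
    (hjs : IsSmall Γ j) {G G' : Subgroup (X ≃ₜ X)} [Finite G'] (hG' : G' ≤ Γ) (hGG' : G ≤ G')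
    {P : DiscreteQuotient X} (hP : Adapted G P) (hm : Matches i j G P) (Q₀ : DiscreteQuotient X) :
    ∃ P' ≤ P, P' ≤ Q₀ ∧ Adapted G' P' ∧ ∃ c ∈ Γ, (∀ x, c (c x) = x) ∧
      (∀ g ∈ G, ∀ x, c (g x) = g (c x)) ∧ (∀ x, P.toSetoid x (c x)) ∧
      Matches i (c ∘ j) G' P' := by
  classical
  have hGfin : Finite G := Finite.of_injective _ (Subgroup.inclusion_injective hGG')
  have hfun : ∀ {x w x' w' : X}, Corr i j G x w → Corr i j G x' w' → (x = x' ↔ w = w') :=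
    fun h1 h2 => hm.corr_iff h1 h2
  obtain ⟨Q₁, hQ₁⟩ := exists_discreteQuotient_forall (X := X) (fun s t hts hp => by
    rcases hp with h | ⟨g₀, hg₀, h1, h2⟩
    · exact Or.inl fun g hg y hy => h g hg y (hts hy)
    · refine Or.inr ⟨g₀, hg₀, fun g hg y hy => h1 g hg y (hts hy), fun γ hγ => ?_⟩
      refine (h2 γ hγ).imp (fun h z hz => h z (hts hz)) ?_
      rintro ⟨δ, hδ, h⟩
      exact ⟨δ, hδ, fun y hy => h y (hts hy)⟩) (exists_nhds_good hi hj hG' hGG')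
  obtain ⟨P', hP'le, hP'⟩ := hΓ.isPreample.exists_adapted G' inferInstance hG' (P ⊓ Q₀ ⊓ Q₁)
  have hP'P : P' ≤ P := hP'le.trans (inf_le_left.trans inf_le_left)
  have hP'Q : P' ≤ Q₁ := hP'le.trans inf_le_right
  refine ⟨P', hP'P, hP'le.trans (inf_le_left.trans inf_le_right), hP', ?_⟩
  -- the classes which meet the `G`-saturation of the range of `i`
  let I := {b : P' // ∃ x w, Corr i j G x w ∧ P'.proj x = b}
  have hmap : ∀ γ ∈ G', ∀ x y, P'.proj x = P'.proj y → P'.proj (γ x) = P'.proj (γ y) := by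
    intro γ hγ x y h
    rw [proj_eq_proj_iff] at h ⊢
    exact hP'.map γ hγ x y h
  have heq : ∀ γ ∈ G', ∀ δ ∈ G', ∀ x y, P'.proj x = P'.proj y → P'.proj (γ x) = P'.proj (δ y) →
      γ x = δ x := fun γ hγ δ hδ x y h1 h2 => hP'.eq_of_rel hγ hδ ((proj_eq_proj_iff _).1 h1)
        ((proj_eq_proj_iff _).1 h2)
  have hgood : ∀ b : I, ∃ g₀ ∈ G,
      (∀ g ∈ G, ∀ y, P'.proj (g (i y)) = b.1 → ∃ y', g₀ (i y') = g (i y)) ∧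
      ∀ γ ∈ G', (∀ z, P'.proj z = b.1 → ∀ w, ¬ Corr i j G (γ z) w) ∨
        ∃ δ ∈ Γ, ∀ x w, P'.proj x = b.1 → Corr i j G x w → Corr i j G (γ x) (δ w) := by
    rintro ⟨b, x₀, w₀, ⟨g, hg, y, rfl, rfl⟩, hx₀⟩
    have hcl : ∀ z, P'.proj z = b → Q₁.toSetoid (g (i y)) z := fun z hz =>
      hP'Q ((proj_eq_proj_iff P').1 (hx₀.trans hz.symm))
    rcases hQ₁ (g (i y)) with h | ⟨g₀, hg₀, h1, h2⟩
    · exact absurd (Q₁.refl _) (h g hg y)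
    · refine ⟨g₀, hg₀, fun g hg y hy => h1 g hg y (hcl _ hy), fun γ hγ => ?_⟩
      refine (h2 γ hγ).imp ?_ ?_
      · rintro h z hz w ⟨g, hg, y, hgy, -⟩
        exact h z (hcl z hz) g hg y hgy
      · rintro ⟨δ, hδ, h⟩
        refine ⟨δ, hδ, ?_⟩
        rintro x w hx ⟨g, hg, y, rfl, rfl⟩
        obtain ⟨y', hy'⟩ := h1 g hg y (hcl _ hx)
        have hw : g₀ (j y') = g (j y) := (hfun ⟨g₀, hg₀, y', rfl, rfl⟩ ⟨g, hg, y, rfl, rfl⟩).1 hy'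
        rw [← hy', ← hw]
        exact h y' (by rw [hy']; exact hcl _ hx)
  choose g₀ hg₀ hg₀1 hgood using hgood
  -- `rep b` represents the `G'`-orbit of the class `b`, and `γ b` maps the class `rep b` to `b`
  let r : Setoid I :=
    { r := fun a b => ∃ γ ∈ G', ∀ x, P'.proj x = a.1 → P'.proj (γ x) = b.1
      iseqv :=
        { refl := fun a => ⟨1, G'.one_mem, fun x hx => hx⟩
          symm := by
            rintro a b ⟨γ, hγ, h⟩
            obtain ⟨x, hx⟩ := P'.proj_surjective a.1
            refine ⟨γ⁻¹, G'.inv_mem hγ, fun z hz => ?_⟩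
            rw [hmap γ⁻¹ (G'.inv_mem hγ) z (γ x) (hz.trans (h x hx).symm), ← hx]
            simp
          trans := by
            rintro a b c ⟨γ, hγ, h⟩ ⟨δ, hδ, h'⟩
            exact ⟨δ * γ, G'.mul_mem hδ hγ, fun x hx => h' _ (h x hx)⟩ } }
  let rep : I → I := fun b => (Quotient.mk r b).out
  have hrep : ∀ b, ∃ γ ∈ G', ∀ x, P'.proj x = (rep b).1 → P'.proj (γ x) = b.1 := fun b =>
    Quotient.mk_out (s := r) b
  have hrep_eq : ∀ (b b' : I) (γ : X ≃ₜ X), γ ∈ G' → ∀ x, P'.proj x = b.1 →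
      P'.proj (γ x) = b'.1 → rep b = rep b' := by
    intro b b' γ hγ x hx hx'
    have : Quotient.mk r b = Quotient.mk r b' := Quotient.sound (s := r)
      ⟨γ, hγ, fun z hz => (hmap γ hγ z x (hz.trans hx.symm)).trans hx'⟩
    simp only [rep, this]
  choose γ hγ hγb using hrep
  have hγinv : ∀ b x, P'.proj x = b.1 → P'.proj ((γ b)⁻¹ x) = (rep b).1 := by
    intro b x hx
    obtain ⟨z, hz⟩ := P'.proj_surjective (rep b).1
    rw [hmap _ (G'.inv_mem (hγ b)) x (γ b z) (hx.trans (hγb b z hz).symm), ← hz]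
    simp
  -- `δ b` imitates, on the side of `j`, the action of `γ b` on the side of `i`
  have hδ : ∀ b, ∃ δ ∈ Γ, ∀ x w, P'.proj x = (rep b).1 → Corr i j G x w →
      Corr i j G (γ b x) (δ w) := by
    intro b
    rcases hgood (rep b) (γ b) (hγ b) with h | h
    · obtain ⟨x, w, hxw, hx⟩ := b.2
      exact absurd (by simpa using hxw) (h _ (hγinv b x hx) w)
    · exact h
  choose δ hδ hδE using hδ
  have hback : ∀ b x₁ w₁, Corr i j G x₁ w₁ → P'.proj x₁ = b.1 →
      ∃ x w, Corr i j G x w ∧ P'.proj x = (rep b).1 ∧ γ b x = x₁ ∧ δ b w = w₁ := by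
    intro b x₁ w₁ h₁ hx₁
    rcases hgood b (γ b)⁻¹ (G'.inv_mem (hγ b)) with h | ⟨ε, -, h⟩
    · obtain ⟨x, w, hxw, hx⟩ := (rep b).2
      refine absurd ?_ (h (γ b x) (hγb b x hx) w)
      simpa using hxw
    · have h2 := h x₁ w₁ hx₁ h₁
      have h3 := hδE b _ _ (hγinv b x₁ hx₁) h2
      refine ⟨_, _, h2, hγinv b x₁ hx₁, by simp, ?_⟩
      exact (hfun h3 h₁).1 (by simp)
  -- the clopen set `V` receives the range of the modified embedding
  obtain ⟨V, hV, hVinv, hVne, hVj⟩ := hjs.exists_invariant_clopen hΓ hj.continuous G' P'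
  have hα : ∀ a : I, ∃ α ∈ Γ, ∀ x w, Corr i j G x w → P'.proj x = a.1 →
      α w ∈ V ∧ P'.proj (α w) = a.1 := by
    intro a
    obtain ⟨β, hβ, h⟩ := hjs (V ∩ P'.proj ⁻¹' {a.1}) (hV.inter (P'.isClopen_preimage _)) (by
      obtain ⟨x, hx, hxa⟩ := hVne a.1
      exact ⟨x, hx, hxa⟩)
    refine ⟨β * (g₀ a)⁻¹, Γ.mul_mem hβ (Γ.inv_mem (hG' (hGG' (hg₀ a)))), ?_⟩
    rintro _ _ ⟨g, hg, y, rfl, rfl⟩ hx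
    obtain ⟨y', hy'⟩ := hg₀1 a g hg y hx
    have hw : g₀ a (j y') = g (j y) :=
      (hfun ⟨g₀ a, hg₀ a, y', rfl, rfl⟩ ⟨g, hg, y, rfl, rfl⟩).1 hy'
    rw [← hw]
    simpa [Homeomorph.mul_apply] using h y'
  choose α hα hαV using hα
  obtain ⟨N, hN, hJN, hNd, hNJ⟩ := exists_disjoint_clopen
    (fun b : I => {w | ∃ x, Corr i j G x w ∧ P'.proj x = b.1}) (fun b => by
      have : {w | ∃ x, Corr i j G x w ∧ P'.proj x = b.1} =
          ⋃ g : G, (fun y => g.1 (j y)) '' {y | P'.proj (g.1 (i y)) = b.1} := by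
        ext w
        simp only [mem_ofPred_eq, mem_iUnion, mem_image]
        constructor
        · rintro ⟨_, ⟨g, hg, y, rfl, rfl⟩, hx⟩
          exact ⟨⟨g, hg⟩, y, hx, rfl⟩
        · rintro ⟨g, y, hx, rfl⟩
          exact ⟨_, ⟨g.1, g.2, y, rfl, rfl⟩, hx⟩
      rw [this]
      refine isClosed_iUnion_of_finite fun g => ?_
      have hcl : IsClosed {y | P'.proj (g.1 (i y)) = b.1} :=
        (P'.isClosed_preimage {b.1}).preimage (g.1.continuous.comp hi.continuous)
      exact (hcl.isCompact.image (g.1.continuous.comp hj.continuous)).isClosed)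
    (by
      rintro b b' w ⟨x, hxw, hx⟩ ⟨x', hxw', hx'⟩
      have := (hfun hxw hxw').2 rfl
      exact Subtype.ext (hx.symm.trans ((congrArg _ this).trans hx')))
    (P ⊓ DiscreteQuotient.ofIsClopen hV)
  have hNV : ∀ b, ∀ w ∈ N b, w ∉ V := by
    intro b w hw hwV
    obtain ⟨w', ⟨x, ⟨g, hg, y, rfl, rfl⟩, -⟩, hw'⟩ := hNJ b w hw
    exact hVj g (hGG' hg) y (hw'.2.2 hwV)
  have hNP : ∀ b, ∀ w ∈ N b, ∀ z, P'.proj z = b.1 → P.toSetoid w z := by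
    intro b w hw z hz
    obtain ⟨w', ⟨x, ⟨g, hg, y, rfl, rfl⟩, hx⟩, hw'⟩ := hNJ b w hw
    refine P.trans _ _ _ (P.symm _ _ hw'.1) (P.trans _ _ _
      (hP.map g hg _ _ (P.symm _ _ (hm.rel y))) ?_)
    exact hP'P ((proj_eq_proj_iff P').1 (hx.trans hz.symm))
  -- the small sets on which all the choices made so far are coherent
  let W : I → Set X := fun a => {w | α a w ∈ V ∧ P'.proj (α a w) = a.1 ∧
    ∀ b : I, rep b = a → δ b w ∈ N b ∧ ∀ (g : G) (b' : I),
      (∀ x, P'.proj x = b.1 → P'.proj (g.1 x) = b'.1) → δ b' w = g.1 (δ b w)}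
  have hWc : ∀ a, IsClopen (W a) := by
    intro a
    have hWa : W a = α a ⁻¹' V ∩ (α a ⁻¹' (P'.proj ⁻¹' {a.1}) ∩ ⋂ b : I, ⋂ _ : rep b = a,
        (δ b ⁻¹' N b ∩ ⋂ g : G, ⋂ b' : I,
          ⋂ _ : ∀ x, P'.proj x = b.1 → P'.proj (g.1 x) = b'.1,
            {w | δ b' w = (g.1 * δ b) w})) := by
      ext w
      simp only [W, mem_inter_iff, mem_iInter, mem_preimage, mem_singleton_iff, mem_ofPred_eq,
        Homeomorph.mul_apply]
    rw [hWa]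
    refine (hV.preimage (α a).continuous).inter
      (((P'.isClopen_preimage {a.1}).preimage (α a).continuous).inter ?_)
    refine isClopen_iInter_of_finite fun b => isClopen_iInter_of_finite fun _ =>
      ((hN b).preimage (δ b).continuous).inter ?_
    exact isClopen_iInter_of_finite fun g => isClopen_iInter_of_finite fun b' =>
      isClopen_iInter_of_finite fun _ =>
        hΓ.isPreample.isClopen_eq (hδ b') (Γ.mul_mem (hG' (hGG' g.2)) (hδ b))
  have hJW : ∀ a x w, Corr i j G x w → P'.proj x = a.1 → w ∈ W a := by
    intro a x w hxw hx
    refine ⟨(hαV a x w hxw hx).1, (hαV a x w hxw hx).2, ?_⟩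
    rintro b rfl
    have h1 := hδE b x w hx hxw
    refine ⟨hJN b ⟨_, h1, hγb b x hx⟩, fun g b' hb' => ?_⟩
    have hr : rep b = rep b' := hrep_eq b b' g.1 (hGG' g.2) _ (hγb b x hx) (hb' _ (hγb b x hx))
    have h2 := hδE b' x w (hx.trans (by rw [hr])) hxw
    refine (hfun h2 (h1.map g.2)).1 ?_
    refine heq (γ b') (hγ b') (g.1 * γ b) (G'.mul_mem (hGG' g.2) (hγ b)) x x rfl ?_
    rw [hγb b' x (hx.trans (by rw [hr]))]
    exact (hb' _ (hγb b x hx)).symm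
  obtain ⟨c, hc, hcc, hc1, hc2, hc3⟩ := hΓ.exists_swap
    (fun b : I => ((δ b)⁻¹ : X ≃ₜ X) ⁻¹' W (rep b))
    (fun b => γ b * α (rep b) * (δ b)⁻¹)
    (fun b => Γ.mul_mem (Γ.mul_mem (hG' (hγ b)) (hα _)) (Γ.inv_mem (hδ b)))
    (fun b => (hWc _).preimage ((δ b)⁻¹).continuous)
    (fun b b' x hx hx' => hNd b b' x (by simpa using (hx.2.2 b rfl).1)
      (by simpa using (hx'.2.2 b' rfl).1))
    (fun b b' x x' hx hx' h => by
      have h1 := hγb b _ hx.2.1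
      have h2 := hγb b' _ hx'.2.1
      simp only [Homeomorph.mul_apply] at h
      exact Subtype.ext (h1.symm.trans ((congrArg _ h).trans h2)))
    (fun b b' x hx hx' => hNV b' _ (by simpa using (hx'.2.2 b' rfl).1)
      (hVinv _ (hγ b) _ hx.1))
  have c1 : ∀ b, ∀ w ∈ W (rep b), c (δ b w) = γ b (α (rep b) w) := by
    intro b w hw
    rw [hc1 b (δ b w) (by simpa using hw)]
    simp [Homeomorph.mul_apply]
  have c2 : ∀ b, ∀ w ∈ W (rep b), c (γ b (α (rep b) w)) = δ b w := by
    intro b w hw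
    rw [← c1 b w hw, hcc]
  have c3 : ∀ x, (∀ b, ∀ w ∈ W (rep b), x ≠ δ b w ∧ x ≠ γ b (α (rep b) w)) → c x = x := by
    intro x hx
    refine hc3 x fun b => ⟨fun h => (hx b _ h).1 (by simp), fun y hy h => ?_⟩
    exact (hx b _ hy).2 h.symm
  have hshift : ∀ (g : X ≃ₜ X) (hg : g ∈ G) (b : I), ∃ b' : I, rep b' = rep b ∧
      (∀ w ∈ W (rep b), δ b' w = g (δ b w)) ∧
      ∀ w ∈ W (rep b), γ b' (α (rep b) w) = g (γ b (α (rep b) w)) := by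
    intro g hg b
    obtain ⟨x, w, hxw, hx⟩ := b.2
    let b' : I := ⟨P'.proj (g x), g x, g w, hxw.map hg, rfl⟩
    have hb' : ∀ z, P'.proj z = b.1 → P'.proj (g z) = b'.1 := fun z hz =>
      hmap g (hGG' hg) z x (hz.trans hx.symm)
    have hr : rep b = rep b' := hrep_eq b b' g (hGG' hg) x hx rfl
    refine ⟨b', hr.symm, fun w hw => (hw.2.2 b rfl).2 ⟨g, hg⟩ b' hb', fun w hw => ?_⟩
    refine heq (γ b') (hγ b') (g * γ b) (G'.mul_mem (hGG' hg) (hγ b)) _ _ rfl ?_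
    rw [hγb b' _ (hw.2.1.trans (by rw [hr]))]
    exact (hb' _ (hγb b _ hw.2.1)).symm
  have cases : ∀ x, (∃ b, ∃ w ∈ W (rep b), x = δ b w ∨ x = γ b (α (rep b) w)) ∨ c x = x := by
    intro x
    by_cases h : ∃ b, ∃ w ∈ W (rep b), x = δ b w ∨ x = γ b (α (rep b) w)
    · exact Or.inl h
    · push Not at h
      exact Or.inr (c3 x fun b w hw => h b w hw)
  have hcomm' : ∀ g ∈ G, ∀ x b w, w ∈ W (rep b) → (x = δ b w ∨ x = γ b (α (rep b) w)) →
      c (g x) = g (c x) := by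
    rintro g hg x b w hw (rfl | rfl)
    all_goals
      obtain ⟨b', hr, h1, h2⟩ := hshift g hg b
      have hw' : w ∈ W (rep b') := by rwa [hr]
    · rw [c1 b w hw, ← h1 w hw, ← h2 w hw, c1 b' w hw', hr]
    · rw [c2 b w hw, ← h2 w hw, ← h1 w hw, ← c2 b' w hw', hr]
  have hcomm : ∀ g ∈ G, ∀ x, c (g x) = g (c x) := by
    intro g hg x
    rcases cases x with ⟨b, w, hw, hx⟩ | hx
    · exact hcomm' g hg x b w hw hx
    rcases cases (g x) with ⟨b, w, hw, hx'⟩ | hx'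
    · have := hcomm' g⁻¹ (G.inv_mem hg) (g x) b w hw hx'
      simp only [Homeomorph.inv_apply, Homeomorph.symm_apply_apply] at this
      rw [this]
      simp
    · rw [hx, hx']
  have hcP : ∀ x, P.toSetoid x (c x) := by
    intro x
    rcases cases x with ⟨b, w, hw, rfl | rfl⟩ | hx
    · rw [c1 b w hw]
      exact hNP b _ (hw.2.2 b rfl).1 _ (hγb b _ hw.2.1)
    · rw [c2 b w hw]
      exact P.symm _ _ (hNP b _ (hw.2.2 b rfl).1 _ (hγb b _ hw.2.1))
    · rw [hx]
  have hpt : ∀ y, ∃ (b : I) (x w : X), Corr i j G x w ∧ P'.proj x = (rep b).1 ∧ i y = γ b x ∧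
      P'.proj (i y) = b.1 ∧ c (j y) = γ b (α (rep b) w) ∧ P'.proj (c (j y)) = b.1 ∧
      P'.proj (α (rep b) w) = (rep b).1 := by
    intro y
    have hy : Corr i j G (i y) (j y) := ⟨1, G.one_mem, y, rfl, rfl⟩
    let b : I := ⟨P'.proj (i y), i y, j y, hy, rfl⟩
    obtain ⟨x, w, hxw, hx, h1, h2⟩ := hback b _ _ hy rfl
    have hw := hJW _ x w hxw hx
    have h3 : c (j y) = γ b (α (rep b) w) := by rw [← h2, c1 b w hw]
    exact ⟨b, x, w, hxw, hx, h1.symm, rfl, h3, by rw [h3]; exact hγb b _ hw.2.1, hw.2.1⟩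
  refine ⟨c, hc, hcc, hcomm, hcP, fun y => ?_, fun ε hε y y' => ?_⟩
  · obtain ⟨b, x, w, -, -, -, h1, -, h2, -⟩ := hpt y
    exact (proj_eq_proj_iff P').1 (h1.trans h2.symm)
  · obtain ⟨b, x, w, hxw, hx, e1, e2, e3, e4, e5⟩ := hpt y
    obtain ⟨b', x', w', hxw', hx', e1', e2', e3', e4', e5'⟩ := hpt y'
    have key : P'.proj (ε (i y)) = b'.1 → rep b = rep b' ∧
        ∀ z, P'.proj z = (rep b).1 → ε (γ b z) = γ b' z := by
      intro h
      have hr := hrep_eq b b' ε hε (i y) e2 h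
      refine ⟨hr, fun z hz => ?_⟩
      refine heq (ε * γ b) (G'.mul_mem hε (hγ b)) (γ b') (hγ b') z z rfl ?_
      rw [hγb b' z (hz.trans (by rw [hr])), ← h]
      exact hmap ε hε _ _ ((hγb b z hz).trans e2.symm)
    simp only [Function.comp_apply]
    constructor
    · intro h
      obtain ⟨hr, hz⟩ := key (by rw [h, e2'])
      have h1 : γ b' x = γ b' x' := by rw [← hz x hx, ← e1, h, e1']
      have h2 : w = w' := (hfun hxw hxw').1 ((γ b').injective h1)
      rw [e3, hz _ e5, e3', h2, hr]
    · intro h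
      obtain ⟨hr, hz⟩ := key (by
        rw [← e4', ← h]
        exact hmap ε hε _ _ (e2.trans e4.symm))
      have h1 : γ b' (α (rep b) w) = γ b' (α (rep b) w') := by
        rw [← hz _ e5, ← e3, h, e3', hr]
      have h2 : x = x' := (hfun hxw hxw').2 ((α _).injective ((γ b').injective h1))
      rw [e1, hz x hx, e1', h2]

end Step

/-! ### Limits of sequences of homeomorphisms -/

section Limit

variable {X : Type*} [TopologicalSpace X]

/-- Dependent choice, for a relation between successive terms. -/
theorem exists_seq_of_step {α : Type*} {p : ℕ → α → Prop} {r : ℕ → α → α → Prop}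
    (h₀ : ∃ a, p 0 a) (hs : ∀ n a, p n a → ∃ b, p (n + 1) b ∧ r n a b) :
    ∃ f : ℕ → α, (∀ n, p n (f n)) ∧ ∀ n, r n (f n) (f (n + 1)) := by
  obtain ⟨a, ha⟩ := h₀
  choose b hb hr using hs
  let f : ∀ n, {a // p n a} := fun n => Nat.rec ⟨a, ha⟩ (fun n a => ⟨b n a.1 a.2, hb n a.1 a.2⟩) n
  exact ⟨fun n => (f n).1, fun n => (f n).2, fun n => hr n (f n).1 (f n).2⟩

/-- A sequence of finite clopen partitions which separates the points. -/
theorem exists_seq_discreteQuotient [CompactSpace X] [T2Space X] [TotallyDisconnectedSpace X]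
    [SecondCountableTopology X] :
    ∃ Q : ℕ → DiscreteQuotient X, ∀ x y, (∀ n, (Q n).toSetoid x y) → x = y := by
  have hC : Countable (TopologicalSpace.Clopens X) :=
    TopologicalSpace.Clopens.countable_iff_secondCountable.2 inferInstance
  obtain ⟨e, he⟩ := exists_surjective_nat (TopologicalSpace.Clopens X)
  refine ⟨fun n => DiscreteQuotient.ofIsClopen (e n).isClopen, fun x y h => ?_⟩
  by_contra hxy
  obtain ⟨V, hV, hxV, hVy⟩ := compact_exists_isClopen_in_isOpen
    (isOpen_compl_singleton (x := y)) hxy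
  obtain ⟨n, hn⟩ := he ⟨V, hV⟩
  have := (h n).1 (by
    rw [hn]
    exact hxV)
  rw [hn] at this
  exact hVy this rfl

theorem isClosed_discreteQuotient_rel (P : DiscreteQuotient X) :
    IsClosed {p : X × X | P.toSetoid p.1 p.2} := by
  have : {p : X × X | P.toSetoid p.1 p.2} =
      (fun p : X × X => (P.proj p.1, P.proj p.2)) ⁻¹' {q | q.1 = q.2} := by
    ext p
    exact (proj_eq_proj_iff P).symm
  rw [this]
  exact (isClosed_discrete _).preimage
    ((P.proj_continuous.comp continuous_fst).prodMk (P.proj_continuous.comp continuous_snd))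

theorem isClosed_discreteQuotient_class (P : DiscreteQuotient X) (x : X) :
    IsClosed {y | P.toSetoid x y} :=
  (P.isClopen_setOfPred_rel x).isClosed

/-- A sequence of homeomorphisms, each obtained from the preceding one by a modification inside the
classes of finer and finer partitions, converges to a homeomorphism. -/
theorem exists_limit_homeomorph [CompactSpace X] [T2Space X] (g : ℕ → X ≃ₜ X)
    (P Q : ℕ → DiscreteQuotient X) (hP : ∀ n, P (n + 1) ≤ P n) (hPQ : ∀ n, P n ≤ Q n)
    (hQ : ∀ x y, (∀ n, (Q n).toSetoid x y) → x = y)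
    (hgQ : ∀ n x y, (P n).toSetoid x y → (Q n).toSetoid (g n x) (g n y))
    (hg : ∀ n x, (P n).toSetoid ((g n).symm x) ((g (n + 1)).symm x)) :
    ∃ H : X ≃ₜ X, (∀ n x, (P n).toSetoid x ((g n).symm (H x))) ∧
      ∀ x y, (∃ N, ∀ n ≥ N, (P n).toSetoid x ((g n).symm y)) → H x = y := by
  have hanti : Antitone P := antitone_nat_of_succ_le hP
  have hPsep : ∀ x y, (∀ n, (P n).toSetoid x y) → x = y := fun x y h =>
    hQ x y fun n => hPQ n (h n)
  have hex1 : ∀ y, ∃ x, ∀ n, (P n).toSetoid x ((g n).symm y) := by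
    intro y
    obtain ⟨x, hx⟩ := IsCompact.nonempty_iInter_of_sequence_nonempty_isCompact_isClosed
      (fun n => {x | (P n).toSetoid ((g n).symm y) x})
      (fun n x hx => (P n).trans _ _ _ (hg n y) (hP n hx)) (fun n => ⟨_, (P n).refl _⟩)
      (isClosed_discreteQuotient_class _ _).isCompact
      (fun n => isClosed_discreteQuotient_class _ _)
    exact ⟨x, fun n => (P n).symm _ _ (mem_iInter.1 hx n)⟩
  have hex2 : ∀ x, ∃ y, ∀ n, (P n).toSetoid x ((g n).symm y) := by
    intro x
    have hcl : ∀ n, IsClosed ((g n).symm ⁻¹' {z | (P n).toSetoid x z}) := fun n =>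
      (isClosed_discreteQuotient_class _ _).preimage (g n).symm.continuous
    obtain ⟨y, hy⟩ := IsCompact.nonempty_iInter_of_sequence_nonempty_isCompact_isClosed
      (fun n => (g n).symm ⁻¹' {z | (P n).toSetoid x z})
      (fun n y hy => (P n).trans _ _ _ (hP n hy) ((P n).symm _ _ (hg n y)))
      (fun n => ⟨g n x, by simp⟩) (hcl 0).isCompact hcl
    exact ⟨y, fun n => mem_iInter.1 hy n⟩
  have huniq1 : ∀ x x' y, (∀ n, (P n).toSetoid x ((g n).symm y)) →
      (∀ n, (P n).toSetoid x' ((g n).symm y)) → x = x' := fun x x' y h h' =>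
    hPsep _ _ fun n => (P n).trans _ _ _ (h n) ((P n).symm _ _ (h' n))
  have huniq2 : ∀ x y y', (∀ n, (P n).toSetoid x ((g n).symm y)) →
      (∀ n, (P n).toSetoid x ((g n).symm y')) → y = y' := fun x y y' h h' =>
    hQ _ _ fun n => by
      have h1 := hgQ n _ _ ((P n).trans _ _ _ ((P n).symm _ _ (h n)) (h' n))
      simpa using h1
  choose k hk using hex1
  choose h hh using hex2
  have hkc : Continuous k := by
    refine continuous_iff_isClosed.2 fun C hC => ?_
    have hR : IsClosed {p : X × X | p.1 ∈ C ∧ ∀ n, (P n).toSetoid p.1 ((g n).symm p.2)} := by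
      have : {p : X × X | ∀ n, (P n).toSetoid p.1 ((g n).symm p.2)} =
          ⋂ n, (fun p : X × X => (p.1, (g n).symm p.2)) ⁻¹' {q | (P n).toSetoid q.1 q.2} := by
        ext p
        simp
      have h2 : IsClosed {p : X × X | ∀ n, (P n).toSetoid p.1 ((g n).symm p.2)} :=
        this ▸ isClosed_iInter fun n => (isClosed_discreteQuotient_rel (P n)).preimage
          (continuous_fst.prodMk ((g n).symm.continuous.comp continuous_snd))
      exact (hC.preimage continuous_fst).inter h2
    convert isClosedMap_snd_of_compactSpace _ hR using 1
    ext y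
    simp only [mem_preimage, mem_image, Prod.exists, mem_ofPred_eq, exists_eq_right]
    exact ⟨fun h => ⟨_, h, hk y⟩, fun ⟨x, hx, hxy⟩ => by rwa [huniq1 _ _ y (hk y) hxy]⟩
  let e : X ≃ X :=
    { toFun := k
      invFun := h
      left_inv := fun y => huniq2 (k y) _ _ (hh _) (hk _)
      right_inv := fun x => huniq1 _ _ (h x) (hk _) (hh _) }
  have hec : Continuous e := hkc
  refine ⟨(hec.homeoOfEquivCompactToT2).symm, fun n x => hh x n, fun x y ⟨N, hN⟩ => ?_⟩
  refine huniq2 x _ _ (hh x) fun n => ?_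
  have key : ∀ d n, N ≤ n + d → (P n).toSetoid x ((g n).symm y) := by
    intro d
    induction d with
    | zero => exact fun n hn => hN n hn
    | succ d ih =>
      intro n hn
      exact (P n).trans _ _ _ (hP n (ih (n + 1) (by omega))) ((P n).symm _ _ (hg n y))
  exact key N n (by omega)

end Limit

/-! ### Extension of étale embeddings -/

section Extension

variable {X Y : Type*} [TopologicalSpace X] [TopologicalSpace Y]

theorem Matches.symm {Y : Type*} {i j : Y → X} {G : Subgroup (X ≃ₜ X)} {P : DiscreteQuotient X}
    (h : Matches i j G P) : Matches j i G P :=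
  ⟨fun y => P.symm _ _ (h.rel y), fun γ hγ y z => (h.iff γ hγ y z).symm⟩

/-- A step forth, modifying `j`, and a step back, modifying `i`; conjugation turns the latter into a
further modification of `j`. The new finite group contains `E` and its conjugate by the new
homeomorphism `g * c`. -/
theorem Matches.exists_step_step [CompactSpace X] [T2Space X] [TotallyDisconnectedSpace X]
    [∀ x : X, (𝓝[≠] x).NeBot] [CompactSpace Y] {Γ : Subgroup (X ≃ₜ X)} (hΓ : IsAmple Γ)
    {S : Subgroup (Y ≃ₜ Y)} {i j : Y → X} (hi : IsEtaleEmb Γ S i) (hj : IsEtaleEmb Γ S j)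
    (his : IsSmall Γ i) (hjs : IsSmall Γ j) {g : X ≃ₜ X} (hg : g ∈ Γ) {G E : Subgroup (X ≃ₜ X)}
    (hGfin : Finite G) (hEfin : Finite E) (hG : G ≤ Γ) (hE : E ≤ Γ)
    {P : DiscreteQuotient X} (hP : Adapted G P) (hm : Matches i (g.symm ∘ j) G P)
    (Q : DiscreteQuotient X) :
    ∃ c ∈ Γ, ∃ G' : Subgroup (X ≃ₜ X), ∃ P' : DiscreteQuotient X, Finite G' ∧ G' ≤ Γ ∧ G ≤ G' ∧
      P' ≤ P ∧ Adapted G' P' ∧ Matches i ((g * c).symm ∘ j) G' P' ∧ E ≤ G' ∧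
      (∀ γ ∈ E, (g * c)⁻¹ * γ * (g * c) ∈ G') ∧ P' ≤ Q ∧
      (∀ x y, P'.toSetoid x y → Q.toSetoid ((g * c) x) ((g * c) y)) ∧
      (∀ γ ∈ G, c * γ = γ * c) ∧ ∀ x, P.toSetoid x (c.symm x) := by
  have hgi := Γ.inv_mem hg
  obtain ⟨G₁, hG₁fin, hG₁, hGG₁, hEG₁⟩ := hΓ.isPreample.exists_finite_ge hGfin hG
    (toFinite (E : Set (X ≃ₜ X))) hE
  obtain ⟨P₁, hP₁P, hP₁Q, hP₁, c₁, hc₁, hcc₁, hc₁G, hc₁P, hm₁⟩ := hm.exists_step hΓ hi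
    (hj.comp_mem hgi) (hjs.comp_mem hgi) hG₁ hGG₁ hP Q
  let g₁ := g * c₁
  have hg₁ : g₁ ∈ Γ := Γ.mul_mem hg hc₁
  obtain ⟨G₂, hG₂fin, hG₂, hG₁G₂, hEG₂⟩ := hΓ.isPreample.exists_finite_ge hG₁fin hG₁
    (F := (fun γ => g₁⁻¹ * γ * g₁) '' E) ((toFinite (E : Set (X ≃ₜ X))).image _) (by
      rintro _ ⟨γ, hγ, rfl⟩
      exact Γ.mul_mem (Γ.mul_mem (Γ.inv_mem hg₁) (hE hγ)) hg₁)
  obtain ⟨P₂, hP₂P, hP₂Q, hP₂, c₂, hc₂, hcc₂, hc₂G, hc₂P, hm₂⟩ := hm₁.symm.exists_step hΓ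
    ((hj.comp_mem hgi).comp_mem hc₁) hi his hG₂ hG₁G₂ hP₁ (Q.comap ⟨g₁, g₁.continuous⟩)
  have hs₁ : ∀ x, c₁.symm x = c₁ x := fun x => by rw [Homeomorph.symm_apply_eq, hcc₁]
  have hs₂ : ∀ x, c₂.symm x = c₂ x := fun x => by rw [Homeomorph.symm_apply_eq, hcc₂]
  have hi₂ : c₂ * c₂ = 1 := by
    ext x
    exact hcc₂ x
  -- conjugating by `c₂` turns the modification of `i` into a modification of `j`
  let G' : Subgroup (X ≃ₜ X) := G₂.map (MulAut.conj c₂).toMonoidHom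
  have hG'mem : ∀ γ, γ ∈ G' ↔ ∃ δ ∈ G₂, c₂ * δ * c₂⁻¹ = γ := fun γ => Subgroup.mem_map
  have hG'ge : G₁ ≤ G' := by
    intro γ hγ
    refine (hG'mem γ).2 ⟨γ, hG₁G₂ hγ, ?_⟩
    rw [mul_inv_eq_iff_eq_mul]
    ext x
    exact hc₂G γ hγ x
  let P' : DiscreteQuotient X := P₂.comap ⟨c₂, c₂.continuous⟩
  have hP'P₁ : P' ≤ P₁ := by
    intro x y hxy
    have h1 : P₁.toSetoid (c₂ x) (c₂ y) := hP₂P hxy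
    exact P₁.trans _ _ _ (hc₂P x) (P₁.trans _ _ _ h1 (P₁.symm _ _ (hc₂P y)))
  refine ⟨c₁ * c₂, Γ.mul_mem hc₁ hc₂, G', P', ?_, ?_, hGG₁.trans hG'ge, hP'P₁.trans hP₁P, ?_, ?_,
    fun γ hγ => hG'ge (hEG₁ hγ), ?_, hP'P₁.trans hP₁Q, ?_, ?_, ?_⟩
  · exact ((toFinite (G₂ : Set (X ≃ₜ X))).image _).to_subtype
  · intro γ hγ
    obtain ⟨δ, hδ, rfl⟩ := (hG'mem γ).1 hγ
    exact Γ.mul_mem (Γ.mul_mem hc₂ (hG₂ hδ)) (Γ.inv_mem hc₂)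
  · refine ⟨?_, ?_⟩
    · intro γ hγ x y hxy
      obtain ⟨δ, hδ, rfl⟩ := (hG'mem γ).1 hγ
      have := hP₂.map δ hδ _ _ hxy
      change P₂.toSetoid (c₂ _) (c₂ _)
      simpa [Homeomorph.mul_apply, hs₂, hcc₂] using this
    · intro γ hγ x hxy
      obtain ⟨δ, hδ, rfl⟩ := (hG'mem γ).1 hγ
      have := hP₂.fix δ hδ (c₂ x) (by
        change P₂.toSetoid (c₂ _) (c₂ _) at hxy
        simpa [Homeomorph.mul_apply, hs₂, hcc₂] using hxy)
      simp [Homeomorph.mul_apply, hs₂, hcc₂, this]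
  · have e : ∀ y, (g * (c₁ * c₂)).symm y = c₂ (c₁ (g.symm y)) := fun y => by
      rw [Homeomorph.symm_apply_eq]
      simp [Homeomorph.mul_apply, hcc₁, hcc₂]
    refine ⟨fun y => ?_, ?_⟩
    · simp only [Function.comp_apply, e]
      change P₂.toSetoid (c₂ _) (c₂ _)
      rw [hcc₂]
      exact P₂.symm _ _ (hm₂.rel y)
    · intro γ hγ y z
      obtain ⟨δ, hδ, rfl⟩ := (hG'mem γ).1 hγ
      have := hm₂.iff δ hδ y z
      simp only [Function.comp_apply, Homeomorph.inv_apply] at this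
      simp only [Function.comp_apply, e, Homeomorph.mul_apply, Homeomorph.inv_apply, hs₂, hcc₂,
        EmbeddingLike.apply_eq_iff_eq]
      rw [this]
      constructor
      · intro h
        rw [← h, hcc₂]
      · intro h
        rw [h, hcc₂]
  · intro γ hγ
    refine (hG'mem _).2 ⟨_, hEG₂ ⟨γ, hγ, rfl⟩, ?_⟩
    have : c₂⁻¹ = c₂ := inv_eq_of_mul_eq_one_left hi₂
    simp only [g₁, mul_inv_rev, this, mul_assoc]
  · intro x y hxy
    exact hP₂Q hxy
  · intro γ hγ
    ext x
    simp only [Homeomorph.mul_apply]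
    rw [hc₂G γ (hGG₁ hγ), hc₁G γ hγ]
  · intro x
    have : (c₁ * c₂).symm x = c₂ (c₁ x) := by
      rw [Homeomorph.symm_apply_eq]
      simp [Homeomorph.mul_apply, hcc₁, hcc₂]
    rw [this]
    exact P.trans _ _ _ (hc₁P x) (hP₁P (hc₂P _))

/-- Any two small étale embeddings of the same space are conjugate under a homeomorphism which
normalizes the group. This homeomorphism `H` is the limit of elements `g n` of `Γ`, where
`g (n + 1) = g n * c` with `c` commuting with the `n`-th finite group. -/
theorem IsEtaleEmb.exists_conj [CompactSpace X] [T2Space X] [TotallyDisconnectedSpace X]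
    [SecondCountableTopology X]
    [∀ x : X, (𝓝[≠] x).NeBot] [CompactSpace Y] {Γ : Subgroup (X ≃ₜ X)} (hΓ : IsAmple Γ)
    {S : Subgroup (Y ≃ₜ Y)} {i j : Y → X} (hi : IsEtaleEmb Γ S i) (hj : IsEtaleEmb Γ S j)
    (his : IsSmall Γ i) (hjs : IsSmall Γ j) :
    ∃ H : X ≃ₜ X, (∀ γ, γ ∈ Γ ↔ H * γ * H⁻¹ ∈ Γ) ∧ ∀ y, H (i y) = j y := by
  obtain ⟨E, hEmono, hEfin, hE, hEex⟩ := hΓ.isPreample.exists_exhaustion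
  obtain ⟨Q, hQ⟩ := exists_seq_discreteQuotient (X := X)
  let p : ℕ → ((X ≃ₜ X) × Subgroup (X ≃ₜ X) × DiscreteQuotient X) → Prop := fun n s =>
    s.1 ∈ Γ ∧ Finite s.2.1 ∧ s.2.1 ≤ Γ ∧ Adapted s.2.1 s.2.2 ∧
      Matches i (s.1.symm ∘ j) s.2.1 s.2.2 ∧ E n ≤ s.2.1 ∧ (∀ γ ∈ E n, s.1⁻¹ * γ * s.1 ∈ s.2.1) ∧
      s.2.2 ≤ Q n ∧ ∀ x y, s.2.2.toSetoid x y → (Q n).toSetoid (s.1 x) (s.1 y)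
  let r : ℕ → ((X ≃ₜ X) × Subgroup (X ≃ₜ X) × DiscreteQuotient X) →
      ((X ≃ₜ X) × Subgroup (X ≃ₜ X) × DiscreteQuotient X) → Prop := fun _ s t =>
    s.2.1 ≤ t.2.1 ∧ t.2.2 ≤ s.2.2 ∧ ∃ c, t.1 = s.1 * c ∧ (∀ γ ∈ s.2.1, c * γ = γ * c) ∧
      ∀ x, s.2.2.toSetoid x (c.symm x)
  obtain ⟨f, hf, hfr⟩ := exists_seq_of_step (p := p) (r := r) (by
      obtain ⟨c, hc, G', P', h1, h2, -, -, h3, h4, h5, h6, h7, h8, -⟩ :=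
        Matches.exists_step_step (g := 1) (G := ⊥) (E := E 0) (P := ⊤) hΓ hi hj his hjs Γ.one_mem
        inferInstance (hEfin 0) bot_le (hE 0)
        ⟨fun _ _ _ _ _ => trivial, fun γ hγ x _ => by rw [Subgroup.mem_bot.1 hγ]; rfl⟩
        ⟨fun _ => trivial, fun γ hγ y z => by
          rw [Subgroup.mem_bot.1 hγ]
          exact hi.injective.eq_iff.trans hj.injective.eq_iff.symm⟩ (Q 0)
      exact ⟨(1 * c, G', P'), Γ.mul_mem Γ.one_mem hc, h1, h2, h3, h4, h5, h6, h7, h8⟩) (by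
      rintro n ⟨g, G, P⟩ ⟨h1, h2, h3, h4, h5, -, -, -, -⟩
      obtain ⟨c, hc, G', P', k1, k2, k3, k4, k5, k6, k7, k8, k9, k10, k11, k12⟩ :=
        Matches.exists_step_step hΓ hi hj his hjs h1 h2 (hEfin (n + 1)) h3 (hE _) h4 h5 (Q (n + 1))
      exact ⟨(g * c, G', P'), ⟨Γ.mul_mem h1 hc, k1, k2, k5, k6, k7, k8, k9, k10⟩, k3, k4, c, rfl,
        k11, k12⟩)
  obtain ⟨H, hH, hH'⟩ := exists_limit_homeomorph (fun n => (f n).1) (fun n => (f n).2.2) Q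
    (fun n => (hfr n).2.1) (fun n => (hf n).2.2.2.2.2.2.2.1) hQ
    (fun n => (hf n).2.2.2.2.2.2.2.2) (fun n x => by
      obtain ⟨-, -, c, hc, -, hcP⟩ := hfr n
      have := hcP ((f n).1.symm x)
      rw [hc]
      exact this)
  have hGmono : Monotone fun n => (f n).2.1 := monotone_nat_of_le_succ fun n => (hfr n).1
  -- the conjugates of an element of the `n`-th finite group do not change after the `n`-th step
  have hconj : ∀ n, ∀ γ ∈ (f n).2.1, H * γ * H⁻¹ = (f n).1 * γ * (f n).1⁻¹ := by
    intro n γ hγ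
    have hconst : ∀ m ≥ n, (f m).1 * γ * (f m).1⁻¹ = (f n).1 * γ * (f n).1⁻¹ := by
      intro m hm
      induction m, hm using Nat.le_induction with
      | base => rfl
      | succ m hm ih =>
        obtain ⟨-, -, c, hc, hcγ, -⟩ := hfr m
        rw [← ih, hc, mul_assoc (f m).1 c γ, hcγ γ (hGmono hm hγ)]
        group
    rw [mul_inv_eq_iff_eq_mul]
    ext x
    refine hH' (γ x) _ ⟨n, fun m hm => ?_⟩
    have h1 := (hf m).2.2.2.1.map γ (hGmono hm hγ) _ _ (hH m x)
    have h2 : (f m).1.symm (((f n).1 * γ * (f n).1⁻¹ * H) x) = γ ((f m).1.symm (H x)) := by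
      rw [← hconst m hm, Homeomorph.symm_apply_eq]
      rfl
    rw [h2]
    exact h1
  refine ⟨H, fun γ => ⟨fun hγ => ?_, fun hγ => ?_⟩, fun y => hH' _ _ ⟨0, fun n _ => ?_⟩⟩
  · obtain ⟨n, hn⟩ := hEex γ hγ
    rw [hconj n γ ((hf n).2.2.2.2.2.1 hn)]
    exact Γ.mul_mem (Γ.mul_mem (hf n).1 hγ) (Γ.inv_mem (hf n).1)
  · obtain ⟨n, hn⟩ := hEex _ hγ
    have h1 := (hf n).2.2.2.2.2.2.1 _ hn
    have h2 := hconj n _ h1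
    have h3 : γ = (f n).1⁻¹ * (H * γ * H⁻¹) * (f n).1 := by
      rw [show (f n).1 * ((f n).1⁻¹ * (H * γ * H⁻¹) * (f n).1) * (f n).1⁻¹ = H * γ * H⁻¹ by
        group] at h2
      exact (mul_left_cancel (mul_right_cancel h2)).symm
    rw [h3]
    exact (hf n).2.2.1 h1
  · exact (hf n).2.2.2.2.1.rel y

end Extension

/-! ### Shrinking an ample group along an étale embedding -/

section Shrink

variable {X Y : Type*} [TopologicalSpace X] [TopologicalSpace Y]

theorem exists_isClopen_between [CompactSpace X] [T2Space X] [TotallyDisconnectedSpace X]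
    {K U : Set X} (hK : IsClosed K) (hU : IsOpen U) (hKU : K ⊆ U) :
    ∃ V, IsClopen V ∧ K ⊆ V ∧ V ⊆ U := by
  obtain ⟨Q, hQ⟩ := exists_discreteQuotient_forall (X := X) (p := fun s => s ⊆ U ∨ s ⊆ Kᶜ)
    (fun s t hts h => h.imp hts.trans hts.trans) (fun x => by
      by_cases hx : x ∈ K
      · exact ⟨U, hU.mem_nhds (hKU hx), Or.inl subset_rfl⟩
      · exact ⟨Kᶜ, hK.isOpen_compl.mem_nhds hx, Or.inr subset_rfl⟩)
  refine ⟨Q.proj ⁻¹' (Q.proj '' K), Q.isClopen_preimage _, subset_preimage_image _ _, ?_⟩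
  rintro x ⟨y, hy, hyx⟩
  rw [proj_eq_proj_iff] at hyx
  rcases hQ y with h | h
  · exact h hyx
  · exact absurd hy (h (Q.refl y))

theorem isFull_of_fullGroup_subset {Γ : Subgroup (X ≃ₜ X)}
    (h : fullGroup Γ ⊆ (Γ : Set (X ≃ₜ X))) : IsFull Γ := by
  refine subset_antisymm (fun γ hγ => ⟨1, fun _ => univ, fun _ => γ, fun _ => isClopen_univ,
    fun i k hik => absurd (Subsingleton.elim i k) hik, ?_, fun _ => hγ, fun _ _ _ => rfl⟩) h
  ext x
  simp

/-- The elements of `Γ` which move no point out of its `R`-class. -/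
def subgroupOfSetoid (Γ : Subgroup (X ≃ₜ X)) (R : Setoid X) : Subgroup (X ≃ₜ X) where
  carrier := {γ | γ ∈ Γ ∧ ∀ z, R z (γ z)}
  mul_mem' := by
    rintro γ δ ⟨hγ, hγR⟩ ⟨hδ, hδR⟩
    exact ⟨Γ.mul_mem hγ hδ, fun z => R.trans (hδR z) (hγR (δ z))⟩
  one_mem' := ⟨Γ.one_mem, fun z => R.refl z⟩
  inv_mem' := by
    rintro γ ⟨hγ, hγR⟩
    refine ⟨Γ.inv_mem hγ, fun z => ?_⟩
    have := hγR (γ⁻¹ z)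
    simp only [Homeomorph.inv_apply, Homeomorph.apply_symm_apply] at this
    exact R.symm this

theorem subgroupOfSetoid_le (Γ : Subgroup (X ≃ₜ X)) (R : Setoid X) : subgroupOfSetoid Γ R ≤ Γ :=
  fun _ hγ => hγ.1

theorem IsAmple.subgroupOfSetoid {Γ : Subgroup (X ≃ₜ X)} (hΓ : IsAmple Γ) (R : Setoid X) :
    IsAmple (subgroupOfSetoid Γ R) := by
  have h := hΓ.isPreample.mono (subgroupOfSetoid_le Γ R)
  refine ⟨h.countable, h.locallyFinite, isFull_of_fullGroup_subset ?_, h.isClopen_fixedPoints⟩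
  rintro g ⟨n, U, γ, hU, hd, hcov, hγ, hg⟩
  constructor
  · have : g ∈ fullGroup Γ := ⟨n, U, γ, hU, hd, hcov, fun i => (hγ i).1, hg⟩
    rw [← hΓ.full] at this
    exact this
  · intro z
    obtain ⟨i, hi⟩ := mem_iUnion.1 (hcov ▸ mem_univ z : z ∈ ⋃ i, U i)
    rw [hg i z hi]
    exact (hγ i).2 z

/-- The involution swapping `W` and `γ '' W` preserves the relation `R` if `γ` does so on `W`. -/
theorem IsAmple.exists_mem_subgroupOfSetoid [CompactSpace X] [T2Space X]
    [TotallyDisconnectedSpace X] {Γ : Subgroup (X ≃ₜ X)} (hΓ : IsAmple Γ) {R : Setoid X}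
    {γ : X ≃ₜ X} (hγ : γ ∈ Γ) {W : Set X} (hW : IsClopen W) (hd : ∀ z ∈ W, γ z ∉ W)
    (hR : ∀ z ∈ W, R z (γ z)) : ∃ c ∈ AmpleGroup.subgroupOfSetoid Γ R, ∀ z ∈ W, c z = γ z := by
  obtain ⟨c, hc, -, h1, h2, h3⟩ := hΓ.exists_swap_one hγ hW hd
  refine ⟨c, ⟨hc, fun z => ?_⟩, h1⟩
  by_cases hz : z ∈ W
  · rw [h1 z hz]
    exact hR z hz
  by_cases hz' : ∃ y ∈ W, γ y = z
  · obtain ⟨y, hy, rfl⟩ := hz'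
    rw [h2 y hy]
    exact R.symm (hR y hy)
  · rw [h3 z hz fun y hy h => hz' ⟨y, hy, h⟩]

/-- If the relation `R` is open in the orbit relation near `z`, then the elements of `Γ` which map
`z` to an `R`-equivalent point can be modified away from `z` to preserve `R`. -/
theorem IsAmple.exists_mem_subgroupOfSetoid_eventually [CompactSpace X] [T2Space X]
    [TotallyDisconnectedSpace X] {Γ : Subgroup (X ≃ₜ X)} (hΓ : IsAmple Γ) {R : Setoid X}
    {γ : X ≃ₜ X} (hγ : γ ∈ Γ) {z : X} (hz : ∀ᶠ w in 𝓝 z, R w (γ w)) :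
    ∃ c ∈ AmpleGroup.subgroupOfSetoid Γ R, ∀ᶠ w in 𝓝 z, c w = γ w := by
  by_cases hfix : γ z = z
  · exact ⟨1, Subgroup.one_mem _, (hΓ.isPreample.eventually_eq hγ Γ.one_mem hfix).mono
      fun w hw => hw.symm⟩
  obtain ⟨u, v, hu, hv, hzu, hzv, huv⟩ := t2_separation hfix
  obtain ⟨W, hW, hzW, hWs⟩ := compact_exists_isClopen_in_isOpen isOpen_interior
    (mem_interior_iff_mem_nhds.2 (inter_mem hz (inter_mem (hv.mem_nhds hzv)
      (γ.continuous.continuousAt.preimage_mem_nhds (hu.mem_nhds hzu)))))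
  have hWs' := hWs.trans interior_subset
  obtain ⟨c, hc, h⟩ := hΓ.exists_mem_subgroupOfSetoid hγ hW
    (fun w hw hw' => huv.le_bot ⟨(hWs' hw).2.2, (hWs' hw').2.1⟩) (fun w hw => (hWs' hw).1)
  exact ⟨c, hc, mem_of_superset (hW.isOpen.mem_nhds hzW) h⟩

/-- An exhaustion of `Γ` by finite groups `G n`, together with elements `δ n` which move the range
of `j` into prescribed clopen sets, so that no element of `G n` maps a point of the moved range to a
point of the range of `j` or to another point of the moved range. -/
theorem exists_exhaustion_moving [CompactSpace X] [T2Space X] [TotallyDisconnectedSpace X]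
    [∀ x : X, (𝓝[≠] x).NeBot] [CompactSpace Y] {Γ : Subgroup (X ≃ₜ X)} (hΓ : IsAmple Γ)
    {j : Y → X} (hj : Continuous j) (hinj : Function.Injective j) (hjs : IsSmall Γ j)
    (B : ℕ → Set X) (hB : ∀ n, IsClopen (B n)) (hBne : ∀ n, (B n).Nonempty) :
    ∃ (G : ℕ → Subgroup (X ≃ₜ X)) (δ : ℕ → X ≃ₜ X), G 0 = ⊥ ∧ Monotone G ∧ (∀ n, Finite (G n)) ∧
      (∀ n, G n ≤ Γ) ∧ (∀ γ ∈ Γ, ∃ n, γ ∈ G n) ∧ (∀ n, δ n ∈ G (n + 1)) ∧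
      (∀ n y, δ n (j y) ∈ B n) ∧ (∀ n, ∀ g ∈ G n, ∀ y y', g (δ n (j y)) ≠ j y') ∧
      ∀ n, ∀ g ∈ G n, ∀ y y', g (δ n (j y)) = δ n (j y') → y = y' := by
  obtain ⟨E, hEmono, hEfin, hE, hEex⟩ := hΓ.isPreample.exists_exhaustion
  obtain ⟨G, hG, hGr⟩ := exists_seq_of_step
    (p := fun n (G : Subgroup (X ≃ₜ X)) => Finite G ∧ G ≤ Γ ∧ (n = 0 → G = ⊥))
    (r := fun n G G' => G ≤ G' ∧ E n ≤ G' ∧ ∃ δ ∈ G', (∀ y, δ (j y) ∈ B n) ∧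
      (∀ g ∈ G, ∀ y y', g (δ (j y)) ≠ j y') ∧
      ∀ g ∈ G, ∀ y y', g (δ (j y)) = δ (j y') → y = y')
    ⟨⊥, inferInstance, bot_le, fun _ => rfl⟩ (by
      rintro n G ⟨hGfin, hG, -⟩
      obtain ⟨A, hAB, hA, hAne, hAj⟩ := hjs.exists_isClopen_disjoint hΓ hj G (hB n) (hBne n)
      obtain ⟨Q, -, hQ⟩ := hΓ.isPreample.exists_adapted G hGfin hG ⊤
      obtain ⟨x, hx⟩ := hAne
      obtain ⟨δ, hδ, hδA⟩ := hjs (A ∩ {w | Q.toSetoid x w})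
        (hA.inter (Q.isClopen_setOfPred_rel x)) ⟨x, hx, Q.refl x⟩
      obtain ⟨G', hG'fin, hG', hGG', hFG'⟩ := hΓ.isPreample.exists_finite_ge hGfin hG
        (F := insert δ (E n : Set (X ≃ₜ X))) ((toFinite _).insert _)
        (insert_subset hδ (hE n))
      refine ⟨G', ⟨hG'fin, hG', by simp⟩, hGG', (subset_insert _ _).trans hFG', δ,
        hFG' (mem_insert _ _), fun y => hAB (hδA y).1, fun g hg y y' h => ?_, fun g hg y y' h => ?_⟩
      · refine hAj g⁻¹ (G.inv_mem hg) y' ?_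
        rw [← h]
        simpa using (hδA y).1
      · have := hQ.fix g hg (δ (j y)) (by
          rw [h]
          exact Q.trans _ _ _ (Q.symm _ _ (hδA y).2) (hδA y').2)
        rw [h] at this
        exact (hinj (δ.injective this)).symm)
  have hGmono : Monotone G := monotone_nat_of_le_succ fun n => (hGr n).1
  choose δ hδ h1 h2 h3 using fun n => (hGr n).2.2
  exact ⟨G, δ, (hG 0).2.2 rfl, hGmono, fun n => (hG n).1, fun n => (hG n).2.1, fun γ hγ => by
    obtain ⟨n, hn⟩ := hEex γ hγ
    exact ⟨n + 1, (hGr n).2.1 hn⟩, hδ, h1, h2, h3⟩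

/-- The rule attaching a point `y` of `Y` to a point `z` of `X` which enters the saturation of the
range of `j` at the stage `n` of an exhaustion `G`: at a positive stage `n + 1`, take the point `y`
such that `δ n (j y)` is `G n`-equivalent to `z` if there is one, and otherwise the point with the
least value of `φ (j y)` among those such that `j y` is `G (n + 1)`-equivalent to `z`. -/
def Selects (G : ℕ → Subgroup (X ≃ₜ X)) (δ : ℕ → X ≃ₜ X) (φ : X → ℝ) (j : Y → X) :
    ℕ → X → Y → Prop
  | 0, z, y => z = j y
  | n + 1, z, y => (∃ g ∈ G n, g z = δ n (j y)) ∨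
      ((∀ y', ∀ g ∈ G n, g z ≠ δ n (j y')) ∧ (∃ g ∈ G (n + 1), g z = j y) ∧
        ∀ g ∈ G (n + 1), ∀ y', g z = j y' → φ (j y) ≤ φ (j y'))

section Selects

variable {Y : Type*} {G : ℕ → Subgroup (X ≃ₜ X)} {δ : ℕ → X ≃ₜ X} {φ : X → ℝ} {j : Y → X}

theorem Selects.exists [∀ n, Finite (G n)] (h₀ : G 0 = ⊥) (n : ℕ) (z : X)
    (hz : ∃ g ∈ G n, ∃ y, g z = j y) : ∃ y, Selects G δ φ j n z y := by
  cases n with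
  | zero =>
    obtain ⟨g, hg, y, hy⟩ := hz
    rw [h₀, Subgroup.mem_bot] at hg
    subst hg
    exact ⟨y, hy⟩
  | succ n =>
    by_cases h : ∃ y', ∃ g ∈ G n, g z = δ n (j y')
    · obtain ⟨y, hy⟩ := h
      exact ⟨y, Or.inl hy⟩
    · push Not at h
      have hfin : {p : G (n + 1) | ∃ y, p.1 z = j y}.Finite := toFinite _
      obtain ⟨g, hg, y, hy⟩ := hz
      obtain ⟨p, ⟨y₀, hy₀⟩, hp⟩ := hfin.exists_minimalFor (fun p : G (n + 1) => φ (p.1 z)) _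
        ⟨⟨g, hg⟩, y, hy⟩
      refine ⟨y₀, Or.inr ⟨h, ⟨p.1, p.2, hy₀⟩, fun g' hg' y' hy' => ?_⟩⟩
      rw [← hy₀, ← hy']
      by_contra hlt
      exact hlt (hp (j := ⟨g', hg'⟩) ⟨y', hy'⟩ (not_le.1 hlt).le)

theorem Selects.unique (hinj : Function.Injective j) (hφ : Function.Injective φ)
    (hδ : ∀ n, ∀ g ∈ G n, ∀ y y', g (δ n (j y)) = δ n (j y') → y = y') {n : ℕ} {z : X} {y y' : Y}
    (h : Selects G δ φ j n z y) (h' : Selects G δ φ j n z y') : y = y' := by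
  cases n with
  | zero => exact hinj (h.symm.trans h')
  | succ n =>
    rcases h with ⟨g, hg, h⟩ | ⟨h1, ⟨g, hg, h2⟩, h3⟩ <;>
    rcases h' with ⟨g', hg', h'⟩ | ⟨h1', ⟨g', hg', h2'⟩, h3'⟩
    · refine hδ n (g' * g⁻¹) ((G n).mul_mem hg' ((G n).inv_mem hg)) y y' ?_
      rw [← h, ← h']
      simp [Homeomorph.mul_apply]
    · exact absurd h (h1' y g hg)
    · exact absurd h' (h1 y' g' hg')
    · exact hinj (hφ (le_antisymm (h3 g' hg' y' h2') (h3' g hg y h2)))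

/-- The rule at the stage `n + 1` is invariant under the preceding finite group. -/
theorem Selects.map {n : ℕ} (hmono : G n ≤ G (n + 1)) {g : X ≃ₜ X} (hg : g ∈ G n) {z : X} {y : Y}
    (h : Selects G δ φ j (n + 1) z y) : Selects G δ φ j (n + 1) (g z) y := by
  have e : ∀ (k : X ≃ₜ X), (k * g⁻¹) (g z) = k z := fun k => by simp [Homeomorph.mul_apply]
  rcases h with ⟨k, hk, h⟩ | ⟨h1, ⟨k, hk, h2⟩, h3⟩
  · exact Or.inl ⟨k * g⁻¹, (G n).mul_mem hk ((G n).inv_mem hg), by rw [e, h]⟩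
  · refine Or.inr ⟨fun y' k hk => h1 y' (k * g) ((G n).mul_mem hk hg),
      ⟨k * g⁻¹, (G _).mul_mem hk ((G _).inv_mem (hmono hg)), by rw [e, h2]⟩,
      fun k hk y' h => h3 (k * g) ((G _).mul_mem hk (hmono hg)) y' h⟩

theorem Selects.exists_mem (hδ : ∀ n, δ n ∈ G (n + 1)) (hmono : Monotone G) {n : ℕ} {z : X} {y : Y}
    (h : Selects G δ φ j n z y) : ∃ g ∈ G n, g z = j y := by
  cases n with
  | zero => exact ⟨1, (G 0).one_mem, h⟩
  | succ n =>
    rcases h with ⟨g, hg, h⟩ | ⟨-, h, -⟩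
    · refine ⟨(δ n)⁻¹ * g, (G _).mul_mem ((G _).inv_mem (hδ n)) (hmono n.le_succ hg), ?_⟩
      simp [Homeomorph.mul_apply, h]
    · exact h

end Selects

/-- The point attached to `z` depends continuously on `z`, since an element of `G n` realizing the
rule at `z` realizes it near `z`. -/
theorem Selects.eventually [CompactSpace Y] [T2Space X] {Γ : Subgroup (X ≃ₜ X)}
    (hΓ : IsPreample Γ) {G : ℕ → Subgroup (X ≃ₜ X)} {δ : ℕ → X ≃ₜ X} {φ : X → ℝ} {j : Y → X}
    [∀ n, Finite (G n)] (hG : ∀ n, G n ≤ Γ) (h₀ : G 0 = ⊥)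
    (hδ : ∀ n, δ n ∈ G (n + 1)) (hj : Continuous j) (hφ : Continuous φ)
    (hφi : Function.Injective φ) {n : ℕ} {z : X} {y : Y} (h : Selects G δ φ j n z y) {γ : X ≃ₜ X}
    (hγ : γ ∈ G n) (hz : γ z = j y) :
    ∀ᶠ w in 𝓝 z, ∀ y', γ w = j y' → Selects G δ φ j n w y' := by
  have hr : IsClosed (range j) := (isCompact_range hj).isClosed
  cases n with
  | zero =>
    rw [h₀, Subgroup.mem_bot] at hγ
    subst hγ
    exact Eventually.of_forall fun w y' hw => hw
  | succ n =>
    have hδΓ := hG _ (hδ n)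
    rcases h with ⟨g, hg, h⟩ | ⟨h1, ⟨g, hg, h2⟩, h3⟩
    · have e : (δ n * γ) z = g z := by rw [Homeomorph.mul_apply, hz, h]
      filter_upwards [hΓ.eventually_eq (Γ.mul_mem hδΓ (hG _ hγ)) (hG _ hg) e] with w hw y' hy'
      exact Or.inl ⟨g, hg, by rw [← hw, Homeomorph.mul_apply, hy']⟩
    · have e1 : ∀ᶠ w in 𝓝 z, ∀ k : G n, ((δ n)⁻¹ * k.1) w ∉ range j := by
        refine eventually_all.2 fun k => ?_
        refine ((δ n)⁻¹ * k.1).continuous.continuousAt.eventually (hr.isOpen_compl.mem_nhds ?_)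
        rintro ⟨y', hy'⟩
        refine h1 y' k.1 k.2 ?_
        rw [hy']
        simp [Homeomorph.mul_apply]
      have e2 : ∀ᶠ w in 𝓝 z, ∀ k : G (n + 1), k.1 w ∈ range j → φ (γ w) ≤ φ (k.1 w) := by
        refine eventually_all.2 fun k => ?_
        by_cases hk : k.1 z ∈ range j
        · obtain ⟨y', hy'⟩ := hk
          have hle : φ (γ z) ≤ φ (k.1 z) := by
            rw [hz, ← hy']
            exact h3 k.1 k.2 y' hy'.symm
          rcases hle.lt_or_eq with hlt | heq
          · exact ((hφ.comp γ.continuous).continuousAt.eventually_lt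
              (hφ.comp k.1.continuous).continuousAt hlt).mono fun w hw _ => hw.le
          · exact (hΓ.eventually_eq (hG _ hγ) (hG _ k.2) (hφi heq)).mono
              fun w hw _ => by rw [hw]
        · exact (k.1.continuous.continuousAt.eventually (hr.isOpen_compl.mem_nhds hk)).mono
            fun w hw hw' => absurd hw' hw
      filter_upwards [e1, e2] with w hw1 hw2 y' hy'
      refine Or.inr ⟨fun y'' k hk h => hw1 ⟨k, hk⟩ ⟨y'', ?_⟩, ⟨γ, hγ, hy'⟩, fun k hk y'' h => ?_⟩
      · rw [Homeomorph.mul_apply, h]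
        simp
      · rw [← hy', ← h]
        exact hw2 ⟨k, hk⟩ ⟨y'', h.symm⟩

end Shrink

/-- An enumeration of the nonempty clopen sets. -/
theorem exists_seq_isClopen (X : Type*) [TopologicalSpace X] [CompactSpace X] [T2Space X]
    [TotallyDisconnectedSpace X] [SecondCountableTopology X] [Nonempty X] :
    ∃ B : ℕ → Set X, (∀ n, IsClopen (B n)) ∧ (∀ n, (B n).Nonempty) ∧
      ∀ C, IsClopen C → C.Nonempty → ∃ n, B n = C := by
  have hC : Countable (TopologicalSpace.Clopens X) :=
    TopologicalSpace.Clopens.countable_iff_secondCountable.2 inferInstance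
  have : Nonempty {C : TopologicalSpace.Clopens X // (C : Set X).Nonempty} :=
    ⟨⟨⊤, univ_nonempty⟩⟩
  obtain ⟨e, he⟩ := exists_surjective_nat {C : TopologicalSpace.Clopens X // (C : Set X).Nonempty}
  refine ⟨fun n => (e n).1, fun n => (e n).1.isClopen, fun n => (e n).2, fun C hC hne => ?_⟩
  obtain ⟨n, hn⟩ := he ⟨⟨C, hC⟩, hne⟩
  exact ⟨n, congrArg (fun s => ((s.1 : TopologicalSpace.Clopens X) : Set X)) hn⟩

section Shrink

variable {X Y : Type*} [TopologicalSpace X] [TopologicalSpace Y]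

/-- The range of an étale embedding is open in its saturation under any finite subgroup. -/
theorem IsEtaleEmb.eventually_mem_range [CompactSpace Y] [T2Space X] {Γ : Subgroup (X ≃ₜ X)}
    {S : Subgroup (Y ≃ₜ Y)} {j : Y → X} (hj : IsEtaleEmb Γ S j) {G : Subgroup (X ≃ₜ X)} [Finite G]
    (hG : G ≤ Γ) {γ : X ≃ₜ X} (hγ : γ ∈ Γ) {z : X} {y : Y} (hz : γ z = j y) :
    ∀ᶠ w in 𝓝 z, (∃ g ∈ G, ∃ y, g w = j y) → ∃ y, γ w = j y := by
  have hr : IsClosed (range j) := (isCompact_range hj.continuous).isClosed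
  have key : ∀ᶠ w in 𝓝 z, ∀ g : G, (∃ y, g.1 w = j y) → ∃ y, γ w = j y := by
    refine eventually_all.2 fun g => ?_
    by_cases hg : g.1 z ∈ range j
    · obtain ⟨y₁, hy₁⟩ := hg
      obtain ⟨σ, -, hσ⟩ := hj.lower (γ * g.1⁻¹) (Γ.mul_mem hγ (Γ.inv_mem (hG g.2))) y₁ y (by
        rw [hy₁, ← hz]
        simp [Homeomorph.mul_apply])
      obtain ⟨V, hV, hVσ⟩ := exists_nhds_of_eventually hj.continuous hj.injective hσ
      rw [hy₁] at hV
      filter_upwards [g.1.continuous.continuousAt.preimage_mem_nhds hV] with w hw ⟨y', hy'⟩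
      refine ⟨σ y', ?_⟩
      rw [← hVσ y' (by rw [← hy']; exact hw), ← hy']
      simp [Homeomorph.mul_apply]
    · exact (g.1.continuous.continuousAt.eventually (hr.isOpen_compl.mem_nhds hg)).mono
        fun w hw ⟨y', hy'⟩ => absurd ⟨y', hy'.symm⟩ hw
  exact key.mono fun w hw ⟨g, hg, h⟩ => hw ⟨g, hg⟩ h

/-- A small étale embedding of `(Y, S)` into a space with an ample group `Γ` can be regarded as an
embedding of `(Y, T)` for any subgroup `T` of `S`, if `Γ` is replaced by a suitable smaller ample
group `Λ`; the orbit relation of `Γ` is then generated by that of `Λ` and the relation induced by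
`S` on the image of `Y`.

Each point of the saturation of the image of `Y` is attached to one of the points of this image in
its orbit, locally by elements of `Γ`, and `Λ` consists of the elements of `Γ` which keep apart the
points attached to `T`-inequivalent points of `Y`. It remains large enough for `j` to be small, as
`δ n` maps the image of `Y` into the `n`-th clopen set without changing the attached points. -/
theorem IsEtaleEmb.exists_shrink [CompactSpace X] [T2Space X] [TotallyDisconnectedSpace X]
    [SecondCountableTopology X] [∀ x : X, (𝓝[≠] x).NeBot] [CompactSpace Y]
    {Γ : Subgroup (X ≃ₜ X)} (hΓ : IsAmple Γ) {S T : Subgroup (Y ≃ₜ Y)} (hTS : T ≤ S) {j : Y → X}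
    (hj : IsEtaleEmb Γ S j) (hjs : IsSmall Γ j) {φ : X → ℝ} (hφ : Continuous φ)
    (hφi : Function.Injective φ) :
    ∃ Λ ≤ Γ, IsAmple Λ ∧ IsEtaleEmb Λ T j ∧ IsSmall Λ j ∧ ∀ R : Setoid X, orbitSetoid Λ ≤ R →
      (∀ σ ∈ S, ∀ y, R (j y) (j (σ y))) → orbitSetoid Γ ≤ R := by
  obtain hX | hX := isEmpty_or_nonempty X
  · have : IsEmpty Y := ⟨fun y => hX.false (j y)⟩
    exact ⟨Γ, le_rfl, hΓ, ⟨hj.continuous, hj.injective, fun _ _ y => isEmptyElim y,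
      fun _ _ y => isEmptyElim y⟩, hjs, fun R hR _ => hR⟩
  obtain ⟨B, hB, hBne, hBex⟩ := exists_seq_isClopen X
  obtain ⟨G, δ, h₀, hmono, hGfin, hG, hGex, hδ, hδB, hδj, hδw⟩ :=
    exists_exhaustion_moving hΓ hj.continuous hj.injective hjs B hB hBne
  let F : ℕ → X → Prop := fun n z => ∃ g ∈ G n, ∃ y, g z = j y
  have hFmono : ∀ {m n z}, m ≤ n → F m z → F n z := fun hmn ⟨g, hg, h⟩ => ⟨g, hmono hmn hg, h⟩
  have hFinv : ∀ {n z g}, g ∈ G n → (F n (g z) ↔ F n z) := by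
    intro n z g hg
    constructor
    · rintro ⟨k, hk, y, h⟩
      exact ⟨k * g, (G n).mul_mem hk hg, y, h⟩
    · rintro ⟨k, hk, y, h⟩
      exact ⟨k * g⁻¹, (G n).mul_mem hk ((G n).inv_mem hg), y, by simpa [Homeomorph.mul_apply]⟩
  have hFcl : ∀ n z, ¬ F n z → ∀ᶠ w in 𝓝 z, ¬ F n w := by
    intro n z hz
    have : ∀ᶠ w in 𝓝 z, ∀ g : G n, g.1 w ∉ range j := eventually_all.2 fun g =>
      g.1.continuous.continuousAt.eventually
        ((isCompact_range hj.continuous).isClosed.isOpen_compl.mem_nhds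
          fun ⟨y, hy⟩ => hz ⟨g.1, g.2, y, hy.symm⟩)
    exact this.mono fun w hw ⟨g, hg, y, h⟩ => hw ⟨g, hg⟩ ⟨y, h.symm⟩
  -- `A z y` says that the point `z` of the saturation is attached to `y`
  let A : X → Y → Prop := fun z y => ∃ n, (∀ k < n, ¬ F k z) ∧ F n z ∧ Selects G δ φ j n z y
  have hAuniq : ∀ {z y y'}, A z y → A z y' → y = y' := by
    rintro z y y' ⟨n, h1, h2, h3⟩ ⟨n', h1', h2', h3'⟩
    obtain rfl : n = n' := by
      rcases lt_trichotomy n n' with h | h | h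
      · exact absurd h2 (h1' n h)
      · exact h
      · exact absurd h2' (h1 n' h)
    exact h3.unique hj.injective hφi hδw h3'
  have hAex : ∀ {n z}, F n z → ∃ y, A z y := by
    intro n z hz
    classical
    have hex : ∃ n, F n z := ⟨n, hz⟩
    obtain ⟨y, hy⟩ := Selects.exists (δ := δ) (φ := φ) h₀ (Nat.find hex) z (Nat.find_spec hex)
    exact ⟨y, Nat.find hex, fun k hk => Nat.find_min hex hk, Nat.find_spec hex, hy⟩
  have hAj : ∀ y, A (j y) y := fun y => ⟨0, by simp, ⟨1, (G 0).one_mem, y, rfl⟩, rfl⟩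
  have hAmap : ∀ {n z g y}, g ∈ G n → ¬ F n z → A z y → A (g z) y := by
    rintro n z g y hg hz ⟨m, h1, h2, h3⟩
    have hnm : n < m := by
      by_contra h
      exact hz (hFmono (not_lt.1 h) h2)
    obtain ⟨m, rfl⟩ : ∃ m', m = m' + 1 := ⟨m - 1, by omega⟩
    have hgm : g ∈ G m := hmono (by omega) hg
    refine ⟨m + 1, fun k hk hF => ?_, (hFinv (hmono m.le_succ hgm)).2 h2,
      h3.map (hmono m.le_succ) hgm⟩
    exact h1 m (by omega) ((hFinv hgm).1 (hFmono (by omega) hF))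
  have hAloc : ∀ {z y}, A z y → ∃ γ ∈ Γ, γ z = j y ∧ ∀ n, ∀ᶠ w in 𝓝 z, F n w →
      ∃ y', γ w = j y' ∧ A w y' := by
    rintro z y ⟨m, h1, h2, h3⟩
    obtain ⟨γ, hγ, hz⟩ := h3.exists_mem hδ hmono
    refine ⟨γ, hG m hγ, hz, fun n => ?_⟩
    have e1 : ∀ᶠ w in 𝓝 z, ∀ k < m, ¬ F k w :=
      (eventually_all_finite (finite_Iio m)).2 fun k hk => hFcl k z (h1 k hk)
    filter_upwards [e1, hj.eventually_mem_range (hG n) (hG m hγ) hz,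
      h3.eventually hΓ.isPreample hG h₀ hδ hj.continuous hφ hφi hγ hz] with w hw1 hw2 hw3 hw
    obtain ⟨y', hy'⟩ := hw2 hw
    exact ⟨y', hy', m, hw1, ⟨γ, hγ, y', hy'⟩, hw3 y' hy'⟩
  have hFΓ : ∀ {z γ}, γ ∈ Γ → (∃ n, F n z) → ∃ n, F n (γ z) := by
    rintro z γ hγ ⟨n, hn⟩
    obtain ⟨m, hm⟩ := hGex γ hγ
    exact ⟨max n m, (hFinv (hmono (le_max_right n m) hm)).2 (hFmono (le_max_left n m) hn)⟩
  have hAF : ∀ {z y}, A z y → ∃ n, F n z := fun ⟨n, _, h, _⟩ => ⟨n, h⟩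
  -- the relation which keeps apart the points attached to `T`-inequivalent points
  let R : Setoid X :=
    { r := fun z w => (∃ γ ∈ Γ, γ z = w) ∧ ∀ y y', A z y → A w y' → ∃ σ ∈ T, σ y = y'
      iseqv :=
        { refl := fun z => ⟨⟨1, Γ.one_mem, rfl⟩, fun y y' h h' => ⟨1, T.one_mem, hAuniq h h'⟩⟩
          symm := by
            rintro z w ⟨⟨γ, hγ, rfl⟩, h⟩
            refine ⟨⟨γ⁻¹, Γ.inv_mem hγ, by simp⟩, fun y y' hy hy' => ?_⟩
            obtain ⟨σ, hσ, rfl⟩ := h y' y hy' hy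
            exact ⟨σ⁻¹, T.inv_mem hσ, by simp⟩
          trans := by
            rintro z w v ⟨⟨γ, hγ, rfl⟩, h⟩ ⟨⟨γ', hγ', rfl⟩, h'⟩
            refine ⟨⟨γ' * γ, Γ.mul_mem hγ' hγ, rfl⟩, fun y y' hy hy' => ?_⟩
            obtain ⟨n, hn⟩ := hFΓ hγ (hAF hy)
            obtain ⟨y₁, hy₁⟩ := hAex hn
            obtain ⟨σ, hσ, rfl⟩ := h y y₁ hy hy₁
            obtain ⟨σ', hσ', rfl⟩ := h' _ y' hy₁ hy'
            exact ⟨σ' * σ, T.mul_mem hσ' hσ, rfl⟩ } }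
  have hopen : ∀ γ ∈ Γ, ∀ z, R z (γ z) → ∀ᶠ w in 𝓝 z, R w (γ w) := by
    intro γ hγ z hz
    obtain ⟨n, hn⟩ := hGex γ hγ
    have hout : ∀ w, ¬ F n w → R w (γ w) := fun w hw => ⟨⟨γ, hγ, rfl⟩, fun y y' hy hy' =>
      ⟨1, T.one_mem, hAuniq (hAmap hn hw hy) hy'⟩⟩
    by_cases hFz : F n z
    swap
    · exact (hFcl n z hFz).mono hout
    obtain ⟨y, hy⟩ := hAex hFz
    obtain ⟨y', hy'⟩ := hAex ((hFinv hn).2 hFz)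
    obtain ⟨σ, hσ, rfl⟩ := hz.2 y y' hy hy'
    obtain ⟨α, hα, hαz, hα'⟩ := hAloc hy
    obtain ⟨β, hβ, hβz, hβ'⟩ := hAloc hy'
    obtain ⟨ε, hε, hεσ⟩ := hj.lift σ (hTS hσ) y
    obtain ⟨V, hV, hVε⟩ := exists_nhds_of_eventually hj.continuous hj.injective hεσ
    have e : (β * γ) z = (ε * α) z := by
      rw [Homeomorph.mul_apply, hβz, Homeomorph.mul_apply, hαz]
      exact hεσ.self_of_nhds
    rw [← hαz] at hV
    filter_upwards [hα' n, γ.continuous.continuousAt.eventually (hβ' n),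
      α.continuous.continuousAt.preimage_mem_nhds hV,
      hΓ.isPreample.eventually_eq (Γ.mul_mem hβ hγ) (Γ.mul_mem hε hα) e] with w hw1 hw2 hw3 hw4
    by_cases hFw : F n w
    swap
    · exact hout w hFw
    obtain ⟨y₁, hy₁, hA₁⟩ := hw1 hFw
    obtain ⟨y₂, hy₂, hA₂⟩ := hw2 ((hFinv hn).2 hFw)
    refine ⟨⟨γ, hγ, rfl⟩, fun y₃ y₄ h₃ h₄ => ⟨σ, hσ, ?_⟩⟩
    rw [hAuniq h₃ hA₁, hAuniq h₄ hA₂]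
    refine hj.injective ?_
    rw [hVε y₁ (by rw [← hy₁]; exact hw3), ← hy₁, ← hy₂]
    exact hw4.symm
  have hloc : ∀ γ ∈ Γ, ∀ z, R z (γ z) → ∃ c ∈ subgroupOfSetoid Γ R, ∀ᶠ w in 𝓝 z, c w = γ w :=
    fun γ hγ z hz => hΓ.exists_mem_subgroupOfSetoid_eventually hγ (hopen γ hγ z hz)
  refine ⟨subgroupOfSetoid Γ R, subgroupOfSetoid_le Γ R, hΓ.subgroupOfSetoid R,
    ⟨hj.continuous, hj.injective, fun σ hσ y => ?_, fun γ hγ y y' hyy' => ?_⟩, ?_, ?_⟩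
  · obtain ⟨γ, hγ, h⟩ := hj.lift σ (hTS hσ) y
    obtain ⟨c, hc, h'⟩ := hloc γ hγ (j y) (by
      refine ⟨⟨γ, hγ, rfl⟩, fun y₁ y₂ h₁ h₂ => ⟨σ, hσ, ?_⟩⟩
      rw [← h.self_of_nhds] at h₂
      rw [hAuniq h₁ (hAj y), hAuniq h₂ (hAj _)])
    exact ⟨c, hc, (h.and (hj.continuous.continuousAt.eventually h')).mono
      fun z hz => by rw [hz.1, hz.2]⟩
  · obtain ⟨σ, hσ, rfl⟩ := (hyy' ▸ hγ.2 (j y) : R (j y) (j y')).2 y y' (hAj y) (hAj y')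
    obtain ⟨ε, hε, h⟩ := hj.lift σ (hTS hσ) y
    have e := hΓ.isPreample.eventually_eq hγ.1 hε (hyy'.trans h.self_of_nhds)
    exact ⟨σ, hσ, (h.and (hj.continuous.continuousAt.eventually e)).mono
      fun z hz => by rw [hz.1, hz.2]⟩
  · intro C hC hCne
    obtain ⟨n, rfl⟩ := hBex C hC hCne
    have hδΓ := hG _ (hδ n)
    have hRδ : ∀ y, R (j y) (δ n (j y)) := by
      refine fun y => ⟨⟨δ n, hδΓ, rfl⟩, fun y₁ y₂ h₁ h₂ => ⟨1, T.one_mem, ?_⟩⟩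
      have : A (δ n (j y)) y := by
        refine ⟨n + 1, fun k hk hF => ?_, ⟨(δ n)⁻¹, (G _).inv_mem (hδ n), y, by simp⟩,
          Or.inl ⟨1, (G n).one_mem, rfl⟩⟩
        obtain ⟨g, hg, y', h⟩ := hFmono (Nat.lt_succ_iff.1 hk) hF
        exact hδj n g hg y y' h
      rw [hAuniq h₁ (hAj y), hAuniq h₂ this]
      rfl
    have hcl : IsClosed (range j) := (isCompact_range hj.continuous).isClosed
    obtain ⟨W₁, hW₁, hjW₁, hW₁s⟩ := exists_isClopen_between hcl
      ((δ n).isClosedMap _ hcl).isOpen_compl (by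
        rintro _ ⟨y, rfl⟩ ⟨_, ⟨y', rfl⟩, h⟩
        exact hδj n 1 (G n).one_mem y' y h)
    obtain ⟨W, hW, hjW, hWs⟩ := exists_isClopen_between hcl
      ((isOpen_interior (s := {z | R z (δ n z)})).inter
        (hW₁.isOpen.inter (hW₁.compl.isOpen.preimage (δ n).continuous))) (by
        rintro _ ⟨y, rfl⟩
        exact ⟨mem_interior_iff_mem_nhds.2 (hopen _ hδΓ _ (hRδ y)), hjW₁ ⟨y, rfl⟩,
          fun h => hW₁s h ⟨_, ⟨y, rfl⟩, rfl⟩⟩)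
    obtain ⟨c, hc, h⟩ := hΓ.exists_mem_subgroupOfSetoid hδΓ hW
      (fun z hz hz' => (hWs hz).2.2 (hWs hz').2.1)
      (fun z hz => interior_subset (s := {z | R z (δ n z)}) (hWs hz).1)
    exact ⟨c, hc, fun y => by rw [h _ (hjW ⟨y, rfl⟩)]; exact hδB n y⟩
  · rintro R' hR' hSR' x _ ⟨γ, hγ, rfl⟩
    have hRR' : ∀ z γ, γ ∈ Γ → R z (γ z) → R' z (γ z) := by
      intro z γ hγ hz
      obtain ⟨c, hc, h⟩ := hloc γ hγ z hz
      exact hR' ⟨c, hc, h.self_of_nhds⟩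
    have hRA : ∀ z y, A z y → R' z (j y) := by
      intro z y hy
      obtain ⟨α, hα, hαz, -⟩ := hAloc hy
      rw [← hαz]
      refine hRR' z α hα ⟨⟨α, hα, rfl⟩, fun y₁ y₂ h₁ h₂ => ⟨1, T.one_mem, ?_⟩⟩
      rw [hαz] at h₂
      rw [hAuniq h₁ hy, hAuniq h₂ (hAj y)]
      rfl
    by_cases hx : ∃ n, F n x
    · obtain ⟨n, hn⟩ := hx
      obtain ⟨y, hy⟩ := hAex hn
      obtain ⟨n', hn'⟩ := hFΓ hγ ⟨n, hn⟩
      obtain ⟨y', hy'⟩ := hAex hn'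
      refine R'.trans (hRA x y hy) (R'.trans ?_ (R'.symm (hRA _ y' hy')))
      obtain ⟨α, hα, hαz, -⟩ := hAloc hy
      obtain ⟨β, hβ, hβz, -⟩ := hAloc hy'
      obtain ⟨σ, hσ, h⟩ := hj.lower (β * γ * α⁻¹)
        (Γ.mul_mem (Γ.mul_mem hβ hγ) (Γ.inv_mem hα)) y y' (by
          rw [← hαz, ← hβz]
          simp [Homeomorph.mul_apply])
      have h1 := h.self_of_nhds
      rw [← hαz] at h1
      simp only [Homeomorph.mul_apply, Homeomorph.inv_apply, Homeomorph.symm_apply_apply, hβz] at h1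
      rw [h1]
      exact hSR' σ hσ y
    · exact hRR' x γ hγ ⟨⟨γ, hγ, rfl⟩, fun y y' hy => absurd (hAF hy) hx⟩

end Shrink

/-! ### Existence of small étale embeddings -/

section Embedding

variable {X Y : Type*} [TopologicalSpace X] [TopologicalSpace Y]

theorem IsMinimal.exists_mem_notMem [T1Space X] [∀ x : X, (𝓝[≠] x).NeBot] {Γ : Subgroup (X ≃ₜ X)}
    (hmin : IsMinimal Γ) (x : X) {U A : Set X} (hU : IsOpen U) (hne : U.Nonempty) (hA : A.Finite) :
    ∃ γ ∈ Γ, γ x ∈ U ∧ γ x ∉ A := by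
  have hd : Dense Aᶜ := by
    have := dense_univ (X := X).sdiff_finite hA
    rwa [← compl_eq_univ_sdiff] at this
  obtain ⟨_, hy, γ, hγ, rfl⟩ := (hmin x).inter_open_nonempty (U ∩ Aᶜ)
    (hU.inter hA.isClosed.isOpen_compl) (hd.inter_open_nonempty U hU hne)
  exact ⟨γ, hγ, hy.1, hy.2⟩

/-- Any finite set of points can be moved into a given clopen set. -/
theorem IsMinimal.exists_forall_mem [CompactSpace X] [T2Space X] [TotallyDisconnectedSpace X]
    [∀ x : X, (𝓝[≠] x).NeBot] {Γ : Subgroup (X ≃ₜ X)} (hΓ : IsAmple Γ) (hmin : IsMinimal Γ)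
    {B A : Set X} (hB : IsClopen B) (hne : B.Nonempty) (hA : A.Finite) :
    ∃ c ∈ Γ, ∀ a ∈ A, c a ∈ B := by
  induction A, hA using Set.Finite.induction_on with
  | empty => exact ⟨1, Γ.one_mem, by simp⟩
  | @insert a A haA hA ih =>
    obtain ⟨c, hc, hcA⟩ := ih
    by_cases hca : c a ∈ B
    · exact ⟨c, hc, by rintro b (rfl | hb); exacts [hca, hcA b hb]⟩
    obtain ⟨γ, hγ, hγB, hγA⟩ := hmin.exists_mem_notMem (c a) hB.isOpen hne (hA.image c)
    have hcl : IsClosed (c '' A) := (hA.image c).isClosed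
    obtain ⟨W, hW, haW, hWs⟩ := compact_exists_isClopen_in_isOpen
      (U := Bᶜ ∩ γ ⁻¹' B ∩ ((c '' A)ᶜ ∩ γ ⁻¹' (c '' A)ᶜ))
      ((hB.compl.isOpen.inter (hB.isOpen.preimage γ.continuous)).inter
        (hcl.isOpen_compl.inter (hcl.isOpen_compl.preimage γ.continuous))) (x := c a)
      ⟨⟨hca, hγB⟩, fun h => hca (by obtain ⟨b, hb, h⟩ := h; rw [← h]; exact hcA b hb), hγA⟩
    obtain ⟨s, hs, -, hs1, -, hs2⟩ := hΓ.exists_swap_one hγ hW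
      (fun x hx hx' => (hWs hx').1.1 (hWs hx).1.2)
    refine ⟨s * c, Γ.mul_mem hs hc, ?_⟩
    rintro b (rfl | hb)
    · rw [Homeomorph.mul_apply, hs1 _ haW]
      exact hγB
    · rw [Homeomorph.mul_apply, hs2 _ (fun h => (hWs h).2.1 ⟨b, hb, rfl⟩)
        (fun y hy h => (hWs hy).2.2 ⟨b, hb, h.symm⟩)]
      exact hcA b hb

/-- Finitely many elements `v s` of the group, none of the points `v s x` being mapped to another
one by a given finite set of homeomorphisms. -/
theorem IsMinimal.exists_free_family [T1Space X] [∀ x : X, (𝓝[≠] x).NeBot] {Γ : Subgroup (X ≃ₜ X)}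
    (hmin : IsMinimal Γ) (x : X) {U : Set X} (hU : IsOpen U) (hne : U.Nonempty)
    {F : Set (X ≃ₜ X)} (hF : F.Finite) (ι : Type*) [Finite ι] :
    ∃ v : ι → X ≃ₜ X, (∀ s, v s ∈ Γ ∧ v s x ∈ U) ∧
      ∀ s t, ∀ f ∈ F, f (v s x) = v t x → s = t := by
  have : Std.Symm (α := X ≃ₜ X) (fun a b => ∀ f ∈ F, f (a x) ≠ b x ∧ f (b x) ≠ a x) :=
    ⟨fun a b h f hf => (h f hf).symm⟩
  obtain ⟨v, hv, hr⟩ := exists_seq_of_forall_finset_exists' (fun a : X ≃ₜ X => a ∈ Γ ∧ a x ∈ U)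
    (fun a b => ∀ f ∈ F, f (a x) ≠ b x ∧ f (b x) ≠ a x) (by
      intro s _
      obtain ⟨γ, hγ, hγU, hγA⟩ := hmin.exists_mem_notMem x hU hne
        (A := ⋃ a ∈ s, ⋃ f ∈ F, {f (a x), f⁻¹ (a x)})
        (s.finite_toSet.biUnion fun _ _ => hF.biUnion fun _ _ => by simp)
      refine ⟨γ, ⟨hγ, hγU⟩, fun a ha f hf => ⟨fun h => hγA ?_, fun h => hγA ?_⟩⟩
      · simp only [mem_iUnion]
        exact ⟨a, ha, f, hf, Or.inl h.symm⟩
      · simp only [mem_iUnion]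
        exact ⟨a, ha, f, hf, Or.inr (by rw [← h]; exact (f.symm_apply_apply _).symm)⟩)
  obtain ⟨e, he⟩ := Countable.exists_injective_nat ι
  refine ⟨v ∘ e, fun s => hv _, fun s t f hf h => ?_⟩
  by_contra hst
  exact (hr (he.ne hst) f hf).1 h

/-- On small neighbourhoods of `x`, two elements of the group agree or have disjoint images. -/
theorem IsPreample.eventually_smallSets [T2Space X] {Γ : Subgroup (X ≃ₜ X)} (h : IsPreample Γ)
    {α β : X ≃ₜ X} (hα : α ∈ Γ) (hβ : β ∈ Γ) (x : X) :
    ∀ᶠ s in (𝓝 x).smallSets, (∀ w ∈ s, α w = β w) ∨ ∀ w ∈ s, ∀ w' ∈ s, α w ≠ β w' := by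
  by_cases hx : α x = β x
  · exact (eventually_smallSets_forall.2 (h.eventually_eq hα hβ hx)).mono fun s hs => Or.inl hs
  · obtain ⟨V, W, hV, hW, hαV, hβW, hd⟩ := t2_separation hx
    filter_upwards [eventually_smallSets_forall.2 (α.continuous.continuousAt.preimage_mem_nhds
      (hV.mem_nhds hαV)), eventually_smallSets_forall.2 (β.continuous.continuousAt.preimage_mem_nhds
      (hW.mem_nhds hβW))] with s h1 h2
    exact Or.inr fun w hw w' hw' e => hd.ne_of_mem (h1 w hw) (h2 w' hw') e

/-- The state of the recursive construction of an embedding: the clopen sets `g y '' U`, for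
`y : Y`, approximate the embedding, two of them being disjoint unless `y` and `y'` lie in the
same class of `P`. -/
structure Approx (Γ : Subgroup (X ≃ₜ X)) (S : Subgroup (Y ≃ₜ Y)) (x : X) (g : Y → X ≃ₜ X)
    (U : Set X) (P : DiscreteQuotient Y) : Prop where
  isClopen : IsClopen U
  mem : x ∈ U
  adapted : Adapted S P
  mem_group : ∀ y, g y ∈ Γ
  eq_of_rel : ∀ y y', P.toSetoid y y' → g y = g y'
  rel : ∀ y y', ∀ u ∈ U, ∀ u' ∈ U, g y u = g y' u' → P.toSetoid y y'

/-- One step of the recursive construction of an embedding: the new sets `g' y '' U'` lie in the old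
ones, the passage from `g` to `g'` is `S`-invariant, the returns of the new sets under the finite
group `G` come from `S`, each of the new sets is contained in or disjoint from `B`, and all of them
can be moved into `B` simultaneously. -/
structure ApproxStep (Γ G : Subgroup (X ≃ₜ X)) (S : Subgroup (Y ≃ₜ Y)) (B : Set X)
    (g : Y → X ≃ₜ X) (U : Set X) (g' : Y → X ≃ₜ X) (U' : Set X) : Prop where
  map : ∀ y, ∀ u ∈ U', ∃ w ∈ U, g' y u = g y w
  equivariant : ∀ σ ∈ S, ∀ y, (g (σ y))⁻¹ * g' (σ y) = (g y)⁻¹ * g' y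
  lower : ∀ γ ∈ G, ∀ y y', ∀ u ∈ U', ∀ u' ∈ U', γ (g' y u) = g' y' u' →
    ∃ σ ∈ S, ∀ᶠ z in 𝓝 y, ∀ w ∈ U', γ (g' z w) = g' (σ z) w
  decide : ∀ y, ∀ u ∈ U', ∀ u' ∈ U', g' y u ∈ B → g' y u' ∈ B
  small : ∃ c ∈ Γ, ∀ y, ∀ u ∈ U', c (g' y u) ∈ B

/-- The new map is `g' y = g y * k y`, where `k y = k z` exactly when `z` is in the same class of
`P'` as a point of the `T`-orbit of `y`, and where the values of `k` are chosen freely enough for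
`G` not to map `g' y x` to `g' z x` unless `k y = k z`. -/
theorem Approx.exists_step [CompactSpace X] [T2Space X] [TotallyDisconnectedSpace X]
    [∀ x : X, (𝓝[≠] x).NeBot] [CompactSpace Y] [T2Space Y] [TotallyDisconnectedSpace Y]
    {Γ : Subgroup (X ≃ₜ X)} (hΓ : IsAmple Γ) (hmin : IsMinimal Γ) {S T T' : Subgroup (Y ≃ₜ Y)}
    (hS : IsPreample S) (hT : T ≤ T') (hT'S : T' ≤ S) [Finite T'] {x : X} {g : Y → X ≃ₜ X}
    {U : Set X} {P : DiscreteQuotient Y} (h : Approx Γ T x g U P) {G : Subgroup (X ≃ₜ X)} [Finite G]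
    (hG : G ≤ Γ) {B : Set X} (hB : IsClopen B) (hne : B.Nonempty) (Q : DiscreteQuotient Y) :
    ∃ (g' : Y → X ≃ₜ X) (U' : Set X) (P' : DiscreteQuotient Y), Approx Γ T' x g' U' P' ∧ P' ≤ Q ∧
      ApproxStep Γ G T B g U g' U' := by
  obtain ⟨P', hP', hA⟩ := hS.exists_adapted T' ‹_› hT'S (P ⊓ Q)
  have hP'P : ∀ {y z}, P'.toSetoid y z → P.toSetoid y z := fun h => (hP' h).1
  -- the classes of `E` are the `T`-orbits of classes of `P'`
  obtain ⟨E, hE⟩ : ∃ E : DiscreteQuotient Y, ∀ y z, E.toSetoid y z ↔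
      ∃ σ ∈ T, P'.toSetoid z (σ y) := ⟨
    { r := fun y z => ∃ σ ∈ T, P'.toSetoid z (σ y)
      iseqv :=
        { refl := fun y => ⟨1, T.one_mem, P'.refl _⟩
          symm := by
            rintro y z ⟨σ, hσ, h⟩
            refine ⟨σ⁻¹, T.inv_mem hσ, ?_⟩
            have := hA.map _ (T'.inv_mem (hT hσ)) _ _ (P'.symm _ _ h)
            simpa using this
          trans := by
            rintro y z w ⟨σ, hσ, h⟩ ⟨τ, hτ, h'⟩
            exact ⟨τ * σ, T.mul_mem hτ hσ, P'.trans _ _ _ h' (hA.map τ (hT hτ) _ _ h)⟩ }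
      isOpen_setOfPred_rel := fun y => by
        rw [isOpen_iff_mem_nhds]
        rintro z ⟨σ, hσ, h⟩
        filter_upwards [(P'.isOpen_setOfPred_rel z).mem_nhds (P'.refl z)] with w hw
        exact ⟨σ, hσ, P'.trans _ _ _ (P'.symm _ _ hw) h⟩ }, fun _ _ => Iff.rfl⟩
  have hgfin : (range g).Finite := by
    have : range g ⊆ range fun q : P => g (Quotient.out q) := by
      rintro _ ⟨y, rfl⟩
      refine ⟨P.proj y, h.eq_of_rel _ _ ?_⟩
      exact Quotient.mk_out (s := P.toSetoid) y
    exact (finite_range _).subset this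
  obtain ⟨v, hv, hvf⟩ := hmin.exists_free_family x h.isClopen.isOpen ⟨x, h.mem⟩
    (F := (fun p : (X ≃ₜ X) × (X ≃ₜ X) × (X ≃ₜ X) => p.2.1⁻¹ * p.1 * p.2.2) ''
      ((G : Set (X ≃ₜ X)) ×ˢ range g ×ˢ range g))
    (((toFinite _).prod (hgfin.prod hgfin)).image _) E
  let k : Y → X ≃ₜ X := fun y => v (E.proj y)
  have hkE : ∀ {y z}, E.toSetoid y z → k y = k z := fun {y z} hyz =>
    congrArg v ((proj_eq_proj_iff E).2 hyz)
  have hkfree : ∀ γ ∈ G, ∀ y z, γ (g y (k y x)) = g z (k z x) → E.toSetoid y z := by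
    intro γ hγ y z e
    refine (proj_eq_proj_iff E).1 (hvf _ _ _ ⟨(γ, g z, g y), ⟨hγ, ⟨z, rfl⟩, ⟨y, rfl⟩⟩, rfl⟩ ?_)
    change (g z)⁻¹ (γ (g y (k y x))) = k z x
    rw [e]
    exact (g z).symm_apply_apply _
  let g' : Y → X ≃ₜ X := fun y => g y * k y
  have hg'Γ : ∀ y, g' y ∈ Γ := fun y => Γ.mul_mem (h.mem_group y) (hv _).1
  have hP'E : ∀ {y z}, P'.toSetoid y z → E.toSetoid y z := fun hyz =>
    (hE _ _).2 ⟨1, T.one_mem, P'.symm _ _ hyz⟩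
  have hg'P : ∀ y z, P'.toSetoid y z → g' y = g' z := by
    intro y z hyz
    change g y * k y = g z * k z
    rw [h.eq_of_rel _ _ (hP'P hyz), hkE (hP'E hyz)]
  have hkfin : (range k).Finite := (finite_range v).subset (by rintro _ ⟨y, rfl⟩; exact ⟨_, rfl⟩)
  have hg'fin : (range g').Finite := by
    refine ((hgfin.prod hkfin).image fun p => p.1 * p.2).subset ?_
    rintro _ ⟨y, rfl⟩
    exact ⟨(g y, k y), ⟨⟨y, rfl⟩, ⟨y, rfl⟩⟩, rfl⟩
  obtain ⟨c, hc, hcB⟩ := hmin.exists_forall_mem hΓ hB hne (hg'fin.image fun a => a x)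
  have e1 : ∀ᶠ s in (𝓝 x).smallSets, ∀ a ∈ range k, ∀ w ∈ s, a w ∈ U := by
    refine (eventually_all_finite hkfin).2 ?_
    rintro _ ⟨y, rfl⟩
    exact eventually_smallSets_forall.2 ((k y).continuous.continuousAt.preimage_mem_nhds
      (h.isClopen.isOpen.mem_nhds (hv _).2))
  have e2 : ∀ᶠ s in (𝓝 x).smallSets, ∀ a ∈ range g', ∀ w ∈ s, c (a w) ∈ B := by
    refine (eventually_all_finite hg'fin).2 fun a ha => ?_
    exact eventually_smallSets_forall.2 ((c * a).continuous.continuousAt.preimage_mem_nhds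
      (hB.isOpen.mem_nhds (hcB _ ⟨a, ha, rfl⟩)))
  have e3 : ∀ᶠ s in (𝓝 x).smallSets, ∀ a ∈ range g', ∀ w ∈ s, (a w ∈ B ↔ a x ∈ B) := by
    refine (eventually_all_finite hg'fin).2 fun a ha => ?_
    by_cases hx : a x ∈ B
    · filter_upwards [eventually_smallSets_forall.2 (a.continuous.continuousAt.preimage_mem_nhds
        (hB.isOpen.mem_nhds hx))] with s hs w hw
      exact iff_of_true (hs w hw) hx
    · filter_upwards [eventually_smallSets_forall.2 (a.continuous.continuousAt.preimage_mem_nhds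
        (hB.compl.isOpen.mem_nhds hx))] with s hs w hw
      exact iff_of_false (hs w hw) hx
  have e4 : ∀ᶠ s in (𝓝 x).smallSets, ∀ γ : G, ∀ a ∈ range g', ∀ b ∈ range g',
      (∀ w ∈ s, γ.1 (a w) = b w) ∨ ∀ w ∈ s, ∀ w' ∈ s, γ.1 (a w) ≠ b w' := by
    refine eventually_all.2 fun γ => (eventually_all_finite hg'fin).2 fun a ha =>
      (eventually_all_finite hg'fin).2 fun b hb => ?_
    obtain ⟨y, rfl⟩ := ha
    obtain ⟨z, rfl⟩ := hb
    exact hΓ.isPreample.eventually_smallSets (Γ.mul_mem (hG γ.2) (hg'Γ y)) (hg'Γ z) x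
  obtain ⟨V, hV, hVs⟩ := eventually_smallSets.1 (e1.and (e2.and (e3.and e4)))
  obtain ⟨U', hU', hxU', hU'V⟩ := compact_exists_isClopen_in_isOpen isOpen_interior
    (mem_interior_iff_mem_nhds.2 hV)
  obtain ⟨h1, h2, h3, h4⟩ := hVs U' (hU'V.trans interior_subset)
  have key : ∀ γ ∈ G, ∀ y z, ∀ u ∈ U', ∀ u' ∈ U', γ (g' y u) = g' z u' →
      (∀ w ∈ U', γ (g' y w) = g' z w) ∧ ∃ σ ∈ T, P'.toSetoid z (σ y) := by
    intro γ hγ y z u hu u' hu' e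
    have := (h4 ⟨γ, hγ⟩ _ ⟨y, rfl⟩ _ ⟨z, rfl⟩).resolve_right fun hn => hn u hu u' hu' e
    exact ⟨this, (hE _ _).1 (hkfree γ hγ y z (this x hxU'))⟩
  refine ⟨g', U', P', ⟨hU', hxU', hA, hg'Γ, hg'P, ?_⟩, fun _ _ hyz => (hP' hyz).2,
    ⟨?_, ?_, ?_, ?_, ?_⟩⟩
  · intro y z u hu u' hu' e
    obtain ⟨-, σ, hσ, hσz⟩ := key 1 G.one_mem y z u hu u' hu' e
    have hyz := h.rel y z _ (h1 _ ⟨y, rfl⟩ u hu) _ (h1 _ ⟨z, rfl⟩ u' hu') e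
    have := h.adapted.fix σ hσ y (P.trans _ _ _ hyz (hP'P hσz))
    rw [this] at hσz
    exact P'.symm _ _ hσz
  · exact fun y u hu => ⟨k y u, h1 _ ⟨y, rfl⟩ u hu, rfl⟩
  · intro σ hσ y
    have : k (σ y) = k y := (hkE ((hE _ _).2 ⟨σ, hσ, P'.refl _⟩)).symm
    simp [g', this]
  · intro γ hγ y z u hu u' hu' e
    obtain ⟨h5, σ, hσ, hσz⟩ := key γ hγ y z u hu u' hu' e
    refine ⟨σ, hσ, ?_⟩
    filter_upwards [(P'.isOpen_setOfPred_rel y).mem_nhds (P'.refl y)] with w hw t ht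
    rw [← hg'P _ _ hw, h5 t ht, hg'P _ _ hσz, hg'P _ _ (hA.map σ (hT hσ) _ _ hw)]
  · exact fun y u hu u' hu' hu1 => (h3 _ ⟨y, rfl⟩ u' hu').2 ((h3 _ ⟨y, rfl⟩ u hu).1 hu1)
  · exact ⟨c, hc, fun y u hu => h2 _ ⟨y, rfl⟩ u hu⟩

/-- A minimal ample group admits small étale embeddings of every locally finite countable group
whose elements have clopen fixed point sets: `i y` is the only point of `⋂ n, g n y '' U n`. -/
theorem IsAmple.exists_isEtaleEmb [CompactSpace X] [T2Space X] [TotallyDisconnectedSpace X]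
    [SecondCountableTopology X] [∀ x : X, (𝓝[≠] x).NeBot] [Nonempty X] [CompactSpace Y] [T2Space Y]
    [TotallyDisconnectedSpace Y] [SecondCountableTopology Y] {Γ : Subgroup (X ≃ₜ X)}
    (hΓ : IsAmple Γ) (hmin : IsMinimal Γ) {S : Subgroup (Y ≃ₜ Y)} (hS : IsPreample S) :
    ∃ i : Y → X, IsEtaleEmb Γ S i ∧ IsSmall Γ i := by
  obtain ⟨x⟩ := ‹Nonempty X›
  have : Nonempty X := ⟨x⟩
  obtain ⟨B, hB, hBne, hBex⟩ := exists_seq_isClopen X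
  obtain ⟨Q, hQ⟩ := exists_seq_discreteQuotient (X := Y)
  obtain ⟨G, hGmono, hGfin, hGΓ, hGex⟩ := hΓ.isPreample.exists_exhaustion
  obtain ⟨S', hS'mono, hS'fin, hS'S, hS'ex⟩ := hS.exists_exhaustion
  -- Starting with the trivial group makes the initial state trivial.
  let T : ℕ → Subgroup (Y ≃ₜ Y) := fun n => Nat.casesOn n ⊥ S'
  have hTfin : ∀ n, Finite (T (n + 1)) := fun n => hS'fin n
  have hTS : ∀ n, T n ≤ S := fun n => Nat.casesOn n bot_le hS'S
  have hTmono : Monotone T := monotone_nat_of_le_succ fun n =>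
    Nat.casesOn n bot_le fun n => hS'mono n.le_succ
  obtain ⟨f, hf, hstep⟩ := exists_seq_of_step
    (p := fun n (a : (Y → X ≃ₜ X) × Set X × DiscreteQuotient Y) =>
      Approx Γ (T n) x a.1 a.2.1 a.2.2)
    (r := fun n a b => b.2.2 ≤ Q n ∧ ApproxStep Γ (G n) (T n) (B n) a.1 a.2.1 b.1 b.2.1)
    ⟨(fun _ => 1, univ, ⊤), isClopen_univ, mem_univ _, ⟨fun _ _ _ _ _ => trivial, fun γ hγ y _ => by
      rw [Subgroup.mem_bot.1 hγ]; rfl⟩, fun _ => Γ.one_mem, fun _ _ _ => rfl,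
      fun _ _ _ _ _ _ _ => trivial⟩
    (fun n a ha => by
      obtain ⟨g', U', P', h1, h2, h3⟩ := Approx.exists_step hΓ hmin hS (hTmono n.le_succ)
        (hTS (n + 1)) ha (hGΓ n) (hB n) (hBne n) (Q n)
      exact ⟨(g', U', P'), h1, h2, h3⟩)
  let g : ℕ → Y → X ≃ₜ X := fun n => (f n).1
  let U : ℕ → Set X := fun n => (f n).2.1
  let P : ℕ → DiscreteQuotient Y := fun n => (f n).2.2
  have ha : ∀ n, Approx Γ (T n) x (g n) (U n) (P n) := hf
  have hs : ∀ n, ApproxStep Γ (G n) (T n) (B n) (g n) (U n) (g (n + 1)) (U (n + 1)) :=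
    fun n => (hstep n).2
  have hex : ∀ y, (⋂ n, g n y '' U n).Nonempty := by
    intro y
    have hcl : ∀ n, IsClosed (g n y '' U n) := fun n =>
      (g n y).isClosedMap _ (ha n).isClopen.isClosed
    refine IsCompact.nonempty_iInter_of_sequence_nonempty_isCompact_isClosed _ (fun n => ?_)
      (fun n => ⟨_, x, (ha n).mem, rfl⟩) (hcl 0).isCompact hcl
    rintro _ ⟨u, hu, rfl⟩
    obtain ⟨w, hw, e⟩ := (hs n).map y u hu
    exact ⟨w, hw, e.symm⟩
  choose i hi using hex
  have hi : ∀ n y, ∃ u ∈ U n, g n y u = i y := fun n y => mem_iInter.1 (hi y) n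
  have hdec : ∀ n y z z', z ∈ g (n + 1) y '' U (n + 1) → z' ∈ g (n + 1) y '' U (n + 1) →
      z ∈ B n → z' ∈ B n := by
    rintro n y _ _ ⟨u, hu, rfl⟩ ⟨u', hu', rfl⟩
    exact (hs n).decide y u hu u' hu'
  have huniq : ∀ y z, (∀ᶠ n in atTop, z ∈ g n y '' U n) → z = i y := by
    intro y z hz
    have hanti : Antitone fun n => g n y '' U n := antitone_nat_of_succ_le fun n => by
      rintro _ ⟨u, hu, rfl⟩
      obtain ⟨w, hw, e⟩ := (hs n).map y u hu
      exact ⟨w, hw, e.symm⟩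
    obtain ⟨N, hN⟩ := eventually_atTop.1 hz
    have hz : ∀ n, z ∈ g n y '' U n := fun n =>
      hanti (le_max_left n N) (hN _ (le_max_right n N))
    by_contra hne
    obtain ⟨C, hC, hzC, hCi⟩ := compact_exists_isClopen_in_isOpen
      (isOpen_compl_singleton (x := i y)) (show z ∈ _ from hne)
    obtain ⟨n, rfl⟩ := hBex C hC ⟨_, hzC⟩
    exact hCi (hdec n y _ _ (hz _) (hi _ y) hzC) rfl
  have hequi : ∀ m n, m ≤ n → ∀ σ ∈ T m, ∀ y,
      g n (σ y) * (g n y)⁻¹ = g m (σ y) * (g m y)⁻¹ := by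
    intro m n hmn σ hσ y
    induction n, hmn using Nat.le_induction with
    | base => rfl
    | succ n hmn ih =>
      rw [← ih]
      have := (hs n).equivariant σ (hTmono hmn hσ) y
      rw [inv_mul_eq_iff_eq_mul] at this
      rw [this]
      simp [mul_assoc]
  have hlift : ∀ m, ∀ σ ∈ T m, ∀ y, i (σ y) = g m (σ y) ((g m y)⁻¹ (i y)) := by
    intro m σ hσ y
    refine (huniq _ _ (eventually_atTop.2 ⟨m, fun n hn => ?_⟩)).symm
    obtain ⟨u, hu, e⟩ := hi n y
    refine ⟨u, hu, ?_⟩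
    have := DFunLike.congr_fun (hequi m n hn σ hσ y) (i y)
    simp only [Homeomorph.mul_apply] at this
    rw [← this, ← e]
    congr 1
    exact ((g n y).symm_apply_apply u).symm
  have hnear : ∀ n y, ∀ᶠ z in 𝓝 y, g n z = g n y := fun n y => by
    filter_upwards [((P n).isOpen_setOfPred_rel y).mem_nhds ((P n).refl y)] with z hz
    exact ((ha n).eq_of_rel _ _ hz).symm
  refine ⟨i, ⟨?_, ?_, ?_, ?_⟩, ?_⟩
  · rw [continuous_iff_continuousAt]
    intro y V hV
    rw [mem_map]
    obtain ⟨C, hC, hyC, hCV⟩ := compact_exists_isClopen_in_isOpen isOpen_interior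
      (mem_interior_iff_mem_nhds.2 hV)
    obtain ⟨n, rfl⟩ := hBex C hC ⟨_, hyC⟩
    filter_upwards [hnear (n + 1) y] with z hz
    refine (interior_subset : interior V ⊆ V) (hCV (hdec n y _ _ (hi _ y) ?_ hyC))
    rw [← hz]
    exact hi _ z
  · intro y z hyz
    refine hQ y z fun n => ?_
    obtain ⟨u, hu, e⟩ := hi (n + 1) y
    obtain ⟨u', hu', e'⟩ := hi (n + 1) z
    exact (hstep n).1 ((ha (n + 1)).rel y z u hu u' hu' (by rw [e, e', hyz]))
  · intro σ hσ y
    obtain ⟨n, hn⟩ := hS'ex σ hσ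
    refine ⟨g (n + 1) (σ y) * (g (n + 1) y)⁻¹,
      Γ.mul_mem ((ha _).mem_group _) (Γ.inv_mem ((ha _).mem_group _)), ?_⟩
    filter_upwards [hnear (n + 1) y, σ.continuous.continuousAt.eventually (hnear (n + 1) (σ y))]
      with z h1 h2
    rw [hlift (n + 1) σ hn, h1, h2]
    rfl
  · intro γ hγ y y' e
    obtain ⟨n, hn⟩ := hGex γ hγ
    obtain ⟨u, hu, e1⟩ := hi (n + 1) y
    obtain ⟨u', hu', e2⟩ := hi (n + 1) y'
    obtain ⟨σ, hσ, h⟩ := (hs n).lower γ hn y y' u hu u' hu' (by rw [e1, e2, e])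
    refine ⟨σ, hTS n hσ, h.mono fun z hz => ?_⟩
    obtain ⟨w, hw, e3⟩ := hi (n + 1) z
    rw [hlift (n + 1) σ (hTmono n.le_succ hσ), ← e3, hz w hw]
    congr 1
    exact ((g (n + 1) z).symm_apply_apply w).symm
  · intro C hC hne
    obtain ⟨n, rfl⟩ := hBex C hC hne
    obtain ⟨c, hc, h⟩ := (hs n).small
    refine ⟨c, hc, fun y => ?_⟩
    obtain ⟨u, hu, e⟩ := hi (n + 1) y
    rw [← e]
    exact h y u hu

end Embedding

/-! ### Groups acting on the levels of `Z × ℕ∞` -/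

section Level

variable {Z : Type*} [TopologicalSpace Z]

open Classical in
/-- The map of `Z × ℕ∞` which acts as `τ n` on the level `Z × {n}`, and trivially on `Z × {⊤}`. -/
noncomputable def levelFun (τ : ℕ → Z ≃ₜ Z) (p : Z × ℕ∞) : Z × ℕ∞ :=
  (if p.2 = ⊤ then p.1 else τ p.2.toNat p.1, p.2)

@[simp]
theorem levelFun_natCast (τ : ℕ → Z ≃ₜ Z) (z : Z) (n : ℕ) :
    levelFun τ (z, (n : ℕ∞)) = (τ n z, (n : ℕ∞)) := by
  simp [levelFun]

@[simp]
theorem levelFun_top (τ : ℕ → Z ≃ₜ Z) (z : Z) : levelFun τ (z, ⊤) = (z, ⊤) := by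
  simp [levelFun]

theorem levelFun_mul (τ τ' : ℕ → Z ≃ₜ Z) (p : Z × ℕ∞) :
    levelFun (τ * τ') p = levelFun τ (levelFun τ' p) := by
  obtain ⟨z, e⟩ := p
  induction e using ENat.recTopCoe <;> simp [Homeomorph.mul_apply]

theorem levelFun_one (p : Z × ℕ∞) : levelFun (1 : ℕ → Z ≃ₜ Z) p = p := by
  obtain ⟨z, e⟩ := p
  induction e using ENat.recTopCoe <;> simp [Homeomorph.one_apply]

theorem exists_eventually_levelFun {τ : ℕ → Z ≃ₜ Z} (hτ : ∀ᶠ m in atTop, τ m = 1) (e : ℕ∞) :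
    ∃ σ : Z ≃ₜ Z, (σ = 1 ∨ σ ∈ range τ) ∧ ∀ᶠ e' in 𝓝 e, ∀ z, levelFun τ (z, e') = (σ z, e') := by
  induction e using ENat.recTopCoe with
  | top =>
    obtain ⟨N, hN⟩ := eventually_atTop.1 hτ
    refine ⟨1, Or.inl rfl, ?_⟩
    filter_upwards [Ioi_mem_nhds (ENat.natCast_lt_top N)] with e' he' z
    induction e' using ENat.recTopCoe with
    | top => simp [Homeomorph.one_apply]
    | coe n => rw [levelFun_natCast, hN n (by exact_mod_cast (mem_Ioi.1 he').le)]
  | coe n =>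
    refine ⟨τ n, Or.inr ⟨n, rfl⟩, ?_⟩
    filter_upwards [(ENat.isOpen_singleton (ENat.natCast_ne_top n)).mem_nhds rfl] with e' he' z
    rw [mem_singleton_iff.1 he', levelFun_natCast]

theorem continuous_levelFun {τ : ℕ → Z ≃ₜ Z} (hτ : ∀ᶠ m in atTop, τ m = 1) :
    Continuous (levelFun τ) := by
  rw [continuous_iff_continuousAt]
  rintro ⟨z, e⟩
  obtain ⟨σ, -, hσ⟩ := exists_eventually_levelFun hτ e
  have : Continuous fun p : Z × ℕ∞ => (σ p.1, p.2) := by fun_prop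
  refine this.continuousAt.congr ?_
  filter_upwards [continuous_snd.continuousAt.eventually hσ] with p hp
  exact (hp p.1).symm

/-- The homeomorphism `levelFun τ`. -/
noncomputable def levelHomeo (τ : ℕ → Z ≃ₜ Z) (hτ : ∀ᶠ m in atTop, τ m = 1) :
    Z × ℕ∞ ≃ₜ Z × ℕ∞ where
  toFun := levelFun τ
  invFun := levelFun τ⁻¹
  left_inv p := by rw [← levelFun_mul, inv_mul_cancel, levelFun_one]
  right_inv p := by rw [← levelFun_mul, mul_inv_cancel, levelFun_one]
  continuous_toFun := continuous_levelFun hτ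
  continuous_invFun := continuous_levelFun (hτ.mono fun m hm => by simp [hm])

/-- The restricted direct product of the groups `T n`, the factor `T n` acting on `Z × {n}`. -/
def levelGroup (T : ℕ → Subgroup (Z ≃ₜ Z)) : Subgroup (Z × ℕ∞ ≃ₜ Z × ℕ∞) where
  carrier := {g | ∃ τ : ℕ → Z ≃ₜ Z, (∀ m, τ m ∈ T m) ∧ (∀ᶠ m in atTop, τ m = 1) ∧
    ∀ p, g p = levelFun τ p}
  mul_mem' := by
    rintro g g' ⟨τ, h1, h2, h3⟩ ⟨τ', h1', h2', h3'⟩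
    refine ⟨τ * τ', fun m => (T m).mul_mem (h1 m) (h1' m), ?_, fun p => ?_⟩
    · filter_upwards [h2, h2'] with m hm hm'
      simp [hm, hm']
    · rw [levelFun_mul, Homeomorph.mul_apply, h3, h3']
  one_mem' := ⟨1, fun m => (T m).one_mem, Eventually.of_forall fun _ => rfl,
    fun p => (levelFun_one p).symm⟩
  inv_mem' := by
    rintro g ⟨τ, h1, h2, h3⟩
    refine ⟨τ⁻¹, fun m => (T m).inv_mem (h1 m), h2.mono fun m hm => by simp [hm], fun p => ?_⟩
    change g.symm p = _
    rw [Homeomorph.symm_apply_eq, h3, ← levelFun_mul, mul_inv_cancel, levelFun_one]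

theorem levelHomeo_mem {T : ℕ → Subgroup (Z ≃ₜ Z)} {τ : ℕ → Z ≃ₜ Z} (hτ : ∀ᶠ m in atTop, τ m = 1)
    (h : ∀ m, τ m ∈ T m) : levelHomeo τ hτ ∈ levelGroup T :=
  ⟨τ, h, hτ, fun _ => rfl⟩

theorem levelGroup_mono {T T' : ℕ → Subgroup (Z ≃ₜ Z)} (h : ∀ m, T m ≤ T' m) :
    levelGroup T ≤ levelGroup T' := by
  rintro g ⟨τ, h1, h2, h3⟩
  exact ⟨τ, fun m => h m (h1 m), h2, h3⟩

/-- An element of one of the factors, as an element of the restricted direct product. -/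
theorem exists_mem_levelGroup {T : ℕ → Subgroup (Z ≃ₜ Z)} {n : ℕ} {σ : Z ≃ₜ Z} (hσ : σ ∈ T n) :
    ∃ g ∈ levelGroup T, ∀ z, g (z, (n : ℕ∞)) = (σ z, (n : ℕ∞)) := by
  classical
  have hs : ∀ᶠ m in atTop, Pi.mulSingle (M := fun _ => Z ≃ₜ Z) n σ m = 1 := by
    filter_upwards [eventually_gt_atTop n] with m hm
    exact Pi.mulSingle_eq_of_ne hm.ne' _
  refine ⟨levelHomeo (Pi.mulSingle n σ) hs, levelHomeo_mem hs fun m => ?_, fun z => ?_⟩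
  · by_cases hm : m = n
    · subst hm
      rwa [Pi.mulSingle_eq_same]
    · rw [Pi.mulSingle_eq_of_ne hm]
      exact (T m).one_mem
  · change levelFun _ _ = _
    simp

theorem isPreample_levelGroup {S : Subgroup (Z ≃ₜ Z)} (hS : IsPreample S) :
    IsPreample (levelGroup fun _ => S) := by
  have ext : ∀ (N : ℕ) (g g' : Z × ℕ∞ ≃ₜ Z × ℕ∞) (τ τ' : ℕ → Z ≃ₜ Z), (∀ p, g p = levelFun τ p) →
      (∀ p, g' p = levelFun τ' p) → (∀ m, N ≤ m → τ m = 1) → (∀ m, N ≤ m → τ' m = 1) →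
      (∀ m < N, τ m = τ' m) → g = g' := by
    intro N g g' τ τ' h h' h1 h1' h2
    have : τ = τ' := by
      funext m
      obtain hm | hm := lt_or_ge m N
      · exact h2 m hm
      · rw [h1 m hm, h1' m hm]
    ext1 p
    rw [h, h', this]
  refine ⟨?_, ?_, ?_⟩
  · have := hS.countable
    choose τ hτ hτ1 hτg using fun g : levelGroup fun _ => S => g.2
    choose N hN using fun g => eventually_atTop.1 (hτ1 g)
    let f : (levelGroup fun _ => S) → Σ n : ℕ, (Fin n → S) := fun g =>
      ⟨N g, fun m => ⟨τ g m, hτ g m⟩⟩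
    have hf : Function.Injective f := by
      intro g g' e
      have e1 : N g = N g' := congrArg Sigma.fst e
      have e2 : ∀ m < N g, τ g m = τ g' m := by
        intro m hm
        have := congrArg (fun a : Σ n : ℕ, (Fin n → S) =>
          if h : m < a.1 then ((a.2 ⟨m, h⟩ : S) : Z ≃ₜ Z) else 1) e
        simpa [f, hm, e1 ▸ hm] using this
      exact Subtype.ext (ext (N g) _ _ _ _ (hτg g) (hτg g') (hN g) (e1 ▸ hN g') e2)
    exact hf.countable
  · intro F hF
    choose τ hτ hτ1 hτg using fun g : F => hF g.2
    obtain ⟨N, hN⟩ := eventually_atTop.1 (eventually_all.2 hτ1)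
    obtain ⟨G, hG, hGS, hGτ⟩ := hS.exists_finite_le
      (F := range fun p : F × Fin N => τ p.1 p.2) (finite_range _) (by
        rintro _ ⟨p, rfl⟩
        exact hτ _ _)
    let T : ℕ → Subgroup (Z ≃ₜ Z) := fun m => if m < N then G else ⊥
    have hle : Subgroup.closure (F : Set (Z × ℕ∞ ≃ₜ Z × ℕ∞)) ≤ levelGroup T := by
      rw [Subgroup.closure_le]
      intro g hg
      refine ⟨τ ⟨g, hg⟩, fun m => ?_, hτ1 _, hτg ⟨g, hg⟩⟩
      by_cases hm : m < N
      · simp only [T, if_pos hm]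
        exact hGτ ⟨(⟨g, hg⟩, ⟨m, hm⟩), rfl⟩
      · simp only [T, if_neg hm]
        exact Subgroup.mem_bot.2 (hN m (not_lt.1 hm) _)
    have hT1 : ∀ m, N ≤ m → ∀ σ ∈ T m, σ = 1 := by
      intro m hm σ hσ
      simp only [T, if_neg (not_lt.2 hm)] at hσ
      exact Subgroup.mem_bot.1 hσ
    have hfin : Finite (levelGroup T) := by
      choose τ hτ hτ1 hτg using fun g : levelGroup T => g.2
      let f : levelGroup T → (Fin N → G) := fun g m => ⟨τ g m, by
        have := hτ g m
        simpa only [T, if_pos m.2] using this⟩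
      have hf : Function.Injective f := by
        intro g g' e
        refine Subtype.ext (ext N _ _ _ _ (hτg g) (hτg g') (fun m hm => hT1 m hm _ (hτ g m))
          (fun m hm => hT1 m hm _ (hτ g' m)) fun m hm => ?_)
        exact congrArg Subtype.val (congrFun e ⟨m, hm⟩)
      exact Finite.of_injective f hf
    exact (toFinite (levelGroup T : Set (Z × ℕ∞ ≃ₜ Z × ℕ∞))).subset hle
  · rintro g ⟨τ, hτ, hτ1, hg⟩
    have key : ∀ p : Z × ℕ∞, ∃ C : Set Z, IsClopen C ∧ ∀ᶠ q in 𝓝 p, (g q = q ↔ q.1 ∈ C) := by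
      rintro ⟨z, e⟩
      obtain ⟨σ, hσ, he⟩ := exists_eventually_levelFun hτ1 e
      have hσS : σ ∈ S := by
        obtain rfl | ⟨m, rfl⟩ := hσ
        exacts [S.one_mem, hτ m]
      refine ⟨_, hS.isClopen_fixedPoints σ hσS, ?_⟩
      filter_upwards [continuous_snd.continuousAt.eventually he] with q hq
      have := hq q.1
      rw [hg, show q = (q.1, q.2) from rfl, this, Prod.mk.injEq]
      simp
    constructor
    · rw [← isOpen_compl_iff, isOpen_iff_mem_nhds]
      intro p hp
      obtain ⟨C, hC, h⟩ := key p
      have hpC : p.1 ∈ Cᶜ := fun h' => hp (h.self_of_nhds.2 h')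
      filter_upwards [h, continuous_fst.continuousAt.preimage_mem_nhds
        (hC.compl.isOpen.mem_nhds hpC)] with q hq hqC hgq
      exact hqC (hq.1 hgq)
    · rw [isOpen_iff_mem_nhds]
      intro p hp
      obtain ⟨C, hC, h⟩ := key p
      filter_upwards [h, continuous_fst.continuousAt.preimage_mem_nhds
        (hC.isOpen.mem_nhds (h.self_of_nhds.1 hp))] with q hq hqC
      exact hq.2 hqC

/-- The shift of `Z × ℕ∞`, a homeomorphism onto the complement of the level `Z × {0}`. -/
def shift {Z : Type*} (p : Z × ℕ∞) : Z × ℕ∞ := (p.1, p.2 + 1)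

theorem continuous_shift : Continuous (shift : Z × ℕ∞ → Z × ℕ∞) :=
  continuous_fst.prodMk (continuous_snd.add continuous_const)

theorem shift_injective {Z : Type*} : Function.Injective (shift : Z × ℕ∞ → Z × ℕ∞) := by
  rintro ⟨z, e⟩ ⟨z', e'⟩ h
  simp only [shift, Prod.mk.injEq] at h
  rw [h.1, ENat.add_left_injective_of_ne_top ENat.one_ne_top h.2]

theorem levelFun_shift (τ : ℕ → Z ≃ₜ Z) (p : Z × ℕ∞) :
    levelFun τ (shift p) = shift (levelFun (fun m => τ (m + 1)) p) := by
  obtain ⟨z, e⟩ := p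
  induction e using ENat.recTopCoe with
  | top => simp [shift]
  | coe n =>
    have := levelFun_natCast τ z (n + 1)
    simp only [shift, levelFun_natCast]
    exact_mod_cast this

/-- The shift carries the action of `T` on the levels to that of a group on the levels above. -/
theorem exists_shift_eq {T T' : ℕ → Subgroup (Z ≃ₜ Z)} (h : ∀ m, T m ≤ T' (m + 1))
    {g : Z × ℕ∞ ≃ₜ Z × ℕ∞} (hg : g ∈ levelGroup T) :
    ∃ g' ∈ levelGroup T', ∀ p, shift (g p) = g' (shift p) := by
  obtain ⟨τ, h1, h2, h3⟩ := hg
  let τ' : ℕ → Z ≃ₜ Z := fun m => Nat.casesOn m 1 τ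
  have hτ' : ∀ᶠ m in atTop, τ' m = 1 := by
    obtain ⟨N, hN⟩ := eventually_atTop.1 h2
    filter_upwards [eventually_ge_atTop (N + 1)] with m hm
    obtain ⟨m, rfl⟩ := Nat.exists_eq_add_of_le' (Nat.le_of_add_left_le hm)
    exact hN m (by omega)
  refine ⟨levelHomeo τ' hτ', levelHomeo_mem hτ' fun m => ?_, fun p => ?_⟩
  · cases m with
    | zero => exact (T' 0).one_mem
    | succ m => exact h m (h1 m)
  · change _ = levelFun τ' _
    rw [levelFun_shift, h3]

/-- The restriction of a group of level maps to the positive levels, carried back by the shift. -/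
theorem exists_eq_shift {T T' : ℕ → Subgroup (Z ≃ₜ Z)} (h : ∀ m, T (m + 1) ≤ T' m)
    {g : Z × ℕ∞ ≃ₜ Z × ℕ∞} (hg : g ∈ levelGroup T) :
    ∃ g' ∈ levelGroup T', ∀ p, g (shift p) = shift (g' p) := by
  obtain ⟨τ, h1, h2, h3⟩ := hg
  have h2' : ∀ᶠ m in atTop, τ (m + 1) = 1 := (tendsto_add_atTop_nat 1).eventually h2
  exact ⟨levelHomeo (fun m => τ (m + 1)) h2', levelHomeo_mem h2' fun m => h m (h1 (m + 1)),
    fun p => by rw [h3, levelFun_shift]; rfl⟩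

variable {X : Type*} [TopologicalSpace X] {Γ : Subgroup (X ≃ₜ X)}

theorem IsEtaleEmb.shift {T : Subgroup (Z ≃ₜ Z)} {j : Z × ℕ∞ → X}
    (hj : IsEtaleEmb Γ (levelGroup fun _ => T) j) :
    IsEtaleEmb Γ (levelGroup fun _ => T) (j ∘ AmpleGroup.shift) where
  continuous := hj.continuous.comp continuous_shift
  injective := hj.injective.comp shift_injective
  lift σ hσ p := by
    obtain ⟨σ', hσ', e⟩ := exists_shift_eq (T' := fun _ => T) (fun _ => le_rfl) hσ
    obtain ⟨γ, hγ, h⟩ := hj.lift σ' hσ' (AmpleGroup.shift p)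
    refine ⟨γ, hγ, (continuous_shift.continuousAt.eventually h).mono fun q hq => ?_⟩
    rw [Function.comp_apply, e, hq, Function.comp_apply]
  lower γ hγ p p' hp := by
    obtain ⟨σ, hσ, h⟩ := hj.lower γ hγ _ _ hp
    obtain ⟨σ', hσ', e⟩ := exists_eq_shift (T' := fun _ => T) (fun _ => le_rfl) hσ
    refine ⟨σ', hσ', (continuous_shift.continuousAt.eventually h).mono fun q hq => ?_⟩
    rw [Function.comp_apply, hq, e, Function.comp_apply]

theorem IsEtaleEmb.level {T : ℕ → Subgroup (Z ≃ₜ Z)} {j : Z × ℕ∞ → X}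
    (hj : IsEtaleEmb Γ (levelGroup T) j) (n : ℕ) : IsEtaleEmb Γ (T n) fun z => j (z, n) := by
  have hc : Continuous fun z : Z => (z, (n : ℕ∞)) := Continuous.prodMk_left _
  refine ⟨hj.continuous.comp hc, fun z z' h => congrArg Prod.fst (hj.injective h), ?_, ?_⟩
  · intro σ hσ z
    obtain ⟨g, hg, hgz⟩ := exists_mem_levelGroup hσ
    obtain ⟨γ, hγ, h⟩ := hj.lift g hg (z, n)
    refine ⟨γ, hγ, (hc.continuousAt.eventually h).mono fun w hw => ?_⟩
    rw [← hw, hgz]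
  · intro γ hγ z z' e
    obtain ⟨g, ⟨τ, hτ, -, hg⟩, h⟩ := hj.lower γ hγ _ _ e
    refine ⟨τ n, hτ n, (hc.continuousAt.eventually h).mono fun w hw => ?_⟩
    rw [hw, hg, levelFun_natCast]

end Level

/-! ### The induced group -/

section Induced

variable {X : Type*} [TopologicalSpace X] {Γ : Subgroup (X ≃ₜ X)} {K : Set X}

theorem IsEtale.isClopen_preimage (hK : IsEtale Γ K) {γ : X ≃ₜ X} (hγ : γ ∈ Γ) :
    IsClopen {z : K | γ z ∈ K} := by
  convert hK _ (Γ.inv_mem hγ) univ isClopen_univ using 1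
  ext z
  simp only [mem_ofPred_eq, mem_preimage, mem_image, mem_univ, true_and]
  constructor
  · exact fun h => ⟨γ z, ⟨⟨γ z, h⟩, rfl⟩, γ.symm_apply_apply _⟩
  · rintro ⟨_, ⟨w, rfl⟩, h⟩
    rw [← h]
    have : γ (γ⁻¹ w) = w := γ.apply_symm_apply _
    rw [this]
    exact w.2

/-- The homeomorphisms of `K` which are, locally, given by elements of `Γ`. -/
def restrictedGroup (Γ : Subgroup (X ≃ₜ X)) (K : Set X) : Subgroup (K ≃ₜ K) where
  carrier := {g | ∀ z, ∃ γ ∈ Γ, ∀ᶠ w : K in 𝓝 z, (g w : X) = γ w}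
  mul_mem' := by
    intro g g' hg hg' z
    obtain ⟨γ, hγ, h⟩ := hg (g' z)
    obtain ⟨γ', hγ', h'⟩ := hg' z
    refine ⟨γ * γ', Γ.mul_mem hγ hγ', ?_⟩
    filter_upwards [h', g'.continuous.continuousAt.eventually h] with w h1 h2
    rw [Homeomorph.mul_apply, h2, h1, Homeomorph.mul_apply]
  one_mem' z := ⟨1, Γ.one_mem, Eventually.of_forall fun _ => rfl⟩
  inv_mem' := by
    intro g hg z
    obtain ⟨γ, hγ, h⟩ := hg (g⁻¹ z)
    refine ⟨γ⁻¹, Γ.inv_mem hγ, (g⁻¹.continuous.continuousAt.eventually h).mono fun w hw => ?_⟩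
    have : g (g⁻¹ w) = w := g.apply_symm_apply w
    rw [this] at hw
    rw [hw]
    exact (γ.symm_apply_apply _).symm

theorem isFull_restrictedGroup : IsFull (restrictedGroup Γ K) := by
  refine isFull_of_fullGroup_subset ?_
  rintro g ⟨n, U, γ, hU, -, hcov, hγ, h⟩ z
  obtain ⟨i, hi⟩ := mem_iUnion.1 (hcov.symm ▸ mem_univ z : z ∈ ⋃ i, U i)
  obtain ⟨δ, hδ, h'⟩ := hγ i z
  refine ⟨δ, hδ, ?_⟩
  filter_upwards [h', (hU i).isOpen.mem_nhds hi] with w h1 h2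
  rw [h i w h2, h1]

theorem IsEtale.inducedGroup_le (hK : IsEtale Γ K) : inducedGroup Γ K ≤ restrictedGroup Γ K := by
  refine sInf_le ⟨isFull_restrictedGroup, fun γ hγ _ g hg z => ?_⟩
  have hcl := hK.isClopen_preimage hγ
  by_cases hz : γ z ∈ K
  · refine ⟨γ, hγ, ?_⟩
    filter_upwards [hcl.isOpen.mem_nhds hz] with w hw
    exact (hg w).1 hw
  · refine ⟨1, Γ.one_mem, ?_⟩
    filter_upwards [hcl.compl.isOpen.mem_nhds hz] with w hw
    exact congrArg Subtype.val ((hg w).2 hw)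

/-- The inclusion of an étale set is an étale embedding of the induced group. -/
theorem IsEtale.isEtaleEmb_val [CompactSpace X] [T2Space X] [TotallyDisconnectedSpace X]
    (hΓ : IsAmple Γ) (hK : IsEtale Γ K) :
    IsEtaleEmb Γ (inducedGroup Γ K) (Subtype.val : K → X) := by
  refine ⟨continuous_subtype_val, Subtype.val_injective, fun σ hσ z => hK.inducedGroup_le hσ z, ?_⟩
  intro γ hγ y y' e
  by_cases hyy : γ y = y
  · refine ⟨1, Subgroup.one_mem _, ?_⟩
    have := hΓ.isPreample.eventually_eq hγ Γ.one_mem (x := (y : X)) hyy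
    exact continuous_subtype_val.continuousAt.eventually this
  obtain ⟨A, B, hA, hB, hyA, hyB, hAB⟩ := t2_separation hyy
  obtain ⟨W, hW, hyW, hWs⟩ := compact_exists_isClopen_in_isOpen
    (hB.inter (hA.preimage γ.continuous)) ⟨hyB, hyA⟩
  obtain ⟨c, hc, hcc, hcW, -, -⟩ := hΓ.exists_swap_one hγ hW
    (fun x hx hx' => hAB.ne_of_mem (hWs hx).2 (hWs hx').1 rfl)
  have hc2 : c * c = 1 := Homeomorph.ext hcc
  obtain ⟨g, hg⟩ := exists_isInducedMap hK hc hc2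
  refine ⟨g, Subgroup.mem_sInf.2 fun H hH => hH.2 c hc hc2 g hg, ?_⟩
  filter_upwards [(hK.isClopen_preimage hγ).isOpen.mem_nhds (show γ y ∈ K from e ▸ y'.2),
    continuous_subtype_val.continuousAt.preimage_mem_nhds (hW.isOpen.mem_nhds hyW)] with z h1 h2
  rw [← hcW _ h2, ((hg z).1 ?_)]
  rw [hcW _ h2]
  exact h1

end Induced

/-! ### The Cantor space -/

section Cantor

theorem exists_continuous_injective_real : ∃ f : (ℕ → Bool) → ℝ, Continuous f ∧
    Function.Injective f :=
  ⟨fun x => cantorSetHomeomorphNatToBool.symm x,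
    continuous_subtype_val.comp cantorSetHomeomorphNatToBool.symm.continuous,
    Subtype.val_injective.comp cantorSetHomeomorphNatToBool.symm.injective⟩

theorem neBot_nhdsNE_of_homeomorph {X : Type*} [TopologicalSpace X] (e : X ≃ₜ (ℕ → Bool)) (x : X) :
    (𝓝[≠] x).NeBot := by
  let u : ℕ → X := fun n => e.symm (Function.update (e x) n (!e x n))
  have hu : Tendsto u atTop (𝓝 x) := by
    have : Tendsto (fun n => Function.update (e x) n (!e x n)) atTop (𝓝 (e x)) := by
      refine tendsto_pi_nhds.2 fun m => tendsto_const_nhds.congr' ?_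
      filter_upwards [eventually_gt_atTop m] with n hn
      rw [Function.update_of_ne hn.ne]
    simpa [u, Function.comp_def] using (e.symm.continuous.tendsto (e x)).comp this
  have hne : ∀ n, u n ≠ x := by
    intro n h
    have := congrFun (congrArg e h) n
    simp [u] at this
  exact (tendsto_nhdsWithin_iff.2 ⟨hu, Eventually.of_forall hne⟩).neBot

end Cantor

/-! ### Absorption -/

section Absorption

variable {X : Type*} [TopologicalSpace X] {Γ : Subgroup (X ≃ₜ X)} {K : Set X}

theorem orbitSetoid_le_glue (S : Subgroup (K ≃ₜ K)) : orbitSetoid Γ ≤ glue Γ K S :=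
  le_sInf fun _ h => h.1

theorem glue_rel {S : Subgroup (K ≃ₜ K)} {σ : K ≃ₜ K} (hσ : σ ∈ S) (x : K) :
    glue Γ K S x (σ x) := by
  intro R hR
  exact hR.2 σ hσ x

/-- The absorption theorem for a closed set `K` whose inclusion is a small étale embedding of
`(K, D)`.

The group `levelGroup A` acts by `D` on the level `K × {0}` and by `S` on the other levels of
`K × ℕ∞`. Through a small étale embedding `j` extending the inclusion of `K = K × {0}`, the relation
`R_Γ` is generated by the relation `R_Λ` of a smaller group and by the action of `S` on all levels
but the first one, while `glue Γ K S` is generated by `R_Λ` and the action of `S` on all levels. A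
homeomorphism normalizing `Λ` and extending the shift identifies the two relations. -/
theorem IsAmple.exists_orbit_equiv [CompactSpace X] [T2Space X] [TotallyDisconnectedSpace X]
    [SecondCountableTopology X] [∀ x : X, (𝓝[≠] x).NeBot] [Nonempty X] {φ : X → ℝ}
    (hφ : Continuous φ) (hφi : Function.Injective φ) (hΓ : IsAmple Γ) (hmin : IsMinimal Γ)
    (hK : IsClosed K) {D S : Subgroup (K ≃ₜ K)} (hDS : D ≤ S) (hS : IsPreample S)
    (hemb : IsEtaleEmb Γ D (Subtype.val : K → X)) (hsmall : IsSmall Γ (Subtype.val : K → X)) :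
    OrbitEquivalent (glue Γ K S) (orbitSetoid Γ) := by
  have : CompactSpace K := isCompact_iff_compactSpace.1 hK.isCompact
  let A : ℕ → Subgroup (K ≃ₜ K) := fun n => Nat.casesOn n D fun _ => S
  have hDA : ∀ n, D ≤ A n := fun n => Nat.casesOn n le_rfl fun _ => hDS
  have hAS : ∀ n, A n ≤ S := fun n => Nat.casesOn n hDS fun _ => le_rfl
  obtain ⟨j₀, hj₀, hj₀s⟩ := hΓ.exists_isEtaleEmb hmin
    ((isPreample_levelGroup hS).mono (levelGroup_mono hAS))
  obtain ⟨H, hH, hHj⟩ := IsEtaleEmb.exists_conj hΓ (hj₀.level 0) hemb (fun B hB hne => by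
    obtain ⟨γ, hγ, h⟩ := hj₀s B hB hne
    exact ⟨γ, hγ, fun _ => h _⟩) hsmall
  obtain ⟨j, hj, hjs, hj0⟩ : ∃ j : K × ℕ∞ → X, IsEtaleEmb Γ (levelGroup A) j ∧ IsSmall Γ j ∧
      ∀ z : K, j (z, 0) = z :=
    ⟨H ∘ j₀, hj₀.comp hH, hj₀s.comp fun γ hγ => (hH γ).1 hγ, hHj⟩
  obtain ⟨Λ, hΛΓ, hΛ, hΛj, hΛs, hR⟩ := hj.exists_shrink hΓ
    (levelGroup_mono (T := fun _ => D) hDA) hjs hφ hφi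
  -- for `Λ` all the levels look alike, so that the shift of the levels extends to `X`
  obtain ⟨H, hH, hHj⟩ := IsEtaleEmb.exists_conj hΛ hΛj hΛj.shift hΛs (fun B hB hne => by
    obtain ⟨γ, hγ, h⟩ := hΛs B hB hne
    exact ⟨γ, hγ, fun _ => h _⟩)
  have hjΓ : ∀ g ∈ levelGroup A, ∀ p, orbitSetoid Γ (j p) (j (g p)) := by
    intro g hg p
    obtain ⟨γ, hγ, h⟩ := hj.lift g hg p
    exact ⟨γ, hγ, h.self_of_nhds.symm⟩
  have hsucc : ∀ n : ℕ, ∀ σ ∈ S, ∀ z : K,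
      orbitSetoid Γ (j (z, (n + 1 : ℕ))) (j (σ z, (n + 1 : ℕ))) := by
    intro n σ hσ z
    obtain ⟨g, hg, h⟩ := exists_mem_levelGroup (T := A) (n := n + 1) hσ
    rw [← h]
    exact hjΓ g hg _
  have hshift : ∀ z : K, ∀ n : ℕ, shift (z, (n : ℕ∞)) = (z, ((n + 1 : ℕ) : ℕ∞)) := by
    intro z n
    simp [shift]
  refine ⟨H, fun x y => ⟨?_, ?_⟩⟩
  · suffices h : glue Γ K S ≤ (orbitSetoid Γ).comap H from fun hxy => h hxy
    refine sInf_le ⟨hR _ ?_ ?_, ?_⟩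
    · rintro x _ ⟨γ, hγ, rfl⟩
      exact ⟨_, hΛΓ ((hH γ).1 hγ), by simp [Homeomorph.mul_apply]⟩
    · intro g hg p
      obtain ⟨g', hg', e⟩ := exists_shift_eq (T' := A) hAS hg
      change orbitSetoid Γ (H _) (H _)
      rw [hHj, hHj, Function.comp_apply, Function.comp_apply, e]
      exact hjΓ g' hg' _
    · intro σ hσ z
      change orbitSetoid Γ (H _) (H _)
      rw [← hj0, ← hj0, hHj, hHj, Function.comp_apply, Function.comp_apply]
      have := hsucc 0 σ hσ z
      rwa [← hshift, ← hshift] at this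
  · suffices h : orbitSetoid Γ ≤ (glue Γ K S).comap H.symm by
      intro hxy
      have : glue Γ K S (H.symm (H x)) (H.symm (H y)) := h hxy
      simpa using this
    have hΛR : orbitSetoid Λ ≤ (glue Γ K S).comap H.symm := by
      rintro x _ ⟨γ, hγ, rfl⟩
      refine orbitSetoid_le_glue S ⟨H⁻¹ * γ * H, hΛΓ ((hH _).2 ?_), ?_⟩
      · simpa [mul_assoc] using hγ
      · simp [Homeomorph.mul_apply, Homeomorph.inv_apply]
    refine hR _ hΛR ?_
    rintro g ⟨τ, hτ, -, hg⟩ ⟨z, e⟩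
    rw [hg]
    induction e using ENat.recTopCoe with
    | top =>
      rw [levelFun_top]
    | coe n =>
      rw [levelFun_natCast]
      cases n with
      | zero =>
        obtain ⟨g', hg', h⟩ := exists_mem_levelGroup (T := fun _ => D) (n := 0) (hτ 0)
        obtain ⟨γ, hγ, h'⟩ := hΛj.lift g' hg' (z, ((0 : ℕ) : ℕ∞))
        refine hΛR ⟨γ, hγ, ?_⟩
        rw [← h'.self_of_nhds, h]
      | succ n =>
        have hHs : ∀ w : K, H.symm (j (w, ((n + 1 : ℕ) : ℕ∞))) = j (w, (n : ℕ∞)) := by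
          intro w
          rw [Homeomorph.symm_apply_eq, hHj, Function.comp_apply, hshift]
        change glue Γ K S (H.symm _) (H.symm _)
        rw [hHs, hHs]
        have hτS : τ (n + 1) ∈ S := hτ (n + 1)
        cases n with
        | zero =>
          have := glue_rel (Γ := Γ) hτS z
          rw [← hj0, ← hj0] at this
          exact this
        | succ n => exact orbitSetoid_le_glue S (hsucc n _ hτS z)

end Absorption

end AmpleGroup

theorem mainTheorem1 {X : Type*} [TopologicalSpace X] [MeasurableSpace X] [BorelSpace X]
    (hX : Nonempty (X ≃ₜ (ℕ → Bool)))
    (Γ : Subgroup (X ≃ₜ X)) (hΓ : AmpleGroup.IsAmple Γ) (hmin : AmpleGroup.IsMinimal Γ)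
    (K : Set X) (hK : AmpleGroup.IsMalleable Γ K)
    (S : Subgroup (K ≃ₜ K)) (hS : AmpleGroup.IsAmple S)
    (hKS : AmpleGroup.inducedGroup Γ K ≤ S) :
    AmpleGroup.OrbitEquivalent (AmpleGroup.glue Γ K S) (AmpleGroup.orbitSetoid Γ) := by
  obtain ⟨e⟩ := hX
  have : CompactSpace X := e.symm.compactSpace
  have : T2Space X := e.isEmbedding.t2Space
  have : TotallyDisconnectedSpace X := e.symm.totallyDisconnectedSpace
  have : SecondCountableTopology X := e.isEmbedding.secondCountableTopology
  have : Nonempty X := ⟨e.symm fun _ => false⟩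
  have := AmpleGroup.neBot_nhdsNE_of_homeomorph e
  obtain ⟨f, hf, hfi⟩ := AmpleGroup.exists_continuous_injective_real
  exact hΓ.exists_orbit_equiv (hf.comp e.continuous) (hfi.comp e.injective) hmin hK.isClosed hKS
    hS.isPreample (hK.etale.isEtaleEmb_val hΓ) (hK.thin.isSmall hΓ hmin hK.isClosed)
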